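/- Let $\mathbb{K}$ be a field of characteristic zero, let $q\in\mathbb{K}^{\ast}$ be not a root of unity, and let $m,p$ be natural numbers; put $n=mp$. Let $R=\mathcal{O}_q(M_{m,p}(\mathbb{K}))$ be the algebra of quantum matrices: it is generated by $X_{ij}$ ($1\le i\le m$, $1\le j\le p$) with relations, for $i<k$ and $j<l$: $X_{ij}X_{kj}=qX_{kj}X_{ij}$, $X_{ij}X_{il}=qX_{il}X_{ij}$, $X_{il}X_{kj}=X_{kj}X_{il}$, $X_{ij}X_{kl}-X_{kl}X_{ij}=(q-q^{-1})X_{il}X_{kj}$. Let $A$ be its semiclassical limit, i.e. the polynomial algebra $\mathbb{K}[X_{ij}]$ with the Poisson bracket given, for $i<k$ and $j<l$, by $\{X_{ij},X_{kj}\}=X_{ij}X_{kj}$, $\{X_{ij},X_{il}\}=X_{ij}X_{il}$, $\{X_{il},X_{kj}\}=0$, $\{X_{ij},X_{kl}\}=2X_{il}X_{kj}$. Let $\mathrm{Spec}(R)$ be the set of prime ideals of $R$ with the Zariski topology, and $\mathrm{P.Spec}(A)$ the set of prime ideals of $A$ that are Poisson ideals, with the topology induced from $\mathrm{Spec}(A)$.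 Order the indices $(i,j)$ lexicographically. The deleting derivations algorithm (Cauchon's algorithm for $R$, the Poisson deleting derivations algorithm for $A$) starts in the (skew) field of fractions $F$ of $R$, respectively $A$, from the family $(X_{ij})$ and takes successively as pivot $(k,l)$ the $n$-th, $(n-1)$-th, …, second index; the step with pivot $(k,l)$ replaces a family $U=(U_{ij})$ by the family $V=(V_{ij})$ with $V_{ij}=U_{ij}-U_{il}U_{kl}^{-1}U_{kj}$ if $i<k$ and $j<l$, and $V_{ij}=U_{ij}$ otherwise. Let $C$ and $C'$ be the subalgebras of $F$ generated by $U$ and by $V$. To a (Poisson) prime ideal $P$ of $C$ this step associates the following (Poisson) prime ideal of $C'$: if $U_{kl}\notin P$, the ideal $PS^{-1}\cap C'$ with $S=\{U_{kl}^r\mid r\ge0\}$; if $U_{kl}\in P$, the preimage of $P/\langle U_{kl}\rangle$ under the homomorphism $C'\to C/\langle U_{kl}\rangle$ sending each $V_{ij}$ to the class of $U_{ij}$ (where $\langle U_{kl}\rangle$ is the ideal, respectively Poisson ideal, generated by $U_{kl}$). Composing the steps gives the canonical embedding $\varphi$ into the (Poisson) spectrum of the algebra generated by the last family $(T_{ij})$.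 For $w\subseteq [1,m]\times[1,p]$ let $\mathrm{Spec}_w(R)$ (respectively $\mathrm{P.Spec}_w(A)$) be the set of those $P$ in $\mathrm{Spec}(R)$ (respectively $\mathrm{P.Spec}(A)$) such that $\varphi(P)$ contains exactly those $T_{ij}$ with $(i,j)\in w$. Let $W'$ (respectively $W'_P$) be the set of all $w$ for which $\mathrm{Spec}_w(R)$ (respectively $\mathrm{P.Spec}_w(A)$) is nonempty. Let $\boldsymbol\lambda$ be the skew-symmetric matrix indexed by $[1,m]\times[1,p]$ whose entry at $(a,b)$ is $1$ if $a$ and $b$ lie in the same row or the same column and $a$ precedes $b$ there, $-1$ if $b$ precedes $a$ there, and $0$ otherwise (so that $T_aT_b=q^{\lambda_{ab}}T_bT_a$ on the quantum side and $\{T_a,T_b\}=\lambda_{ab}T_aT_b$ on the Poisson side). Let $M(w)$ be obtained from $\boldsymbol\lambda$ by deleting the rows and columns indexed by the elements of $w$. Then: 1. $W'=W'_P$. 2. For every $w\in W'=W'_P$ there are homeomorphisms $$\mathrm{P.Spec}_w(A)\;\cong\;\mathrm{Spec}\big(\mathbb{K}[U_1^{\pm1},\dots,U_s^{\pm1}]\big)\;\cong\;\mathrm{Spec}_w(R),\qquad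 s=\dim_{\mathbb{Q}}\ker M(w).$$ 3. There is a bijection $\mathrm{Spec}(R)\to\mathrm{P.Spec}(A)$ that restricts, for every $w\in W'=W'_P$, to a homeomorphism from $\mathrm{Spec}_w(R)$ onto $\mathrm{P.Spec}_w(A)$. -/

import Mathlib

noncomputable section

/-! ## Prime spectrum of a noncommutative ring -/

/-- A two-sided ideal `P` of a (not necessarily commutative) ring is prime if it is proper and
`a R b ⊆ P` implies `a ∈ P` or `b ∈ P`; equivalently, `I J ⊆ P` implies `I ⊆ P` or `J ⊆ P` for
two-sided ideals `I`, `J`. -/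
def TwoSidedIdealIsPrime {R : Type*} [Ring R] (P : TwoSidedIdeal R) : Prop :=
  (1 : R) ∉ P ∧ ∀ a b : R, (∀ r : R, a * r * b ∈ P) → a ∈ P ∨ b ∈ P

/-- The set of prime (two-sided) ideals of a ring. -/
def NCSpec (R : Type*) [Ring R] : Type _ :=
  {P : TwoSidedIdeal R // TwoSidedIdealIsPrime P}

/-- The closed sets of the Zariski topology: `V(S) = {P | S ⊆ P}`. -/
def NCSpec.zeroLocus {R : Type*} [Ring R] (S : Set R) : Set (NCSpec R) :=
  {P | ∀ s ∈ S, s ∈ P.1}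

/-- The Zariski topology on the set of prime ideals. -/
instance NCSpec.zariskiTopology (R : Type*) [Ring R] : TopologicalSpace (NCSpec R) :=
  TopologicalSpace.ofClosed (Set.range NCSpec.zeroLocus)
    ⟨Set.univ, by
      ext P
      simp only [NCSpec.zeroLocus, Set.mem_ofPred_eq, Set.mem_empty_iff_false, iff_false]
      exact fun h => P.2.1 (h 1 (Set.mem_univ _))⟩
    (by
      intro A hA
      refine ⟨{r | ∃ S : Set R, NCSpec.zeroLocus S ∈ A ∧ r ∈ S}, ?_⟩
      ext P
      simp only [NCSpec.zeroLocus, Set.mem_ofPred_eq, Set.mem_sInter]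
      constructor
      · intro h Z hZ
        obtain ⟨S, rfl⟩ := hA hZ
        exact fun s hs => h s ⟨S, hZ, hs⟩
      · rintro h r ⟨S, hS, hr⟩
        exact h _ hS r hr)
    (by
      rintro _ ⟨S, rfl⟩ _ ⟨T, rfl⟩
      refine ⟨{x | ∃ s ∈ S, ∃ t ∈ T, ∃ r : R, x = s * r * t}, ?_⟩
      ext P
      simp only [NCSpec.zeroLocus, Set.mem_ofPred_eq, Set.mem_union]
      constructor
      · intro h
        by_contra hc
        push Not at hc
        obtain ⟨⟨s, hs, hsP⟩, ⟨t, ht, htP⟩⟩ := hc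
        rcases P.2.2 s t (fun r => h _ ⟨s, hs, t, ht, r, rfl⟩) with h1 | h1
        · exact hsP h1
        · exact htP h1
      · rintro (h | h) x ⟨s, hs, t, ht, r, rfl⟩
        · exact P.1.mul_mem_right _ _ (P.1.mul_mem_right _ _ (h s hs))
        · exact P.1.mul_mem_left _ _ (h t ht))

/-! ## Quantum matrices -/

/-- Defining relations of the one-parameter quantum matrices `O_q(M_{m,p}(K))`; the generator
`X_{ij}` is `FreeAlgebra.ι K (i, j)`. -/
inductive QuantumMatrixRel {K : Type*} [Field K] (q : K) (m p : ℕ) :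
    FreeAlgebra K (Fin m × Fin p) → FreeAlgebra K (Fin m × Fin p) → Prop
  | col (i k : Fin m) (j : Fin p) (hik : i < k) :
      QuantumMatrixRel q m p
        (FreeAlgebra.ι K (i, j) * FreeAlgebra.ι K (k, j))
        (q • (FreeAlgebra.ι K (k, j) * FreeAlgebra.ι K (i, j)))
  | row (i : Fin m) (j l : Fin p) (hjl : j < l) :
      QuantumMatrixRel q m p
        (FreeAlgebra.ι K (i, j) * FreeAlgebra.ι K (i, l))
        (q • (FreeAlgebra.ι K (i, l) * FreeAlgebra.ι K (i, j)))
  | anti (i k : Fin m) (j l : Fin p) (hik : i < k) (hlj : l < j) :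
      QuantumMatrixRel q m p
        (FreeAlgebra.ι K (i, j) * FreeAlgebra.ι K (k, l))
        (FreeAlgebra.ι K (k, l) * FreeAlgebra.ι K (i, j))
  | diag (i k : Fin m) (j l : Fin p) (hik : i < k) (hjl : j < l) :
      QuantumMatrixRel q m p
        (FreeAlgebra.ι K (i, j) * FreeAlgebra.ι K (k, l))
        (FreeAlgebra.ι K (k, l) * FreeAlgebra.ι K (i, j)
          + (q - q⁻¹) • (FreeAlgebra.ι K (i, l) * FreeAlgebra.ι K (k, j)))

/-- The algebra of quantum matrices `R = O_q(M_{m,p}(K))`. -/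
abbrev QuantumMatrices {K : Type*} [Field K] (q : K) (m p : ℕ) : Type _ :=
  RingQuot (QuantumMatrixRel q m p)

/-- Relations for the ring obtained from a `K`-algebra `R` by formally inverting all nonzero
elements: `inl r` stands for `r`, and `inr r` for `r⁻¹` (`r ≠ 0`). -/
inductive FractionsRel (K : Type*) [Field K] (R : Type*) [Ring R] [Algebra K R] :
    FreeAlgebra K (R ⊕ {r : R // r ≠ 0}) → FreeAlgebra K (R ⊕ {r : R // r ≠ 0}) → Prop
  | scalar (c : K) : FractionsRel K R
      (FreeAlgebra.ι K (Sum.inl (algebraMap K R c)))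
      (algebraMap K (FreeAlgebra K (R ⊕ {r : R // r ≠ 0})) c)
  | add (r s : R) : FractionsRel K R
      (FreeAlgebra.ι K (Sum.inl (r + s)))
      (FreeAlgebra.ι K (Sum.inl r) + FreeAlgebra.ι K (Sum.inl s))
  | mul (r s : R) : FractionsRel K R
      (FreeAlgebra.ι K (Sum.inl (r * s)))
      (FreeAlgebra.ι K (Sum.inl r) * FreeAlgebra.ι K (Sum.inl s))
  | mul_inv (r : {r : R // r ≠ 0}) : FractionsRel K R
      (FreeAlgebra.ι K (Sum.inl r.1) * FreeAlgebra.ι K (Sum.inr r)) 1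
  | inv_mul (r : {r : R // r ≠ 0}) : FractionsRel K R
      (FreeAlgebra.ι K (Sum.inr r) * FreeAlgebra.ι K (Sum.inl r.1)) 1

/-- The universal ring of fractions of a `K`-algebra `R`, in which every nonzero element of `R`
becomes invertible. If `R` is an Ore domain (as for quantum matrices, which are a noetherian
domain), this is its skew field of fractions `Frac R`, by the universal property of
Ore localisation. -/
abbrev SkewFractions (K : Type*) [Field K] (R : Type*) [Ring R] [Algebra K R] : Type _ :=
  RingQuot (FractionsRel K R)

/-- The canonical map `R → Frac R`. -/
def SkewFractions.of (K : Type*) [Field K] {R : Type*} [Ring R] [Algebra K R] (r : R) :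
    SkewFractions K R :=
  RingQuot.mkAlgHom K (FractionsRel K R) (FreeAlgebra.ι K (Sum.inl r))

/-! ## The Poisson algebra -/

/-- The value of `{X_a, X_b}` when `a` precedes `b` lexicographically (and `0` for all other pairs
`(a, b)`, whose bracket is determined by skew-symmetry). -/
def poissonTable (K : Type*) [Field K] {m p : ℕ} (a b : Fin m × Fin p) :
    MvPolynomial (Fin m × Fin p) K :=
  if (a.1 < b.1 ∧ a.2 = b.2) ∨ (a.1 = b.1 ∧ a.2 < b.2) then
    MvPolynomial.X a * MvPolynomial.X b
  else if a.1 < b.1 ∧ a.2 < b.2 then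
    2 * MvPolynomial.X (a.1, b.2) * MvPolynomial.X (b.1, a.2)
  else 0

/-- The Poisson bracket on `A = K[X_{ij}]`: the skew-symmetric biderivation with
`{X_a, X_b} = poissonTable K a b` for `a` lexicographically before `b`. -/
def matrixPoissonBracket {K : Type*} [Field K] {m p : ℕ}
    (f g : MvPolynomial (Fin m × Fin p) K) : MvPolynomial (Fin m × Fin p) K :=
  ∑ a, ∑ b, poissonTable K a b *
    (MvPolynomial.pderiv a f * MvPolynomial.pderiv b g
      - MvPolynomial.pderiv b f * MvPolynomial.pderiv a g)

/-- `P.Spec(A)`: the prime ideals of `A` that are Poisson ideals, with the topology induced by the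
Zariski topology of `Spec(A)`. -/
abbrev PoissonSpec (K : Type*) [Field K] (m p : ℕ) : Type _ :=
  {P : PrimeSpectrum (MvPolynomial (Fin m × Fin p) K) //
    ∀ f g : MvPolynomial (Fin m × Fin p) K, g ∈ P.asIdeal → matrixPoissonBracket f g ∈ P.asIdeal}

/-! ## Deleting derivations

The algorithm is run inside a ring `L`, which is `Frac R` for quantum matrices (Cauchon's algorithm)
and the field `Frac A` for the semiclassical limit (the Poisson algorithm). The `n = m p`
generators are ordered lexicographically, and the algorithm uses successively the pivots number
`n, n - 1, …, 2`. -/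

/-- The pivot of step number `t` (counted from `0`): the generator of number `n - t` in the
lexicographic order (counted from `1`). -/
def pivot {m p : ℕ} (t : Fin (m * p)) : Fin m × Fin p :=
  finProdFinEquiv.symm t.rev

/-- One step of the algorithm, with pivot `a = (k, l)`:
`V_{ij} = U_{ij} - U_{il} U_{kl}⁻¹ U_{kj}` if `i < k` and `j < l`, and `V_{ij} = U_{ij}` otherwise.

On the Poisson side this is the formula `V_b = ∑ₙ η⁻ⁿ Dₙ(U_b) U_a⁻ⁿ`, where `Dₙ = δⁿ / n!`,
`η = 2`, and `δ(U_{ij}) = -2 U_{il} U_{kj}` if `i < k` and `j < l`, while `δ(U_b) = 0` for the other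
`b` before `a`; note `δ² (U_b) = 0`.
On the quantum side it is Cauchon's formula
`V_b = ∑ₙ (1 - q_a)⁻ⁿ ([n]!_{q_a})⁻¹ δⁿ(σ⁻ⁿ(U_b)) U_a⁻ⁿ`, where `q_a = q⁻²`, `σ(U_b) = q⁻¹ U_b` if
`b` lies in the row or column of `a` and `σ(U_b) = U_b` otherwise, and
`δ(U_{ij}) = -(q - q⁻¹) U_{il} U_{kj}` if `i < k` and `j < l`, while `δ(U_b) = 0` for the other `b`
before `a`; again `δ² (U_b) = 0`, and `U_{kj} U_{kl} = q U_{kl} U_{kj}`. -/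
def deleteStep {L : Type*} [Ring L] {m p : ℕ} (a : Fin m × Fin p)
    (U : Fin m × Fin p → L) : Fin m × Fin p → L :=
  fun b =>
    if b.1 < a.1 ∧ b.2 < a.2 then
      U b - U (b.1, a.2) * Ring.inverse (U a) * U (a.1, b.2)
    else U b

/-- The family of generators of the `t`-th algebra, i.e. after `t` steps, from the family `X`. -/
def deletedGens {L : Type*} [Ring L] {m p : ℕ} (X : Fin m × Fin p → L) :
    ℕ → Fin m × Fin p → L
  | 0 => X
  | t + 1 =>
    if h : t < m * p then deleteStep (pivot ⟨t, h⟩) (deletedGens X t) else deletedGens X t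

open Classical in
/-- The embedding `φ_j` from the (Poisson) spectrum of the algebra `C = K⟨U⟩ ⊆ L` to that of the
algebra `C' = K⟨V⟩ ⊆ L` obtained from it by one step with pivot `a`; here `U_a = V_a`, and ideals of
`C` and `C'` are viewed as subsets of `L`.

If `U_a ∉ P`, then `φ_j(P) = P S⁻¹ ∩ C'` with `S = {U_aⁿ}`. If `U_a ∈ P`, then `φ_j(P)` is
`g⁻¹(P / ⟨U_a⟩)`, where `g : C' → C / ⟨U_a⟩` is the algebra homomorphism that sends each `V_b` to the
class of `U_b`; i.e. it consists of all `f(V)`, where `f` is a polynomial expression with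
`f(U) ∈ P`. -/
def spectrumStep (K : Type*) [Field K] {L : Type*} [Ring L] [Algebra K L] {m p : ℕ}
    (a : Fin m × Fin p) (U V : Fin m × Fin p → L) (P : Set L) : Set L :=
  if U a ∈ P then
    {c | ∃ f : FreeAlgebra K (Fin m × Fin p),
      FreeAlgebra.lift K U f ∈ P ∧ c = FreeAlgebra.lift K V f}
  else
    {c | c ∈ Algebra.adjoin K (Set.range V) ∧
      ∃ x ∈ P, ∃ n : ℕ, c = x * Ring.inverse (U a) ^ n}

/-- The composition of the first `t` of the maps `φ_j` (in the order `j = n, n - 1, …`). -/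
def spectrumSteps (K : Type*) [Field K] {L : Type*} [Ring L] [Algebra K L] {m p : ℕ}
    (X : Fin m × Fin p → L) (P : Set L) : ℕ → Set L
  | 0 => P
  | t + 1 =>
    if h : t < m * p then
      spectrumStep K (pivot ⟨t, h⟩) (deletedGens X t) (deletedGens X (t + 1))
        (spectrumSteps K X P t)
    else spectrumSteps K X P t

/-- The generators `T_a` of the algebra obtained at the end of the algorithm
(after `n - 1` steps). -/
def finalGens {L : Type*} [Ring L] {m p : ℕ} (X : Fin m × Fin p → L) : Fin m × Fin p → L :=
  deletedGens X (m * p - 1)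

/-- The canonical embedding `φ = φ_2 ∘ ⋯ ∘ φ_n`. -/
def canonicalEmbedding (K : Type*) [Field K] {L : Type*} [Ring L] [Algebra K L] {m p : ℕ}
    (X : Fin m × Fin p → L) (P : Set L) : Set L :=
  spectrumSteps K X P (m * p - 1)

/-- The generators `X_{ij}` of quantum matrices `R`, in `Frac R`. -/
def quantumGens {K : Type*} [Field K] (q : K) (m p : ℕ) (a : Fin m × Fin p) :
    SkewFractions K (QuantumMatrices q m p) :=
  SkewFractions.of K (RingQuot.mkAlgHom K (QuantumMatrixRel q m p) (FreeAlgebra.ι K a))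

/-- The stratum `Spec_w(R)`: the primes `P` of `R` whose image under the canonical embedding
contains exactly those generators `T_a` with `a ∈ w`. -/
def quantumStratum {K : Type*} [Field K] (q : K) (m p : ℕ) (w : Finset (Fin m × Fin p)) :
    Set (NCSpec (QuantumMatrices q m p)) :=
  {P | ∀ a, finalGens (quantumGens q m p) a ∈
      canonicalEmbedding K (quantumGens q m p) (SkewFractions.of K '' {r | r ∈ P.1}) ↔ a ∈ w}

/-- The set `W'` of those `w` for which `Spec_w(R)` is nonempty. -/
def quantumDiagrams {K : Type*} [Field K] (q : K) (m p : ℕ) : Set (Finset (Fin m × Fin p)) :=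
  {w | (quantumStratum q m p w).Nonempty}

/-- The generators `X_{ij}` of `A`, in the field `Frac A`. -/
def poissonGens (K : Type*) [Field K] (m p : ℕ) (a : Fin m × Fin p) :
    FractionRing (MvPolynomial (Fin m × Fin p) K) :=
  algebraMap (MvPolynomial (Fin m × Fin p) K) _ (MvPolynomial.X a)

/-- The stratum `P.Spec_w(A)`: the Poisson primes `P` of `A` whose image under the canonical
embedding contains exactly those generators `T_a` with `a ∈ w`. -/
def poissonStratum (K : Type*) [Field K] (m p : ℕ) (w : Finset (Fin m × Fin p)) :
    Set (PoissonSpec K m p) :=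
  {P | ∀ a, finalGens (poissonGens K m p) a ∈
      canonicalEmbedding K (poissonGens K m p)
        (algebraMap (MvPolynomial (Fin m × Fin p) K)
          (FractionRing (MvPolynomial (Fin m × Fin p) K)) '' {f | f ∈ P.1.asIdeal}) ↔ a ∈ w}

/-- The set `W'_P` of Cauchon diagrams: those `w` for which `P.Spec_w(A)` is nonempty. -/
def poissonDiagrams (K : Type*) [Field K] (m p : ℕ) : Set (Finset (Fin m × Fin p)) :=
  {w | (poissonStratum K m p w).Nonempty}

/-! ## The torus ranks -/

/-- The skew-symmetric matrix `λ` with `{T_a, T_b} = λ_{ab} T_a T_b` in the Poisson affine space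
`K[T]` and `T_a T_b = q^{λ_{ab}} T_b T_a` in the quantum affine space: `λ_{ab} = 1` if `a` is
before `b` in the same row or the same column, `-1` if it is after, and `0` otherwise. -/
def lambdaMatrix (m p : ℕ) : Matrix (Fin m × Fin p) (Fin m × Fin p) ℚ :=
  fun a b =>
    if (a.1 = b.1 ∧ a.2 < b.2) ∨ (a.2 = b.2 ∧ a.1 < b.1) then 1
    else if (a.1 = b.1 ∧ b.2 < a.2) ∨ (a.2 = b.2 ∧ b.1 < a.1) then -1
    else 0

/-- The matrix `M(w)`: delete from `λ` the rows and columns with index in `w`. -/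
def diagramMatrix {m p : ℕ} (w : Finset (Fin m × Fin p)) :
    Matrix {a : Fin m × Fin p // a ∉ w} {a : Fin m × Fin p // a ∉ w} ℚ :=
  (lambdaMatrix m p).submatrix Subtype.val Subtype.val

/-- The dimension over `ℚ` of the kernel of `M(w)`. -/
def diagramNullity {m p : ℕ} (w : Finset (Fin m × Fin p)) : ℕ :=
  Module.finrank ℚ (LinearMap.ker (diagramMatrix w).mulVecLin)

/-- The Laurent polynomial ring `K[U_1^{±1}, …, U_s^{±1}]`, i.e. the group algebra of `ℤ^s`. -/
abbrev LaurentRing (K : Type*) [Field K] (s : ℕ) : Type _ :=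
  AddMonoidAlgebra K (Fin s → ℤ)

end

/-! Both sides of the theorem are instances of one argument with a parameter `q`. The relations
`StageRel` make sense for a unit `q` of any commutative ring: quantum matrices and the algebras
occurring in the algorithm are the case of the given `q`, and commutative algebras are the case `q =
1`. Every prime ideal of every stage is pulled back to the free algebra on the indices, so that
ideals of different stages become comparable. The quantum side works with the class `StageIdeal q`,
the Poisson side with `PoissonStageIdeal`.

Descent. A step of the algorithm replaces an ideal by its localization at the pivot, or leaves its
pullback unchanged if it contains the pivot. This needs the pivot to be regular modulo an ideal not
containing it, and the products of a column and a row entry of the pivot to lie in every ideal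
containing it (`StageIdeal.pivotRegular`, `PoissonStageIdeal.pivotRegular`). In the final algebra
let `w` be the set of indices of the generators in the ideal. Inverting the others gives a quantum
or Poisson torus. Conjugation by a generator, respectively bracket with it followed by division by
it, acts diagonally on monomials. As `q` is not a root of unity, respectively as the characteristic
is zero, the eigenvalues separate the radical of the commutation form from its complement. Hence the
extended ideal is induced from a prime of the center, a Laurent polynomial ring whose rank is the
nullity of `M(w)` (`exists_torusIdeal_eq_induced`, `nonempty_radicalChart`).

Ascent. The inverse of a step, `restoreStep`, is applied inside the torus of `w`, starting from its
generators, with those in `w` set to zero. If `w` is a Cauchon diagram the resulting families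
satisfy the relations of all stages (`stageRel_restored`), so each prime of the center has a
preimage at each stage (`stageKernel`). Conversely the final ideal determines the whole chain, and
the condition on column and row entries forces `w` to be a Cauchon diagram (`chain_eq_stageKernel`).

The full torus, `w = ∅`, is a faithful model of every stage: a leading term argument shows that
ordered monomials in a restored family are independent, so a relation valid there is valid in every
algebra with the stage relations (`lift_eq_zero_of_lift_restored`). The Poisson relations of
restored families come from the same computation over the dual numbers, with `q = 1 + ε`.

Consequently the occurring `w` are the Cauchon diagrams on both sides, each stratum is the spectrum
of the Laurent ring of `w` (`stratumHomeomorph`), and both spectra are parametrized by the disjoint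
union of these Laurent spectra (`spectrumEquiv`), which yields the global bijection. -/

namespace DeletingDerivations

/-! ## Stage relations and the restoration step -/

/-- The relations between the generators of the algebras in the deleting derivations algorithm: the
relations of quantum matrices, where the correction term in the relation between `U_{ij}` and
`U_{kl}` (`i < k`, `j < l`) is present only for `(k, l) ∈ S`. -/
structure StageRel {k B : Type*} [CommRing k] [Ring B] [Algebra k B] {m p : ℕ} (q : kˣ)
    (S : Set (Fin m × Fin p)) (U : Fin m × Fin p → B) : Prop where
  col : ∀ i i' j, i < i' → U (i, j) * U (i', j) = (q : k) • (U (i', j) * U (i, j))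
  row : ∀ i j j', j < j' → U (i, j) * U (i, j') = (q : k) • (U (i, j') * U (i, j))
  anti : ∀ i i' j j', i < i' → j' < j → U (i, j) * U (i', j') = U (i', j') * U (i, j)
  diag : ∀ i i' j j', i < i' → j < j' → (i', j') ∈ S →
    U (i, j) * U (i', j') = U (i', j') * U (i, j)
      + ((q : k) - ((q⁻¹ : kˣ) : k)) • (U (i, j') * U (i', j))
  comm : ∀ i i' j j', i < i' → j < j' → (i', j') ∉ S →
    U (i, j) * U (i', j') = U (i', j') * U (i, j)

/-- The inverse of `deleteStep`. -/
noncomputable def restoreStep {B : Type*} [Ring B] {m p : ℕ} (a : Fin m × Fin p)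
    (V : Fin m × Fin p → B) : Fin m × Fin p → B :=
  fun b =>
    if b.1 < a.1 ∧ b.2 < a.2 then
      V b + V (b.1, a.2) * Ring.inverse (V a) * V (a.1, b.2)
    else V b

section StageRel

variable {k B : Type*} [CommRing k] [Ring B] [Algebra k B] {m p : ℕ} {q : kˣ}
  {S : Set (Fin m × Fin p)} {V : Fin m × Fin p → B}

open Classical in
/-- The coefficient of the correction term in the relation with larger index `b`. -/
noncomputable def correction (q : kˣ) (S : Set (Fin m × Fin p)) (b : Fin m × Fin p) : k :=
  if b ∈ S then (q : k) - ((q⁻¹ : kˣ) : k) else 0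

theorem StageRel.diag_correction (h : StageRel q S V) {i i' : Fin m} {j j' : Fin p} (hi : i < i')
    (hj : j < j') : V (i, j) * V (i', j') = V (i', j') * V (i, j)
      + correction q S (i', j') • (V (i, j') * V (i', j)) := by
  unfold correction
  split_ifs with hS
  · exact h.diag i i' j j' hi hj hS
  · rw [h.comm i i' j j' hi hj hS, zero_smul, add_zero]

theorem StageRel.of_diag_correction
    (col : ∀ i i' j, i < i' → V (i, j) * V (i', j) = (q : k) • (V (i', j) * V (i, j)))
    (row : ∀ i j j', j < j' → V (i, j) * V (i, j') = (q : k) • (V (i, j') * V (i, j)))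
    (anti : ∀ i i' j j', i < i' → j' < j → V (i, j) * V (i', j') = V (i', j') * V (i, j))
    (diag : ∀ i i' j j', i < i' → j < j' → V (i, j) * V (i', j') = V (i', j') * V (i, j)
      + correction q S (i', j') • (V (i, j') * V (i', j))) : StageRel q S V where
  col := col
  row := row
  anti := anti
  diag i i' j j' hi hj hS := by rw [diag i i' j j' hi hj, correction, if_pos hS]
  comm i i' j j' hi hj hS := by
    rw [diag i i' j j' hi hj, correction, if_neg hS, zero_smul, add_zero]

/-- Quantum matrices are symmetric under transposition: the two factors of the correction term
commute by `anti`, so the term keeps its form. This halves the case distinctions below. -/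
theorem StageRel.swap (h : StageRel q S V) : StageRel q (Prod.swap ⁻¹' S) (V ∘ Prod.swap) where
  col i i' j hi := h.row j i i' hi
  row i j j' hj := h.col j j' i hj
  anti i i' j j' hi hj := (h.anti j' j i' i hj hi).symm
  diag i i' j j' hi hj hS := by
    have := h.diag j j' i i' hj hi hS
    simpa [← h.anti j j' i' i hj hi] using this
  comm i i' j j' hi hj hS := h.comm j j' i i' hj hi hS

theorem correction_swap (b : Fin m × Fin p) :
    correction q (Prod.swap ⁻¹' S) b.swap = correction q S b := by
  by_cases hb : b ∈ S <;> simp [correction, hb]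

/-- A rewriting device: it lets `simp` apply a commutation relation at the head of a
right-associated product. -/
theorem mul_assoc_of_eq {a b w : B} (h : a * b = w) (z : B) : a * (b * z) = w * z := by
  rw [← mul_assoc, h]

/-- The restoration step enlarges the set of active pivots by `a`; this holds if all other indices
weakly north-west of `a` are active, and no index weakly south-east of `a` is. -/
structure RestoreSetting (q : kˣ) (S : Set (Fin m × Fin p)) (V : Fin m × Fin p → B)
    (a : Fin m × Fin p) : Prop where
  rel : StageRel q S V
  unit : IsUnit (V a)
  northWest : ∀ b : Fin m × Fin p, b.1 ≤ a.1 → b.2 ≤ a.2 → b ≠ a → b ∈ S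
  southEast : ∀ b : Fin m × Fin p, a.1 ≤ b.1 → a.2 ≤ b.2 → b ∉ S

theorem RestoreSetting.swap {a : Fin m × Fin p} (h : RestoreSetting q S V a) :
    RestoreSetting q (Prod.swap ⁻¹' S) (V ∘ Prod.swap) a.swap where
  rel := h.rel.swap
  unit := by simpa using h.unit
  northWest b h1 h2 h3 := h.northWest b.swap h2 h1 (fun e => h3 (by rw [← e, Prod.swap_swap]))
  southEast b h1 h2 := h.southEast b.swap h2 h1

variable {a₁ : Fin m} {a₂ : Fin p}

theorem inverse_mul_of_qcomm {t : k} {x z : B} (hx : IsUnit x) (h : z * x = t • (x * z)) :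
    Ring.inverse x * z = t • (z * Ring.inverse x) := by
  obtain ⟨u, rfl⟩ := hx
  rw [Ring.inverse_unit]
  have : (↑u⁻¹ : B) * (z * u) * ↑u⁻¹ = t • (z * ↑u⁻¹) := by
    rw [h]; simp
  rw [← this]; simp [mul_assoc]

theorem inverse_mul_of_comm {x z : B} (hx : IsUnit x) (h : z * x = x * z) :
    Ring.inverse x * z = z * Ring.inverse x := by
  simpa using inverse_mul_of_qcomm (k := ℤ) (t := 1) hx (by simpa using h)

theorem smul_symm {q : kˣ} {z w : B} (h : z = (q : k) • w) : w = ((q⁻¹ : kˣ) : k) • z := by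
  rw [h, smul_smul, Units.inv_mul, one_smul]

/-! ### Commutation identities behind the restoration step -/

section Identities

variable {t t' : k} {V V' V₁ V₂ c c' r r' : B}

/-- In this group `c`, `c'` stand for an entry of the pivot's column times the inverse pivot, `r`,
`r'` for entries of the pivot's row, the letters `V` for entries of the family, and `t`, `t'` for
`q`, `q⁻¹`. Each identity follows by bringing all words into one order and comparing scalar
coefficients. -/
theorem restore_col_identity (ht : t * t' = 1) (hV : V * V' = t • (V' * V))
    (h3 : V * c' = c' * V + (t - t') • (c * V')) (h4 : V' * c = c * V') (h5 : V * r = t • (r * V))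
    (h6 : V' * r = t • (r * V')) (h7 : c * c' = t • (c' * c)) (h8 : c * r = t • (r * c))
    (h9 : c' * r = t • (r * c')) :
    (V + c * r) * (V' + c' * r) = t • ((V' + c' * r) * (V + c * r)) := by
  simp only [mul_add, add_mul, smul_add, mul_smul_comm, smul_mul_assoc, mul_assoc, hV, h3,
    h4, h7, h8, h9, mul_assoc_of_eq h5, mul_assoc_of_eq h6,
    mul_assoc_of_eq h8, mul_assoc_of_eq h9, smul_smul]
  match_scalars <;> grind

theorem restore_anti_identity (hV : V * V' = V' * V)
    (h3 : V * c' = c' * V + (t - t') • (c * V₁)) (h4 : V' * c = c * V') (h5 : V * r' = r' * V)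
    (h6 : V' * r = r * V' + (t - t') • (V₁ * r')) (h7 : c * c' = t • (c' * c))
    (h8 : c * r = t • (r * c)) (h9 : c' * r = t • (r * c')) (h10 : c * r' = t • (r' * c))
    (h11 : c' * r' = t • (r' * c')) (h12 : r' * r = t • (r * r'))
    (h15 : V₁ * r' = r' * V₁) (h16 : V₁ * c = c * V₁) :
    (V + c * r) * (V' + c' * r') = (V' + c' * r') * (V + c * r) := by
  simp only [mul_add, add_mul, smul_add, mul_smul_comm, smul_mul_assoc, mul_assoc, hV, h3,
    h4, h7, h8, h11, h15, h16, mul_assoc_of_eq h5, mul_assoc_of_eq h6, mul_assoc_of_eq h9,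
    mul_assoc_of_eq h10, mul_assoc_of_eq h12, smul_smul]
  match_scalars <;> grind

theorem restore_diag_identity (ht : t * t' = 1) (h1 : V * c' = c' * V + (t - t') • (c * V₂))
    (h2 : V * r' = r' * V + (t - t') • (V₁ * r)) (h3 : c * r = t • (r * c))
    (h4 : c' * r = t • (r * c')) (h5 : c * r' = t • (r' * c)) (h6 : c' * r' = t • (r' * c'))
    (h7 : c * c' = t • (c' * c)) (h8 : r * r' = t • (r' * r))
    (hV : V * V' = V' * V + (t - t') • (V₁ * V₂)) (h15 : V' * c = c * V')
    (h16 : V' * r = r * V') :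
    (V + c * r) * (V' + c' * r') = (V' + c' * r') * (V + c * r)
      + (t - t') • ((V₁ + c * r') * (V₂ + c' * r)) := by
  simp only [mul_add, add_mul, smul_add, mul_smul_comm, smul_mul_assoc, mul_assoc, hV, h1, h3,
    h4, h5, h6, h7, h15,
    mul_assoc_of_eq h2, mul_assoc_of_eq h3,
    mul_assoc_of_eq h4, mul_assoc_of_eq h5,
    mul_assoc_of_eq h8, mul_assoc_of_eq h16, smul_smul]
  match_scalars <;> grind

theorem add_mul_of_qcomm {t₁ t₂ : k} {Z : B} (h1 : V * Z = t₁ • (Z * V)) (h2 : c * Z = t₂ • (Z * c))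
    (h3 : r * Z = t • (Z * r)) (ht : t₂ * t = t₁) :
    (V + c * r) * Z = t₁ • (Z * (V + c * r)) := by
  simp only [mul_add, add_mul, smul_add, mul_smul_comm, smul_mul_assoc, mul_assoc, h1, h3,
    mul_assoc_of_eq h2, smul_smul, ← ht]
  match_scalars <;> grind

theorem restore_top_identity (ht : t * t' = 1) (h1 : V * r' = r' * V + (t - t') • (V₁ * r))
    (h3 : c * r = t • (r * c)) (h5 : c * r' = t • (r' * c)) (h8 : r * r' = t • (r' * r)) :
    (V + c * r) * r' = r' * (V + c * r) + (t - t') • ((V₁ + c * r') * r) := by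
  simp only [mul_add, add_mul, smul_add, mul_smul_comm, smul_mul_assoc, mul_assoc, h1,
    h3, h5, mul_assoc_of_eq h8, smul_smul]
  match_scalars <;> grind

theorem restore_below_identity {e : k} {Z Y : B} (h1 : V * Z = Z * V + e • (V₁ * Y))
    (h2 : c * Z = Z * c) (h3 : r * Z = Z * r + e • (r' * Y)) :
    (V + c * r) * Z = Z * (V + c * r) + e • ((V₁ + c * r') * Y) := by
  simp only [mul_add, add_mul, smul_add, mul_smul_comm, mul_assoc, h1, h3, mul_assoc_of_eq h2]
  abel

end Identities

/-! ### Relations of the restored family, by position relative to the pivot -/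

namespace RestoreSetting

variable (h : RestoreSetting q S V (a₁, a₂))
include h

local notation "y" => Ring.inverse (V (a₁, a₂))

local notation "c[" i "]" => V (i, a₂) * Ring.inverse (V (a₁, a₂))
local notation "r[" j "]" => V (a₁, j)

theorem inv_left {i : Fin m} (hi : i < a₁) : y * V (i, a₂) = (q : k) • (V (i, a₂) * y) :=
  inverse_mul_of_qcomm h.unit (h.rel.col i a₁ a₂ hi)

theorem inv_top {j : Fin p} (hj : j < a₂) : y * r[j] = (q : k) • (r[j] * y) :=
  inverse_mul_of_qcomm h.unit (h.rel.row a₁ j a₂ hj)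

theorem mul_pivot {i : Fin m} {j : Fin p} (hi : i < a₁) (hj : j < a₂) :
    V (i, j) * V (a₁, a₂) = V (a₁, a₂) * V (i, j) :=
  h.rel.comm i a₁ j a₂ hi hj (h.southEast _ le_rfl le_rfl)

theorem inv_mul {i : Fin m} {j : Fin p} (hi : i < a₁) (hj : j < a₂) :
    y * V (i, j) = V (i, j) * y :=
  inverse_mul_of_comm h.unit (h.mul_pivot hi hj)

theorem left_top {i : Fin m} {j : Fin p} (hi : i < a₁) (hj : j < a₂) :
    c[i] * r[j] = (q : k) • (r[j] * c[i]) := by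
  rw [mul_assoc, h.inv_top hj, mul_smul_comm, ← mul_assoc, h.rel.anti i a₁ a₂ j hi hj, mul_assoc]

theorem left_left {i i' : Fin m} (hi : i < i') (hi' : i' < a₁) :
    c[i] * c[i'] = (q : k) • (c[i'] * c[i]) := by
  simp only [mul_assoc, mul_assoc_of_eq (h.inv_left hi'), mul_assoc_of_eq (h.inv_left (hi.trans hi')),
    mul_smul_comm, smul_mul_assoc, mul_assoc_of_eq (h.rel.col i i' a₂ hi)]

theorem mul_left_of_lt {i i' : Fin m} {j : Fin p} (hi : i < i') (hi' : i' < a₁) (hj : j < a₂) :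
    V (i, j) * c[i'] = c[i'] * V (i, j)
      + ((q : k) - ((q⁻¹ : kˣ) : k)) • (c[i] * V (i', j)) := by
  have := h.rel.diag i i' j a₂ hi hj (h.northWest _ hi'.le le_rfl (by simp [hi'.ne]))
  simp only [mul_assoc, smul_mul_assoc, mul_assoc_of_eq this, add_mul,
      h.inv_mul (hi.trans hi') hj, h.inv_mul hi' hj]

theorem mul_left_of_gt {i i' : Fin m} {j : Fin p} (hi : i' < i) (hi' : i < a₁) (hj : j < a₂) :
    V (i, j) * c[i'] = c[i'] * V (i, j) := by
  have := h.rel.anti i' i a₂ j hi hj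
  simp only [mul_assoc, mul_assoc_of_eq this.symm, h.inv_mul hi' hj]

theorem mul_top_of_lt {i : Fin m} {j j' : Fin p} (hi : i < a₁) (hj : j < j') (hj' : j' < a₂) :
    V (i, j) * r[j'] = r[j'] * V (i, j)
      + ((q : k) - ((q⁻¹ : kˣ) : k)) • (V (i, j') * r[j]) :=
  h.rel.diag i a₁ j j' hi hj (h.northWest _ le_rfl hj'.le (by simp [hj'.ne]))

omit [CommRing k] [Algebra k B] h in
theorem restore_apply {i : Fin m} {j : Fin p} (hi : i < a₁) (hj : j < a₂) :
    restoreStep (a₁, a₂) V (i, j) = V (i, j) + c[i] * r[j] := by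
  simp [restoreStep, hi, hj]

omit h in
theorem restore_of_le_left {i : Fin m} {j : Fin p} (hi : a₁ ≤ i) :
    restoreStep (a₁, a₂) V (i, j) = V (i, j) := by
  simp [restoreStep, hi.not_gt]

omit h in
theorem restore_of_le_right {i : Fin m} {j : Fin p} (hj : a₂ ≤ j) :
    restoreStep (a₁, a₂) V (i, j) = V (i, j) := by
  simp [restoreStep, hj.not_gt]

/-- The correction may be written in either order, because the inverse pivot picks up the same
factor `q` when it passes a column entry or a row entry. Restoration thus commutes with
transposition. -/
theorem restore_swap :
    restoreStep (Prod.swap (a₁, a₂)) (V ∘ Prod.swap) = restoreStep (a₁, a₂) V ∘ Prod.swap := by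
  funext ⟨j, i⟩
  by_cases hi : i < a₁
  · by_cases hj : j < a₂
    · have : V (a₁, j) * y * V (i, a₂) = V (i, a₂) * y * V (a₁, j) := by
        simp only [mul_assoc, h.inv_left hi, h.inv_top hj, mul_smul_comm]
        rw [← mul_assoc, ← mul_assoc, h.rel.anti i a₁ a₂ j hi hj]
      simp [restoreStep, hi, hj, this]
    · simp [restoreStep, hj]
  · simp [restoreStep, hi]

theorem left_mul_comm {i : Fin m} {Z : B} {t : k} (h1 : V (i, a₂) * Z = t • (Z * V (i, a₂)))
    {t' : k} (h2 : Z * V (a₁, a₂) = t' • (V (a₁, a₂) * Z)) :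
    c[i] * Z = (t * t') • (Z * c[i]) := by
  have h3 := inverse_mul_of_qcomm h.unit h2
  simp only [mul_assoc, h3, mul_smul_comm, mul_assoc_of_eq h1, smul_mul_assoc, smul_smul]
  rw [mul_comm]

theorem restore_col {i i' : Fin m} {j : Fin p} (hi : i < i') :
    restoreStep (a₁, a₂) V (i, j) * restoreStep (a₁, a₂) V (i', j)
      = (q : k) • (restoreStep (a₁, a₂) V (i', j) * restoreStep (a₁, a₂) V (i, j)) := by
  rcases le_or_gt a₂ j with hj | hj
  · rw [restore_of_le_right hj, restore_of_le_right hj, h.rel.col _ _ _ hi]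
  rcases lt_trichotomy i' a₁ with hi' | rfl | hi'
  · rw [restore_apply hi' hj, restore_apply (hi.trans hi') hj]
    exact restore_col_identity q.mul_inv (h.rel.col _ _ _ hi) (h.mul_left_of_lt hi hi' hj) (h.mul_left_of_gt hi hi' hj)
      (h.rel.col _ _ _ (hi.trans hi')) (h.rel.col _ _ _ hi') (h.left_left hi hi')
      (h.left_top (hi.trans hi') hj) (h.left_top hi' hj)
  · rw [restore_of_le_left le_rfl, restore_apply hi hj]
    exact add_mul_of_qcomm (t := 1) (h.rel.col _ _ _ hi) (h.left_top hi hj) (by simp) (by simp)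
  · rw [restore_of_le_left hi'.le]
    rcases le_or_gt a₁ i with hi₁ | hi₁
    · rw [restore_of_le_left hi₁, h.rel.col _ _ _ hi]
    rw [restore_apply hi₁ hj]
    refine add_mul_of_qcomm (h.rel.col _ _ _ hi) (h.left_mul_comm (t := 1) (t' := 1) ?_ ?_)
      (h.rel.col _ _ _ hi') (by simp)
    · rw [h.rel.anti _ _ _ _ hi hj, one_smul]
    · rw [h.rel.anti _ _ _ _ hi' hj, one_smul]

theorem restore_row {i : Fin m} {j j' : Fin p} (hj : j < j') :
    restoreStep (a₁, a₂) V (i, j) * restoreStep (a₁, a₂) V (i, j')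
      = (q : k) • (restoreStep (a₁, a₂) V (i, j') * restoreStep (a₁, a₂) V (i, j)) := by
  have := h.swap.restore_col (j := i) hj
  erw [h.restore_swap] at this
  exact this

theorem restore_anti_of_lt {i i' : Fin m} {j j' : Fin p} (hi : i < i') (hj : j' < j)
    (hj₁ : j < a₂) :
    restoreStep (a₁, a₂) V (i, j) * restoreStep (a₁, a₂) V (i', j')
      = restoreStep (a₁, a₂) V (i', j') * restoreStep (a₁, a₂) V (i, j) := by
  rcases le_or_gt a₁ i with hi₁ | hi₁
  · rw [restore_of_le_left hi₁, restore_of_le_left (hi₁.trans hi.le), h.rel.anti _ _ _ _ hi hj]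
  have hj₂ := hj.trans hj₁
  rcases lt_trichotomy i' a₁ with hi' | rfl | hi'
  · rw [restore_apply hi' hj₂, restore_apply hi₁ hj₁]
    exact restore_anti_identity (h.rel.anti _ _ _ _ hi hj)
      (h.mul_left_of_lt hi hi' hj₁) (h.mul_left_of_gt hi hi' hj₂)
      (h.rel.anti _ _ _ _ hi₁ hj) (h.mul_top_of_lt hi' hj hj₁) (h.left_left hi hi')
      (h.left_top hi₁ hj₁) (h.left_top hi' hj₁) (h.left_top hi₁ hj₂) (h.left_top hi' hj₂)
      (h.rel.row _ _ _ hj) (h.rel.anti _ _ _ _ hi' hj)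
      (h.mul_left_of_gt hi hi' hj₁)
  · rw [restore_of_le_left le_rfl, restore_apply hi hj₁]
    rw [← one_smul k (V (i', j') * _)]
    exact add_mul_of_qcomm (by rw [h.rel.anti _ _ _ _ hi hj, one_smul]) (h.left_top hi hj₂)
      (smul_symm (h.rel.row _ _ _ hj)) (by simp)
  · rw [restore_of_le_left hi'.le, restore_apply hi₁ hj₁]
    rw [← one_smul k (V (i', j') * _)]
    refine add_mul_of_qcomm (by rw [h.rel.anti _ _ _ _ hi hj, one_smul])
      (h.left_mul_comm (t := 1) (t' := 1) ?_ ?_) (t := 1) ?_ (by simp)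
    · rw [h.rel.anti _ _ _ _ hi hj₂, one_smul]
    · rw [h.rel.anti _ _ _ _ hi' hj₂, one_smul]
    · rw [h.rel.anti _ _ _ _ hi' hj, one_smul]

/-- If the first entry lies right of or in the pivot's column, either the second one is also
unchanged by the step, or the transposed situation falls under `restore_anti_of_lt`. -/
theorem restore_anti {i i' : Fin m} {j j' : Fin p} (hi : i < i') (hj : j' < j) :
    restoreStep (a₁, a₂) V (i, j) * restoreStep (a₁, a₂) V (i', j')
      = restoreStep (a₁, a₂) V (i', j') * restoreStep (a₁, a₂) V (i, j) := by
  rcases le_or_gt a₂ j with hj₁ | hj₁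
  · rcases le_or_gt a₁ i' with hi₁ | hi₁
    · rw [restore_of_le_left hi₁, restore_of_le_right hj₁, h.rel.anti _ _ _ _ hi hj]
    · have := h.swap.restore_anti_of_lt hj hi hi₁
      erw [h.restore_swap] at this
      exact this.symm
  · exact h.restore_anti_of_lt hi hj hj₁

-- The hypothesis `hc` selects representatives up to transposition. Its last alternative is the
-- pivot itself, the one place where a correction term is created.
open Classical in
theorem restore_diag_of {i i' : Fin m} {j j' : Fin p} (hi : i < i') (hj : j < j')
    (hc : (j' < a₂ ∨ a₁ < i') ∨ (i' = a₁ ∧ j' = a₂)) :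
    restoreStep (a₁, a₂) V (i, j) * restoreStep (a₁, a₂) V (i', j')
      = restoreStep (a₁, a₂) V (i', j') * restoreStep (a₁, a₂) V (i, j)
        + correction q (insert (a₁, a₂) S) (i', j') •
          (restoreStep (a₁, a₂) V (i, j') * restoreStep (a₁, a₂) V (i', j)) := by
  rcases hc with hc | ⟨rfl, rfl⟩
  swap
  -- The summand added to the entry passes the pivot with factor `q` when multiplied from the right
  -- and `q⁻¹` from the left; the difference is exactly the new correction coefficient.
  · rw [restore_of_le_left le_rfl, restore_apply hi hj, restore_of_le_right le_rfl,
      restore_of_le_left le_rfl, correction, if_pos (Set.mem_insert _ _)]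
    obtain ⟨u, hu⟩ := h.unit
    have e1 := h.mul_pivot hi hj
    have e2 := h.rel.col _ _ j' hi
    have e3 := h.rel.row i' _ _ hj
    rw [← hu] at e1 e2 e3 ⊢
    rw [Ring.inverse_unit]
    have e4 : V (i, j') * (↑u⁻¹ * (V (i', j) * ↑u)) = (q : k) • (V (i, j') * V (i', j)) := by
      rw [e3]; simp
    have e5 : (u : B) * (V (i, j') * (↑u⁻¹ * V (i', j)))
        = ((q⁻¹ : kˣ) : k) • (V (i, j') * V (i', j)) := by
      rw [← mul_assoc, smul_symm e2]; simp [mul_assoc]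
    simp only [add_mul, mul_add, e1, mul_assoc, e4, e5, sub_smul]
    abel
  have hne : (i', j') ≠ (a₁, a₂) := by
    rintro e; simp only [Prod.mk.injEq] at e; rcases hc with hc | hc
    · exact hc.ne e.2
    · exact hc.ne' e.1
  have hcorr : correction q (insert (a₁, a₂) S) (i', j') = correction q S (i', j') := by
    simp [correction, hne]
  rw [hcorr]
  have hdiag := h.rel.diag_correction hi hj
  rcases le_or_gt a₁ i with hi₁ | hi₁
  · simp only [restore_of_le_left hi₁, restore_of_le_left (hi₁.trans hi.le)]
    exact hdiag
  rcases le_or_gt a₂ j with hj₁ | hj₁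
  · simp only [restore_of_le_right hj₁, restore_of_le_right (hj₁.trans hj.le)]
    exact hdiag
  rcases lt_trichotomy i' a₁ with hi' | rfl | hi'
  · replace hc : j' < a₂ := hc.resolve_right hi'.not_gt
    have hS := h.northWest (i', j') hi'.le hc.le hne
    simp only [restore_apply hi' hc, restore_apply hi₁ hj₁, restore_apply hi' hj₁,
      restore_apply hi₁ hc]
    rw [correction, if_pos hS]
    exact restore_diag_identity q.mul_inv (h.mul_left_of_lt hi hi' hj₁) (h.mul_top_of_lt hi₁ hj hc)
      (h.left_top hi₁ hj₁) (h.left_top hi' hj₁) (h.left_top hi₁ hc) (h.left_top hi' hc)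
      (h.left_left hi hi') (h.rel.row _ _ _ hj) (h.rel.diag _ _ _ _ hi hj hS)
      (h.mul_left_of_gt hi hi' hc) (h.rel.anti _ _ _ _ hi' hj)
  · replace hc : j' < a₂ := hc.resolve_right (lt_irrefl _)
    have hS := h.northWest (i', j') le_rfl hc.le hne
    simp only [restore_of_le_left le_rfl, restore_apply hi hj₁, restore_apply hi hc]
    rw [correction, if_pos hS]
    exact restore_top_identity q.mul_inv (h.mul_top_of_lt hi hj hc) (h.left_top hi hj₁)
      (h.left_top hi hc) (h.rel.row _ _ _ hj)
  · have hc₂ : ∀ Z, V (i, a₂) * Z = Z * V (i, a₂) → Z * V (a₁, a₂) = V (a₁, a₂) * Z →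
        c[i] * Z = Z * c[i] := fun Z e1 e2 => by
      simpa using h.left_mul_comm (t := 1) (t' := 1) (by rwa [one_smul]) (by rwa [one_smul])
    simp only [restore_of_le_left hi'.le, restore_apply hi₁ hj₁]
    rcases lt_or_ge j' a₂ with hj' | hj'
    · rw [restore_apply hi₁ hj']
      exact restore_below_identity hdiag
        (hc₂ _ (h.rel.anti _ _ _ _ hi hj') (h.rel.anti _ _ _ _ hi' hj').symm)
        (h.rel.diag_correction hi' hj)
    · have hS : (i', j') ∉ S := h.southEast _ hi'.le hj'
      have hz : correction q S (i', j') = (0 : k) := by simp [correction, hS]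
      rw [hz, zero_smul, add_zero]
      rw [← one_smul k (V (i', j') * _)]
      have e := h.rel.comm _ _ _ _ hi' hj hS
      rcases hj'.eq_or_lt with rfl | hj'
      · exact add_mul_of_qcomm (t := 1) (by rw [h.rel.comm _ _ _ _ hi hj hS, one_smul])
          (h.left_mul_comm (h.rel.col _ _ _ hi) (smul_symm (h.rel.col _ _ _ hi')))
          (by rw [e, one_smul]) (by simp)
      · exact add_mul_of_qcomm (t := 1) (by rw [h.rel.comm _ _ _ _ hi hj hS, one_smul])
          (by rw [hc₂ _ (h.rel.comm _ _ _ _ hi hj' hS) (h.rel.comm _ _ _ _ hi' hj' hS).symm,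
            one_smul]) (by rw [e, one_smul]) (by simp)

theorem restore_diag {i i' : Fin m} {j j' : Fin p} (hi : i < i') (hj : j < j') :
    restoreStep (a₁, a₂) V (i, j) * restoreStep (a₁, a₂) V (i', j')
      = restoreStep (a₁, a₂) V (i', j') * restoreStep (a₁, a₂) V (i, j)
        + correction q (insert (a₁, a₂) S) (i', j') •
          (restoreStep (a₁, a₂) V (i, j') * restoreStep (a₁, a₂) V (i', j)) := by
  by_cases hc : (j' < a₂ ∨ a₁ < i') ∨ (i' = a₁ ∧ j' = a₂)
  · exact h.restore_diag_of hi hj hc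
  · have hc' : (i' < a₁ ∨ a₂ < j') ∨ (j' = a₂ ∧ i' = a₁) := by
      push Not at hc
      rcases hc.1.2.lt_or_eq with h1 | h1
      · exact .inl (.inl h1)
      · exact .inl (.inr (hc.1.1.lt_of_ne (hc.2 h1).symm))
    have e := h.swap.restore_diag_of hj hi hc'
    erw [h.restore_swap] at e
    have hS : (insert ((a₁, a₂) : Fin m × Fin p).swap (Prod.swap ⁻¹' S)) =
        Prod.swap ⁻¹' insert (a₁, a₂) S := by
      ext ⟨b, c⟩; simp [Prod.swap]; tauto
    erw [hS, correction_swap (i', j')] at e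
    simp only [Function.comp, Prod.swap] at e
    rw [← h.restore_anti hi hj] at e
    exact e

theorem stageRel_restoreStep : StageRel q (insert (a₁, a₂) S) (restoreStep (a₁, a₂) V) :=
  .of_diag_correction (fun _ _ _ hi => h.restore_col hi) (fun _ _ _ hj => h.restore_row hj)
    (fun _ _ _ _ hi hj => h.restore_anti hi hj) (fun _ _ _ _ hi hj => h.restore_diag hi hj)

end RestoreSetting
end StageRel
end DeletingDerivations

namespace DeletingDerivations

/-! ## Algebras with generators that commute up to scalars and terms of lower weight -/

section Filtered

variable {K B ι : Type*} [Field K] [Ring B] [Algebra K B]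

/-- The span of the words in the family `U` of weight less than `d`. -/
def wordSpan (K : Type*) [Field K] {B ι : Type*} [Ring B] [Algebra K B] (U : ι → B) (ω : ι → ℕ)
    (d : ℕ) : Submodule K B :=
  Submodule.span K {x | ∃ l : List ι, (l.map ω).sum < d ∧ x = (l.map U).prod}

/-- The family `U` commutes up to nonzero scalars and terms of lower weight. -/
def AlmostCommutes (K : Type*) [Field K] {B ι : Type*} [Ring B] [Algebra K B] (U : ι → B)
    (ω : ι → ℕ) : Prop :=
  ∀ a b, ∃ c : K, c ≠ 0 ∧ U a * U b - c • (U b * U a) ∈ wordSpan K U ω (ω a + ω b)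

/-- The product of the members of the family `U` indexed by a multiset, in some fixed order. -/
noncomputable def monomialProd (U : ι → B) (s : Multiset ι) : B :=
  (s.toList.map U).prod

variable {U : ι → B} {ω : ι → ℕ}

theorem word_mem_wordSpan {l : List ι} {d : ℕ} (h : (l.map ω).sum < d) :
    (l.map U).prod ∈ wordSpan K U ω d :=
  Submodule.subset_span ⟨l, h, rfl⟩

theorem word_mul_mem {x : B} {d : ℕ} (hx : x ∈ wordSpan K U ω d) (l : List ι) :
    (l.map U).prod * x ∈ wordSpan K U ω ((l.map ω).sum + d) := by
  induction hx using Submodule.span_induction with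
  | mem x h =>
    obtain ⟨l', hl', rfl⟩ := h
    rw [← List.prod_append, ← List.map_append]
    exact word_mem_wordSpan (by simpa using hl')
  | zero => simp
  | add x y _ _ hx hy => rw [mul_add]; exact add_mem hx hy
  | smul c x _ hx => rw [mul_smul_comm]; exact Submodule.smul_mem _ _ hx

theorem mul_word_mem {x : B} {d : ℕ} (hx : x ∈ wordSpan K U ω d) (l : List ι) :
    x * (l.map U).prod ∈ wordSpan K U ω (d + (l.map ω).sum) := by
  induction hx using Submodule.span_induction with
  | mem x h =>
    obtain ⟨l', hl', rfl⟩ := h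
    rw [← List.prod_append, ← List.map_append]
    exact word_mem_wordSpan (by simpa using hl')
  | zero => simp
  | add x y _ _ hx hy => rw [add_mul]; exact add_mem hx hy
  | smul c x _ hx => rw [smul_mul_assoc]; exact Submodule.smul_mem _ _ hx

/-- Exchanging two neighbours costs a nonzero scalar and words of lower weight, and weights are
invariant under permutation, so the errors accumulate harmlessly. -/
theorem word_perm (hU : AlmostCommutes K U ω) {l l' : List ι} (h : l.Perm l') :
    ∃ c : K, c ≠ 0 ∧ (l.map U).prod - c • (l'.map U).prod ∈ wordSpan K U ω (l.map ω).sum := by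
  induction h with
  | nil => exact ⟨1, one_ne_zero, by simp⟩
  | cons a h ih =>
    obtain ⟨c, hc, h⟩ := ih
    refine ⟨c, hc, ?_⟩
    have := word_mul_mem h [a]
    simpa [mul_sub] using this
  | swap a b l =>
    obtain ⟨c, hc, h⟩ := hU b a
    refine ⟨c, hc, ?_⟩
    have := mul_word_mem h l
    simpa [sub_mul, mul_assoc, add_assoc] using this
  | @trans l₁ l₂ l₃ h₁ h₂ ih₁ ih₂ =>
    obtain ⟨c, hc, h⟩ := ih₁
    obtain ⟨c', hc', h'⟩ := ih₂
    refine ⟨c * c', mul_ne_zero hc hc', ?_⟩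
    have e : (l₁.map ω).sum = (l₂.map ω).sum := (h₁.map ω).sum_eq
    rw [← e] at h'
    have := add_mem h (Submodule.smul_mem _ c h')
    rwa [smul_sub, smul_smul, sub_add_sub_cancel] at this

theorem word_sub_monomialProd_mem (hU : AlmostCommutes K U ω) (l : List ι) :
    ∃ c : K, c ≠ 0 ∧ (l.map U).prod - c • monomialProd U (l : Multiset ι)
      ∈ wordSpan K U ω (l.map ω).sum :=
  word_perm hU (Multiset.coe_eq_coe.1 (Multiset.coe_toList _)).symm

theorem monomialProd_mul (hU : AlmostCommutes K U ω) (s t : Multiset ι) :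
    ∃ c : K, c ≠ 0 ∧ monomialProd U s * monomialProd U t - c • monomialProd U (s + t)
      ∈ wordSpan K U ω ((s.map ω).sum + (t.map ω).sum) := by
  obtain ⟨c, hc, h⟩ := word_sub_monomialProd_mem hU (s.toList ++ t.toList)
  refine ⟨c, hc, ?_⟩
  have e : ∀ s : Multiset ι, (s.toList.map ω).sum = (s.map ω).sum := fun s => by
    conv_rhs => rw [← Multiset.coe_toList s]
    simp
  simpa [monomialProd, ← Multiset.coe_add, e] using h

/-- Sorting a word leaves an error of strictly smaller weight, which is handled by strong induction
on the weight. -/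
theorem wordSpan_le_span_monomialProd (hU : AlmostCommutes K U ω) (d : ℕ) :
    wordSpan K U ω d ≤
      Submodule.span K {x | ∃ s : Multiset ι, (s.map ω).sum < d ∧ x = monomialProd U s} := by
  induction d using Nat.strong_induction_on with
  | _ d ih =>
    refine Submodule.span_le.2 ?_
    rintro _ ⟨l, hl, rfl⟩
    obtain ⟨c, hc, h⟩ := word_sub_monomialProd_mem hU l
    have hsub : {x | ∃ s : Multiset ι, (s.map ω).sum < (l.map ω).sum ∧ x = monomialProd U s} ⊆
        {x | ∃ s : Multiset ι, (s.map ω).sum < d ∧ x = monomialProd U s} :=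
      fun _ ⟨s, hs, hx⟩ => ⟨s, hs.trans hl, hx⟩
    have h1 := Submodule.span_mono (R := K) hsub (ih _ hl h)
    have h2 := add_mem h1 (Submodule.smul_mem _ c (Submodule.subset_span
      ⟨(l : Multiset ι), by simpa using hl, rfl⟩))
    simpa using h2

theorem lift_mem_span_monomialProd (hU : AlmostCommutes K U ω) (f : FreeAlgebra K ι) :
    FreeAlgebra.lift K U f ∈ Submodule.span K (Set.range (monomialProd U)) := by
  have h : FreeAlgebra.lift K U f ∈
      Submodule.span K {x | ∃ l : List ι, x = (l.map U).prod} := by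
    induction f using FreeAlgebra.induction with
    | grade0 r =>
      rw [AlgHom.commutes, Algebra.algebraMap_eq_smul_one]
      exact Submodule.smul_mem _ _ (Submodule.subset_span ⟨[], by simp⟩)
    | grade1 a => exact Submodule.subset_span ⟨[a], by simp⟩
    | mul f g hf hg =>
      rw [map_mul]
      have := Submodule.mul_mem_mul hf hg
      rw [Submodule.span_mul_span] at this
      refine Submodule.span_mono ?_ this
      rintro _ ⟨_, ⟨l, rfl⟩, _, ⟨l', rfl⟩, rfl⟩
      exact ⟨l ++ l', by simp⟩
    | add f g hf hg => rw [map_add]; exact add_mem hf hg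
  refine (Submodule.span_le.2 ?_) h
  rintro _ ⟨l, rfl⟩
  refine Submodule.span_mono ?_ (wordSpan_le_span_monomialProd hU ((l.map ω).sum + 1)
    (word_mem_wordSpan (Nat.lt_succ_self _)))
  rintro _ ⟨s, -, rfl⟩
  exact ⟨s, rfl⟩

end Filtered

/-! ### Noetherianity by leading monomials -/

section Noetherian

variable {K B ι : Type*} [Field K] [Ring B] [Algebra K B] {U : ι → B} {ω : ι → ℕ}
  {σ : Type*} [LinearOrder σ] {key : Multiset ι → σ}

/-- The span of the monomials with key less than `k`. -/
def keySpan (K : Type*) [Field K] {B ι : Type*} [Ring B] [Algebra K B] (U : ι → B)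
    {σ : Type*} [LinearOrder σ] (key : Multiset ι → σ) (k : σ) : Submodule K B :=
  Submodule.span K {x | ∃ s : Multiset ι, key s < k ∧ x = monomialProd U s}

theorem keySpan_mono {k k' : σ} (h : k ≤ k') : keySpan K U key k ≤ keySpan K U key k' :=
  Submodule.span_mono fun _ ⟨s, hs, hx⟩ => ⟨s, hs.trans_le h, hx⟩

theorem exists_leading {k : σ} (hinj : Function.Injective key) {f : B}
    (hf : f ∈ keySpan K U key k) : f = 0 ∨ ∃ s, key s < k ∧ ∃ c : K,
      f - c • monomialProd U s ∈ keySpan K U key (key s) := by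
  induction hf using Submodule.span_induction with
  | mem x h =>
    obtain ⟨s, hs, rfl⟩ := h
    exact .inr ⟨s, hs, 1, by simp⟩
  | zero => exact .inl rfl
  | add x y _ _ hx hy =>
    rcases hx with rfl | ⟨s, hs, c, hx⟩
    · simpa using hy
    rcases hy with rfl | ⟨t, ht, d, hy⟩
    · exact .inr ⟨s, hs, c, by simpa using hx⟩
    have hmem : ∀ {s t : Multiset ι} (c : K), key s < key t →
        c • monomialProd U s ∈ keySpan K U key (key t) := fun c h =>
      Submodule.smul_mem _ _ (Submodule.subset_span ⟨_, h, rfl⟩)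
    rcases lt_trichotomy (key s) (key t) with h | h | h
    · refine .inr ⟨t, ht, d, ?_⟩
      have := add_mem (add_mem (keySpan_mono h.le hx) (hmem c h)) hy
      convert this using 1; abel
    · obtain rfl := hinj h
      refine .inr ⟨s, hs, c + d, ?_⟩
      convert add_mem hx hy using 1; rw [add_smul]; abel
    · refine .inr ⟨s, hs, c, ?_⟩
      have := add_mem (add_mem (keySpan_mono h.le hy) (hmem d h)) hx
      convert this using 1; abel
  | smul a x _ hx =>
    rcases hx with rfl | ⟨s, hs, c, hx⟩
    · simp
    · refine .inr ⟨s, hs, a * c, ?_⟩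
      convert Submodule.smul_mem _ a hx using 1
      rw [smul_sub, smul_smul]

/-- Dickson's lemma: multisets over a finite type are well-quasi-ordered, so the minimal elements of
a set form a finite antichain. -/
theorem finite_dominating {ι : Type*} [Finite ι] (E : Set (Multiset ι)) :
    ∃ E₀ ⊆ E, E₀.Finite ∧ ∀ s ∈ E, ∃ s₀ ∈ E₀, s₀ ≤ s := by
  classical
  have hwqo : WellQuasiOrderedLE (Multiset ι) := by
    refine ⟨fun f => ?_⟩
    obtain ⟨i, j, hij, h⟩ := (wellQuasiOrdered_le (α := ι →₀ ℕ)) (fun n => Multiset.toFinsupp (f n))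
    exact ⟨i, j, hij, Finsupp.orderIsoMultiset.symm.le_iff_le.1 h⟩
  refine ⟨{s | Minimal (· ∈ E) s}, fun s hs => hs.1, ?_, fun s hs => ?_⟩
  · exact WellQuasiOrderedLE.finite_of_isAntichain (setOfPred_minimal_antichain _)
  · obtain ⟨s₀, h₀, h⟩ := exists_minimal_le_of_wellFoundedLT (· ∈ E) s hs
    exact ⟨s₀, h, h₀⟩

/-- Hilbert's basis argument for left ideals. Choose elements of the ideal whose leading exponents
are the finitely many minimal ones; a left multiple of one of them cancels the leading term of any
other element, and the keys are well-founded. -/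
theorem isNoetherianRing_of_key [Finite ι] [WellFoundedLT σ] (hinj : Function.Injective key)
    (hadd : ∀ s t t', key t < key t' → key (s + t) < key (s + t'))
    (hmul : ∀ s t, ∃ c : K, c ≠ 0 ∧
      monomialProd U s * monomialProd U t - c • monomialProd U (s + t)
        ∈ keySpan K U key (key (s + t)))
    (htop : ∀ f : B, ∃ k, f ∈ keySpan K U key k) : IsNoetherianRing B := by
  have hmulmem : ∀ s {t} {f : B}, f ∈ keySpan K U key (key t) →
      monomialProd U s * f ∈ keySpan K U key (key (s + t)) := by
    intro s t f hf
    induction hf using Submodule.span_induction with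
    | mem x h =>
      obtain ⟨t', ht', rfl⟩ := h
      obtain ⟨c, hc, h⟩ := hmul s t'
      have h1 := keySpan_mono (hadd s _ _ ht').le h
      have h2 : c • monomialProd U (s + t') ∈ keySpan K U key (key (s + t)) :=
        Submodule.smul_mem _ _ (Submodule.subset_span ⟨_, hadd s _ _ ht', rfl⟩)
      simpa using add_mem h1 h2
    | zero => simp
    | add x y _ _ hx hy => rw [mul_add]; exact add_mem hx hy
    | smul c x _ hx => rw [mul_smul_comm]; exact Submodule.smul_mem _ _ hx
  refine ⟨fun I => ?_⟩
  let E : Set (Multiset ι) := {s | ∃ f ∈ I, f - monomialProd U s ∈ keySpan K U key (key s)}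
  obtain ⟨E₀, hE₀, hfin, hdom⟩ := finite_dominating E
  choose! g hgI hg using (show ∀ s ∈ E₀, ∃ f ∈ I,
    f - monomialProd U s ∈ keySpan K U key (key s) from fun s hs => hE₀ hs)
  refine (Submodule.fg_def.2 ⟨g '' E₀, hfin.image g, le_antisymm ?_ ?_⟩)
  · refine Submodule.span_le.2 ?_
    rintro _ ⟨s, hs, rfl⟩
    exact hgI s hs
  · have main : ∀ k : σ, ∀ f ∈ I, f ∈ keySpan K U key k → f ∈ Submodule.span B (g '' E₀) := by
      intro k
      induction k using WellFoundedLT.induction with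
      | ind k ih =>
        intro f hfI hf
        rcases exists_leading hinj hf with rfl | ⟨s, hs, c, hc⟩
        · simp
        -- `exists_leading` does not promise a nonzero coefficient. If it vanishes, `f` already lies
        -- in a smaller span.
        by_cases hc0 : c = 0
        · exact ih (key s) hs f hfI (by simpa [hc0] using hc)
        have hsE : s ∈ E := by
          refine ⟨c⁻¹ • f, ?_, ?_⟩
          · rw [← one_mul f, ← smul_mul_assoc]; exact I.smul_mem _ hfI
          · have := Submodule.smul_mem _ c⁻¹ hc
            rwa [smul_sub, smul_smul, inv_mul_cancel₀ hc0, one_smul] at this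
        obtain ⟨s₀, hs₀, hle⟩ := hdom s hsE
        obtain ⟨t, rfl⟩ := exists_add_of_le hle
        rw [add_comm s₀ t] at hs hc
        obtain ⟨d, hd, hdm⟩ := hmul t s₀
        have h1 := hmulmem t (hg s₀ hs₀)
        have h2 := add_mem h1 hdm
        rw [mul_sub, sub_add_sub_cancel] at h2
        have h3 := sub_mem hc (Submodule.smul_mem _ (c * d⁻¹) h2)
        rw [smul_sub, smul_smul, mul_assoc, inv_mul_cancel₀ hd, mul_one, sub_sub_sub_cancel_right,
          ← smul_mul_assoc] at h3
        have h4 : ((c * d⁻¹) • monomialProd U t) * g s₀ ∈ Submodule.span B (g '' E₀) :=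
          Submodule.smul_mem _ _ (Submodule.subset_span ⟨s₀, hs₀, rfl⟩)
        have h5 := ih _ hs _ (sub_mem hfI (I.smul_mem _ (hgI s₀ hs₀))) h3
        simpa using add_mem h5 h4
    intro f hf
    obtain ⟨k, hk⟩ := htop f
    exact main k f hf hk

theorem AlmostCommutes.isNoetherianRing [Finite ι] (hU : AlmostCommutes K U ω)
    (htop : Algebra.adjoin K (Set.range U) = ⊤) : IsNoetherianRing B := by
  classical
  have := Fintype.ofFinite ι
  let _ : LinearOrder ι := LinearOrder.lift' (Fintype.equivFin ι) (Fintype.equivFin ι).injective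
  let o : MonomialOrder ι := MonomialOrder.lex
  -- The weight comes first, so that error terms of lower weight have lower key; the lexicographic
  -- order breaks ties and makes the key injective.
  let key : Multiset ι → ℕ ×ₗ o.syn := fun s => toLex ((s.map ω).sum, o.toSyn (Multiset.toFinsupp s))
  have hlow : ∀ s, wordSpan K U ω (s.map ω).sum ≤ keySpan K U key (key s) := fun s => by
    refine (wordSpan_le_span_monomialProd hU _).trans (Submodule.span_mono ?_)
    rintro _ ⟨t, ht, rfl⟩
    exact ⟨t, Prod.Lex.toLex_lt_toLex.2 (.inl ht), rfl⟩
  refine isNoetherianRing_of_key (K := K) (U := U) (key := key) ?_ ?_ ?_ ?_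
  · intro s t h
    have h' : o.toSyn (Multiset.toFinsupp s) = o.toSyn (Multiset.toFinsupp t) :=
      congrArg (fun x => (ofLex x).2) h
    simpa using h'
  · intro s t t' h
    rcases Prod.Lex.toLex_lt_toLex.1 h with h | ⟨h, h'⟩
    · exact Prod.Lex.toLex_lt_toLex.2 (.inl (by simpa using h))
    · refine Prod.Lex.toLex_lt_toLex.2 (.inr ⟨by simpa using h, ?_⟩)
      simpa using h'
  · intro s t
    obtain ⟨c, hc, h⟩ := monomialProd_mul hU s t
    exact ⟨c, hc, hlow _ (by simpa using h)⟩
  · intro f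
    have hf : f ∈ (FreeAlgebra.lift K U).range := by
      rw [← Algebra.adjoin_range_eq_range_freeAlgebra_lift, htop]; trivial
    obtain ⟨f, rfl⟩ := hf
    have h := lift_mem_span_monomialProd hU f
    generalize FreeAlgebra.lift K U f = x at h
    have key_le : ∀ s : Multiset ι, ∃ k, key s < k := fun s =>
      ⟨toLex ((s.map ω).sum + 1, 0), Prod.Lex.toLex_lt_toLex.2 (.inl (Nat.lt_succ_self _))⟩
    induction h using Submodule.span_induction with
    | mem x h =>
      obtain ⟨s, rfl⟩ := h
      obtain ⟨k, hk⟩ := key_le s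
      exact ⟨k, Submodule.subset_span ⟨s, hk, rfl⟩⟩
    | zero => exact ⟨key 0, zero_mem _⟩
    | add x y _ _ hx hy =>
      obtain ⟨k, hk⟩ := hx
      obtain ⟨k', hk'⟩ := hy
      exact ⟨max k k', add_mem (keySpan_mono (le_max_left _ _) hk)
        (keySpan_mono (le_max_right _ _) hk')⟩
    | smul c x _ hx => exact hx.imp fun k hk => Submodule.smul_mem _ _ hk

end Noetherian

end DeletingDerivations

namespace DeletingDerivations

/-! ## Quantum tori -/

noncomputable section QuantumTorus

variable {K Γ : Type*} [Field K] [AddCommGroup Γ]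

/-- The quantum torus with basis `T^α` (`α ∈ Γ`) and multiplication
`T^α T^β = q^{b(α, β)} T^{α+β}`. -/
def QTorus (_q : Kˣ) (_b : Γ →+ Γ →+ ℤ) : Type _ := Γ →₀ K

namespace QTorus

variable {q : Kˣ} {b : Γ →+ Γ →+ ℤ}

instance : AddCommGroup (QTorus q b) := inferInstanceAs (AddCommGroup (Γ →₀ K))

instance : Module K (QTorus q b) := inferInstanceAs (Module K (Γ →₀ K))

/-- The basis element `T^α`. -/
def T (q : Kˣ) (b : Γ →+ Γ →+ ℤ) (α : Γ) : QTorus q b := Finsupp.single α 1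

/-- The coefficients of an element of the quantum torus. -/
def coeff : QTorus q b →ₗ[K] (Γ →₀ K) := LinearMap.id

theorem coeff_injective : Function.Injective (coeff : QTorus q b → (Γ →₀ K)) := fun _ _ h => h

@[simp] theorem coeff_T (α : Γ) : coeff (T q b α) = Finsupp.single α 1 := rfl

/-- The linear extension of a function on the basis. -/
def lin {M : Type*} [AddCommGroup M] [Module K M] (v : Γ → M) : QTorus q b →ₗ[K] M :=
  Finsupp.linearCombination K v

@[simp] theorem lin_T {M : Type*} [AddCommGroup M] [Module K M] (v : Γ → M) (α : Γ) :
    lin v (T q b α) = v α := by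
  have h := Finsupp.linearCombination_single (R := K) (v := v) 1 α
  rw [one_smul] at h
  exact h

theorem lin_apply {M : Type*} [AddCommGroup M] [Module K M] (v : Γ → M) (f : QTorus q b) :
    lin v f = ∑ α ∈ (coeff f).support, coeff f α • v α := rfl

theorem hom_ext {M : Type*} [AddCommGroup M] [Module K M] {φ ψ : QTorus q b →ₗ[K] M}
    (h : ∀ α, φ (T q b α) = ψ (T q b α)) : φ = ψ :=
  Finsupp.lhom_ext' fun α => LinearMap.ext_ring (h α)

theorem lin_T_self (f : QTorus q b) : lin (T q b) f = f := by
  have : (lin (T q b) : QTorus q b →ₗ[K] QTorus q b) = LinearMap.id := hom_ext fun α => by simp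
  exact LinearMap.congr_fun this f

theorem eq_sum (f : QTorus q b) : f = ∑ α ∈ (coeff f).support, coeff f α • T q b α := by
  conv_lhs => rw [← lin_T_self f]
  rw [lin_apply]

theorem induction_linear {p : QTorus q b → Prop} (f : QTorus q b) (h0 : p 0)
    (hadd : ∀ f g, p f → p g → p (f + g)) (hT : ∀ (c : K) α, p (c • T q b α)) : p f := by
  rw [eq_sum f]
  exact Finset.sum_induction _ p hadd h0 fun α _ => hT _ _

/-- The multiplication of the quantum torus, as a bilinear map. -/
def mulMap (q : Kˣ) (b : Γ →+ Γ →+ ℤ) : QTorus q b →ₗ[K] QTorus q b →ₗ[K] QTorus q b :=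
  lin fun α => lin fun β => ((q ^ b α β : Kˣ) : K) • T q b (α + β)

theorem mulMap_T (α β : Γ) :
    mulMap q b (T q b α) (T q b β) = ((q ^ b α β : Kˣ) : K) • T q b (α + β) := by
  simp [mulMap]

theorem mulMap_assoc (f g h : QTorus q b) :
    mulMap q b (mulMap q b f g) h = mulMap q b f (mulMap q b g h) := by
  induction f using induction_linear with
  | h0 => simp
  | hadd f f' hf hf' => simp [hf, hf']
  | hT c α =>
    induction g using induction_linear with
    | h0 => simp
    | hadd g g' hg hg' => simp only [map_add, LinearMap.add_apply, hg, hg']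
    | hT d β =>
      induction h using induction_linear with
      | h0 => simp
      | hadd h h' hh hh' => simp only [map_add, hh, hh']
      | hT e γ =>
        simp only [map_smul, LinearMap.smul_apply, mulMap_T, smul_smul,
          map_add, AddMonoidHom.add_apply, add_assoc]
        congr 1
        simp only [zpow_add, Units.val_mul]
        ring

instance : Mul (QTorus q b) := ⟨fun f g => mulMap q b f g⟩

instance : One (QTorus q b) := ⟨T q b 0⟩

theorem mul_def (f g : QTorus q b) : f * g = mulMap q b f g := rfl

theorem one_mul' (f : QTorus q b) : 1 * f = f := by
  have : mulMap q b (T q b 0) = LinearMap.id := hom_ext fun α => by simp [mulMap_T]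
  exact LinearMap.congr_fun this f

theorem mul_one' (f : QTorus q b) : f * 1 = f := by
  have : (mulMap q b).flip (T q b 0) = LinearMap.id := hom_ext fun α => by simp [mulMap_T]
  exact LinearMap.congr_fun this f

instance : Ring (QTorus q b) :=
  { (inferInstance : AddCommGroup (QTorus q b)) with
    mul := (· * ·)
    one := 1
    left_distrib := fun f g h => by simp [mul_def]
    right_distrib := fun f g h => by simp [mul_def]
    zero_mul := fun f => by simp [mul_def]
    mul_zero := fun f => by simp [mul_def]
    mul_assoc := mulMap_assoc
    one_mul := one_mul'
    mul_one := mul_one' }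

instance : Algebra K (QTorus q b) :=
  Algebra.ofModule (fun c f g => by simp [mul_def]) (fun c f g => by simp [mul_def])

theorem T_mul (α β : Γ) : T q b α * T q b β = ((q ^ b α β : Kˣ) : K) • T q b (α + β) :=
  mulMap_T α β

theorem T_zero : T q b 0 = 1 := rfl

theorem T_mul_comm (α β : Γ) :
    T q b α * T q b β = ((q ^ (b α β - b β α) : Kˣ) : K) • (T q b β * T q b α) := by
  rw [T_mul, T_mul, smul_smul, ← Units.val_mul, ← zpow_add, add_comm β α, sub_add_cancel]

/-- The unit `T^α`. -/
def Tunit (q : Kˣ) (b : Γ →+ Γ →+ ℤ) (α : Γ) : (QTorus q b)ˣ where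
  val := T q b α
  inv := ((q ^ b α α : Kˣ) : K) • T q b (-α)
  val_inv := by
    rw [mul_smul_comm, T_mul, smul_smul, ← Units.val_mul, ← zpow_add]; simp [T_zero]
  inv_val := by
    rw [smul_mul_assoc, T_mul, smul_smul, ← Units.val_mul, ← zpow_add]; simp [T_zero]

@[simp] theorem val_Tunit (α : Γ) : (Tunit q b α : QTorus q b) = T q b α := rfl

theorem isUnit_T (α : Γ) : IsUnit (T q b α) := ⟨Tunit q b α, rfl⟩

theorem val_inv_Tunit (α : Γ) :
    ((Tunit q b α)⁻¹ : (QTorus q b)ˣ).val = ((q ^ b α α : Kˣ) : K) • T q b (-α) := rfl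

theorem inverse_T (α : Γ) : Ring.inverse (T q b α) = ((q ^ b α α : Kˣ) : K) • T q b (-α) :=
  Ring.inverse_unit (Tunit q b α)

instance : Nontrivial (QTorus q b) := inferInstanceAs (Nontrivial (Γ →₀ K))

/-! ### The center -/

/-- A parametrization of the radical of the commutation form by `ℤ^s`, together with a function
that trivializes the cocycle on it. -/
structure RadicalChart (b : Γ →+ Γ →+ ℤ) (s : ℕ) where
  /-- the parametrization -/
  emb : (Fin s → ℤ) →+ Γ
  injective : Function.Injective emb
  mem_range : ∀ γ, γ ∈ Set.range emb ↔ ∀ β, b γ β = b β γ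
  /-- the trivialization of the cocycle -/
  quad : (Fin s → ℤ) → ℤ
  quad_add : ∀ n n', quad (n + n') = quad n + quad n' + b (emb n) (emb n')

variable {s : ℕ} (D : RadicalChart b s)

theorem RadicalChart.quad_zero : D.quad 0 = 0 := by
  have := D.quad_add 0 0
  simp at this
  exact this

/-- The embedding of the Laurent polynomial ring onto the center. -/
def fromLaurent (q : Kˣ) : LaurentRing K s →ₐ[K] QTorus q b :=
  AddMonoidAlgebra.lift K _ (Fin s → ℤ)
    { toFun := fun n => ((q ^ D.quad n.toAdd : Kˣ) : K) • T q b (D.emb n.toAdd)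
      map_one' := by simp [D.quad_zero, T_zero]
      map_mul' := fun n n' => by
        simp only [toAdd_mul, smul_mul_assoc, mul_smul_comm, T_mul, smul_smul, ← Units.val_mul,
          ← zpow_add, D.quad_add, map_add]
        congr 3; ring }

/-- The monomial with exponent `n` in the Laurent polynomial ring. -/
def laurentMonomial (K : Type*) [Field K] {s : ℕ} (n : Fin s → ℤ) : LaurentRing K s :=
  AddMonoidAlgebra.single n 1

theorem laurentMonomial_mul (n n' : Fin s → ℤ) :
    laurentMonomial K n * laurentMonomial K n' = laurentMonomial K (n + n') := by
  simp [laurentMonomial, AddMonoidAlgebra.single_mul_single]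

theorem fromLaurent_monomial (n : Fin s → ℤ) :
    fromLaurent D q (laurentMonomial K n) = ((q ^ D.quad n : Kˣ) : K) • T q b (D.emb n) := by
  simp [fromLaurent, laurentMonomial, AddMonoidAlgebra.lift_single]

theorem laurent_hom_ext {M : Type*} [AddCommGroup M] [Module K M]
    {φ ψ : LaurentRing K s →ₗ[K] M}
    (h : ∀ n, φ (laurentMonomial K n) = ψ (laurentMonomial K n)) : φ = ψ := by
  refine AddMonoidAlgebra.lhom_ext' fun n => LinearMap.ext_ring ?_
  exact h n

open Classical in
/-- The projection onto the center. It is a trace. -/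
def toLaurent (q : Kˣ) : QTorus q b →ₗ[K] LaurentRing K s :=
  lin fun γ => if h : ∃ n, D.emb n = γ then
    ((q ^ (-D.quad h.choose) : Kˣ) : K) • laurentMonomial K h.choose else 0

theorem toLaurent_T_emb (n : Fin s → ℤ) :
    toLaurent D q (T q b (D.emb n)) = ((q ^ (-D.quad n) : Kˣ) : K) • laurentMonomial K n := by
  have h : ∃ n', D.emb n' = D.emb n := ⟨n, rfl⟩
  rw [toLaurent, lin_T, dif_pos h, D.injective h.choose_spec]

theorem toLaurent_T_of_notMem {γ : Γ} (h : γ ∉ Set.range D.emb) :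
    toLaurent D q (T q b γ) = 0 := by
  rw [toLaurent, lin_T, dif_neg (by simpa using h)]

theorem toLaurent_fromLaurent (z : LaurentRing K s) : toLaurent D q (fromLaurent D q z) = z := by
  have : (toLaurent D q) ∘ₗ (fromLaurent D q).toLinearMap = LinearMap.id :=
    laurent_hom_ext fun n => by
      simp only [LinearMap.comp_apply, AlgHom.toLinearMap_apply, fromLaurent_monomial, map_smul,
        toLaurent_T_emb, smul_smul, LinearMap.id_apply]
      rw [← Units.val_mul, ← zpow_add]; simp
  exact LinearMap.congr_fun this z

/-- The projection is linear over the center, because adding a radical exponent does not change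
whether an exponent is radical. -/
theorem mul_fromLaurent_bilinear (f : QTorus q b) (z : LaurentRing K s) :
    toLaurent D q (f * fromLaurent D q z) = toLaurent D q f * z := by
  induction f using induction_linear with
  | h0 => simp
  | hadd f g hf hg => simp [add_mul, hf, hg]
  | hT c γ =>
    have : (toLaurent D q) ∘ₗ (LinearMap.mulLeft K (T q b γ)) ∘ₗ (fromLaurent D q).toLinearMap
        = LinearMap.mulLeft K (toLaurent D q (T q b γ)) := laurent_hom_ext fun n => by
      simp only [LinearMap.comp_apply, AlgHom.toLinearMap_apply, fromLaurent_monomial,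
        LinearMap.mulLeft_apply, T_mul, map_smul, smul_smul]
      by_cases h : γ ∈ Set.range D.emb
      · obtain ⟨n', rfl⟩ := h
        rw [← map_add, toLaurent_T_emb, toLaurent_T_emb, smul_smul, smul_mul_assoc,
          laurentMonomial_mul, D.quad_add, ← Units.val_mul, ← Units.val_mul, ← zpow_add, ← zpow_add]
        congr 3; ring
      · rw [toLaurent_T_of_notMem D h, toLaurent_T_of_notMem D, smul_zero, zero_mul]
        rintro ⟨n', hn'⟩
        exact h ⟨n' - n, by rw [map_sub, hn', add_sub_cancel_right]⟩
    have h2 := LinearMap.congr_fun this z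
    simp only [LinearMap.comp_apply, AlgHom.toLinearMap_apply, LinearMap.mulLeft_apply] at h2
    rw [smul_mul_assoc, map_smul, h2, map_smul, smul_mul_assoc]

/-- Only pairs with `α + β` in the radical contribute. Then `α + β` is in symmetric position to `α`,
which forces `b α β = b β α`. -/
theorem toLaurent_mul_comm (f g : QTorus q b) :
    toLaurent D q (f * g) = toLaurent D q (g * f) := by
  induction f using induction_linear with
  | h0 => simp
  | hadd f f' hf hf' => simp [add_mul, mul_add, hf, hf']
  | hT c α =>
    induction g using induction_linear with
    | h0 => simp
    | hadd g g' hg hg' => simp [add_mul, mul_add] at *; rw [hg, hg']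
    | hT d β =>
      simp only [smul_mul_assoc, mul_smul_comm, map_smul, T_mul, add_comm β α]
      by_cases h : α + β ∈ Set.range D.emb
      · have h1 := (D.mem_range _).1 h α
        simp only [map_add, AddMonoidHom.add_apply] at h1
        have h2 : b α β = b β α := by omega
        rw [h2, smul_comm c d]
      · rw [toLaurent_T_of_notMem D h]; simp

/-! ### Ideals induced from the center -/

/-- The ideal of the quantum torus induced from an ideal of its center. -/
def induced (I : Ideal (LaurentRing K s)) : Ideal (QTorus q b) where
  carrier := {f | ∀ g, toLaurent D q (g * f) ∈ I}
  zero_mem' := fun g => by simp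
  add_mem' := fun hf hg h => by rw [mul_add, map_add]; exact add_mem (hf h) (hg h)
  smul_mem' := fun c f hf g => by rw [smul_eq_mul, ← mul_assoc]; exact hf _

variable {D}

theorem mem_induced {I : Ideal (LaurentRing K s)} {f : QTorus q b} :
    f ∈ induced D I ↔ ∀ g, toLaurent D q (g * f) ∈ I := Iff.rfl

theorem mul_mem_induced {I : Ideal (LaurentRing K s)} {f : QTorus q b} (h : f ∈ induced D I)
    (g : QTorus q b) : f * g ∈ induced D I := fun g' => by
  rw [← mul_assoc, toLaurent_mul_comm, ← mul_assoc]; exact h _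

theorem fromLaurent_mem_induced {I : Ideal (LaurentRing K s)} {z : LaurentRing K s} :
    fromLaurent D q z ∈ induced D I ↔ z ∈ I := by
  constructor
  · intro h
    have := h 1
    rwa [one_mul, toLaurent_fromLaurent] at this
  · intro h g
    rw [mul_fromLaurent_bilinear]
    exact I.mul_mem_left _ h

theorem one_notMem_induced {I : Ideal (LaurentRing K s)} (hI : I ≠ ⊤) :
    (1 : QTorus q b) ∉ induced D I := by
  rw [← map_one (fromLaurent D q), fromLaurent_mem_induced]
  exact (Ideal.ne_top_iff_one I).1 hI

theorem smul_mem_iff_of_ne_zero {M : Type*} [AddCommGroup M] [Module K M] {S : Type*}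
    [SetLike S M] [SMulMemClass S K M] {N : S} {c : K} (hc : c ≠ 0) {x : M} : c • x ∈ N ↔ x ∈ N :=
  ⟨fun h => by simpa [smul_smul, inv_mul_cancel₀ hc] using SMulMemClass.smul_mem c⁻¹ h,
    fun h => SMulMemClass.smul_mem c h⟩

variable (D) in
/-- The component of `f` in `T^α · center`. -/
def component (α : Γ) (f : QTorus q b) : QTorus q b :=
  T q b α * fromLaurent D q (toLaurent D q ((Tunit q b α)⁻¹.val * f))

theorem fromLaurent_toLaurent_T {γ : Γ} (h : γ ∈ Set.range D.emb) :
    fromLaurent D q (toLaurent D q (T q b γ)) = T q b γ := by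
  obtain ⟨n, rfl⟩ := h
  rw [toLaurent_T_emb, map_smul, fromLaurent_monomial, smul_smul, ← Units.val_mul, ← zpow_add]
  simp

theorem inv_Tunit_mul_T (α β : Γ) :
    ∃ c : K, c ≠ 0 ∧ (Tunit q b α)⁻¹.val * T q b β = c • T q b (β - α) := by
  rw [val_inv_Tunit, smul_mul_assoc, T_mul, smul_smul, ← Units.val_mul]
  exact ⟨_, Units.ne_zero _, by rw [neg_add_eq_sub]⟩

open Classical in
theorem coeff_component (α : Γ) (f : QTorus q b) (β : Γ) :
    coeff (component D α f) β = if β - α ∈ Set.range D.emb then coeff f β else 0 := by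
  induction f using induction_linear with
  | h0 => simp [component]
  | hadd f g hf hg =>
    have : component D α (f + g) = component D α f + component D α g := by
      simp [component, mul_add]
    rw [this, map_add, map_add, Finsupp.add_apply, Finsupp.add_apply, hf, hg]
    split_ifs <;> simp
  | hT c γ =>
    have h : component D α (T q b γ) = if γ - α ∈ Set.range D.emb then T q b γ else 0 := by
      obtain ⟨d, hd, h⟩ := inv_Tunit_mul_T (q := q) (b := b) α γ
      split_ifs with hγ
      · rw [component, h, map_smul, map_smul, fromLaurent_toLaurent_T hγ, ← h, ← val_Tunit α,
          Units.mul_inv_cancel_left]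
      · rw [component, h, map_smul, toLaurent_T_of_notMem D hγ]; simp
    have h2 : component D α (c • T q b γ) = c • component D α (T q b γ) := by
      simp [component]
    rw [h2, h, map_smul, map_smul, Finsupp.smul_apply, Finsupp.smul_apply]
    by_cases hβ : γ = β
    · subst hβ; split_ifs <;> simp
    · split_ifs <;> simp [hβ]

theorem card_support_sub_component_lt {α : Γ} {f : QTorus q b} (h : α ∈ (coeff f).support) :
    (coeff (f - component D α f)).support.card < (coeff f).support.card := by
  refine Finset.card_lt_card (Finset.ssubset_iff_subset_ne.2 ⟨fun β hβ => ?_, fun e => ?_⟩)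
  · simp only [Finsupp.mem_support_iff, map_sub, Finsupp.sub_apply, coeff_component] at hβ ⊢
    rintro h0
    simp [h0] at hβ
  · rw [← e] at h
    simp only [Finsupp.mem_support_iff, map_sub, Finsupp.sub_apply, coeff_component, sub_self] at h
    rw [if_pos ⟨0, by simp⟩] at h
    simp at h

/-- An ideal that is stable under the projection onto the center is induced from the center. -/
theorem eq_induced_of_projection_mem {Q : Ideal (QTorus q b)}
    (hQ : ∀ f ∈ Q, fromLaurent D q (toLaurent D q f) ∈ Q) :
    Q = induced D (Q.comap (fromLaurent D q)) := by
  refine le_antisymm (fun f hf g => hQ _ (Q.mul_mem_left _ hf)) ?_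
  intro f hf
  induction hn : (coeff f).support.card using Nat.strong_induction_on generalizing f with
  | _ n ih =>
    by_cases h0 : (coeff f).support = ∅
    · rw [Finsupp.support_eq_empty] at h0
      rw [show f = 0 from coeff_injective (by rw [h0, map_zero])]
      exact zero_mem _
    · obtain ⟨α, hα⟩ := Finset.nonempty_iff_ne_empty.2 h0
      -- The component is a multiple of a central element of `Q`. Removing it keeps `f` in the
      -- induced ideal and shrinks the support.
      have hc : component D α f ∈ Q := Q.mul_mem_left _ (hf _)
      have h1 := ih _ (hn ▸ card_support_sub_component_lt (D := D) hα) (sub_mem hf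
        (fun g => hQ _ (Q.mul_mem_left _ hc))) rfl
      simpa using add_mem h1 hc

/-- Components whose central coefficient lies in `I` are discarded one after another. The result
represents `f` modulo the induced ideal by an element all of whose central coefficients are nonzero
modulo `I`. -/
theorem exists_reduced {I : Ideal (LaurentRing K s)} (f : QTorus q b) :
    ∃ f', f - f' ∈ induced D I ∧ ∀ α ∈ (coeff f').support,
      toLaurent D q ((Tunit q b α)⁻¹.val * f') ∉ I := by
  induction hn : (coeff f).support.card using Nat.strong_induction_on generalizing f with
  | _ n ih =>
    by_cases h : ∀ α ∈ (coeff f).support, toLaurent D q ((Tunit q b α)⁻¹.val * f) ∉ I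
    · exact ⟨f, by simp, h⟩
    · push Not at h
      obtain ⟨α, hα, hI⟩ := h
      obtain ⟨f', hf', h'⟩ := ih _ (hn ▸ card_support_sub_component_lt (D := D) hα) _ rfl
      refine ⟨f', ?_, h'⟩
      have hc : component D α f ∈ induced D I :=
        (induced D I).mul_mem_left _ (fromLaurent_mem_induced.2 hI)
      have := add_mem hf' hc
      rwa [sub_right_comm, sub_add_cancel] at this

theorem toLaurent_mul_of_mem {α β : Γ} (hβ : β ∈ Set.range D.emb) :
    toLaurent D q (T q b α * T q b β) = toLaurent D q (T q b α) * toLaurent D q (T q b β) := by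
  rw [← mul_fromLaurent_bilinear, fromLaurent_toLaurent_T hβ]

/-- Ideals induced from prime ideals of the center are completely prime. -/
theorem mem_or_mem_of_mul_mem_induced {I : Ideal (LaurentRing K s)} (hI : I.IsPrime)
    {f g : QTorus q b} (h : f * g ∈ induced D I) : f ∈ induced D I ∨ g ∈ induced D I := by
  classical
  obtain ⟨f', hf, hf'⟩ := exists_reduced (D := D) (I := I) f
  obtain ⟨g', hg, hg'⟩ := exists_reduced (D := D) (I := I) g
  by_contra hcon
  push Not at hcon
  have hmem : f' * g' ∈ induced D I := by
    have h1 := mul_mem_induced hf g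
    have h2 := (induced D I).mul_mem_left f' hg
    have h3 := sub_mem h (add_mem h1 h2)
    convert h3 using 1
    noncomm_ring
  have hne : ∀ {f f' : QTorus q b}, f - f' ∈ induced D I → f ∉ induced D I →
      (coeff f').support.Nonempty := by
    intro f f' hff hf
    rw [Finset.nonempty_iff_ne_empty, Ne, Finsupp.support_eq_empty]
    intro h0
    rw [show f' = 0 from coeff_injective (by rw [h0, map_zero]), sub_zero] at hff
    exact hf hff
  -- `M γ` is the commutation character of `γ`. Its kernel is the radical, so the exponents modulo
  -- the radical embed into the torsion-free group `Γ → ℤ`, where two finite nonempty sets always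
  -- have a uniquely attained sum.
  let M : Γ → (Γ → ℤ) := fun γ β => b γ β - b β γ
  have hMadd : ∀ α β, M (α + β) = M α + M β := fun α β => by
    funext γ; simp [M]; ring
  have hMsub : ∀ α β, M α = M β → α - β ∈ Set.range D.emb := fun α β e => by
    rw [D.mem_range]
    intro γ
    have := congrFun e γ
    simp only [M] at this
    simp only [map_sub, AddMonoidHom.sub_apply]
    omega
  have hMz : ∀ γ ∈ Set.range D.emb, M γ = 0 := fun γ hγ => by
    funext β
    have := (D.mem_range γ).1 hγ β
    simp [M, this]
  obtain ⟨δ₁, hδ₁, δ₂, hδ₂, huniq⟩ := UniqueSums.uniqueAdd_of_nonempty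
    ((hne hf hcon.1).image M) ((hne hg hcon.2).image M)
  obtain ⟨α₁, hα₁, rfl⟩ := Finset.mem_image.1 hδ₁
  obtain ⟨β₂, hβ₂, rfl⟩ := Finset.mem_image.1 hδ₂
  have hz : toLaurent D q ((Tunit q b α₁)⁻¹.val * f' * (g' * (Tunit q b β₂)⁻¹.val)) ∈ I := by
    have := mul_mem_induced hmem (Tunit q b β₂)⁻¹.val (Tunit q b α₁)⁻¹.val
    simpa [mul_assoc] using this
  -- Only the coset with the unique sum contributes to this coefficient of `f' * g'`, so it factors
  -- into one coefficient of each, neither of which lies in `I`.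
  have key : toLaurent D q ((Tunit q b α₁)⁻¹.val * f' * (g' * (Tunit q b β₂)⁻¹.val))
      = toLaurent D q ((Tunit q b α₁)⁻¹.val * f') * toLaurent D q (g' * (Tunit q b β₂)⁻¹.val) := by
    rw [eq_sum f', eq_sum g']
    simp only [Finset.mul_sum, Finset.sum_mul, map_sum]
    refine Finset.sum_congr rfl fun β hβ => Finset.sum_congr rfl fun α hα => ?_
    simp only [mul_smul_comm, smul_mul_assoc, map_smul]
    congr 2
    obtain ⟨c, hc, e1⟩ := inv_Tunit_mul_T (q := q) (b := b) α₁ α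
    have e2 : ∃ d : K, d ≠ 0 ∧ T q b β * (Tunit q b β₂)⁻¹.val = d • T q b (β - β₂) := by
      rw [val_inv_Tunit, mul_smul_comm, T_mul, smul_smul, ← Units.val_mul]
      exact ⟨_, Units.ne_zero _, by rw [← sub_eq_add_neg]⟩
    obtain ⟨d, hd, e2⟩ := e2
    rw [e1, e2]
    simp only [mul_smul_comm, smul_mul_assoc, map_smul]
    congr 2
    by_cases hs : (α - α₁) + (β - β₂) ∈ Set.range D.emb
    · have h1 := hMz _ hs
      have h2 : M α + M β = M α₁ + M β₂ := by
        have e : M (α + β) = M ((α - α₁) + (β - β₂)) + M (α₁ + β₂) := by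
          rw [← hMadd]; congr 1; abel
        rw [hMadd, h1, zero_add, hMadd] at e
        exact e
      obtain ⟨-, h4⟩ := huniq (Finset.mem_image_of_mem M hα) (Finset.mem_image_of_mem M hβ) h2
      exact toLaurent_mul_of_mem (hMsub _ _ h4)
    · rw [T_mul, map_smul, toLaurent_T_of_notMem D hs, smul_zero]
      by_cases h1 : α - α₁ ∈ Set.range D.emb
      · by_cases h2 : β - β₂ ∈ Set.range D.emb
        · obtain ⟨n, hn⟩ := h1
          obtain ⟨n', hn'⟩ := h2
          exact absurd ⟨n + n', by rw [map_add, hn, hn']⟩ hs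
        · rw [toLaurent_T_of_notMem D h2, mul_zero]
      · rw [toLaurent_T_of_notMem D h1, zero_mul]
  rw [key] at hz
  rcases hI.mem_or_mem hz with h1 | h1
  · exact hf' _ hα₁ h1
  · rw [toLaurent_mul_comm] at h1
    exact hg' _ hβ₂ h1

/-- A subspace that is stable under diagonal operators which separate the radical from its
complement is stable under the projection onto the center. -/
theorem projection_mem {J : Type*} {Q : Submodule K (QTorus q b)} (μ : J → Γ → K)
    (hQ : ∀ j, ∀ f ∈ Q, lin (fun α => μ j α • T q b α) f ∈ Q)
    (h0 : ∀ j, ∀ γ ∈ Set.range D.emb, μ j γ = μ j 0)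
    (hsep : ∀ γ ∉ Set.range D.emb, ∃ j, μ j γ ≠ μ j 0) {f : QTorus q b} (hf : f ∈ Q) :
    fromLaurent D q (toLaurent D q f) ∈ Q := by
  induction hn : (coeff f).support.card using Nat.strong_induction_on generalizing f with
  | _ n ih =>
    by_cases h : ∀ α ∈ (coeff f).support, α ∈ Set.range D.emb
    · have : fromLaurent D q (toLaurent D q f) = f := by
        conv_rhs => rw [eq_sum f]
        conv_lhs => rw [eq_sum f]
        simp only [map_sum, map_smul]
        exact Finset.sum_congr rfl fun α hα => by rw [fromLaurent_toLaurent_T (h α hα)]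
      rwa [this]
    · push Not at h
      obtain ⟨α, hα, hαD⟩ := h
      obtain ⟨j, hj⟩ := hsep α hαD
      -- This operator kills the term at `α` and multiplies the central part by the nonzero scalar
      -- `μ j 0 - μ j α`.
      let φ : QTorus q b →ₗ[K] QTorus q b := lin (fun α => μ j α • T q b α) - μ j α • LinearMap.id
      have hφ : ∀ γ, φ (T q b γ) = (μ j γ - μ j α) • T q b γ := fun γ => by
        simp [φ, sub_smul]
      have hcoeff : ∀ γ, coeff (φ f) γ = (μ j γ - μ j α) * coeff f γ := by
        intro γ
        have : Finsupp.lapply γ ∘ₗ coeff ∘ₗ φ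
            = (μ j γ - μ j α) • (Finsupp.lapply γ ∘ₗ coeff (q := q) (b := b)) :=
          hom_ext fun β => by
            by_cases hβ : β = γ
            · simp [hφ, hβ]
            · simp [hφ, hβ]
        exact LinearMap.congr_fun this f
      have hproj : fromLaurent D q (toLaurent D q (φ f))
          = (μ j 0 - μ j α) • fromLaurent D q (toLaurent D q f) := by
        have : (fromLaurent D q).toLinearMap ∘ₗ toLaurent D q ∘ₗ φ
            = (μ j 0 - μ j α) • ((fromLaurent D q).toLinearMap ∘ₗ toLaurent D q) :=
          hom_ext fun γ => by
            simp only [LinearMap.comp_apply, hφ, map_smul, LinearMap.smul_apply]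
            by_cases hγ : γ ∈ Set.range D.emb
            · rw [h0 j γ hγ]
            · rw [toLaurent_T_of_notMem D hγ]; simp
        exact LinearMap.congr_fun this f
      have hmem : φ f ∈ Q := sub_mem (hQ j f hf) (Q.smul_mem _ hf)
      have hlt : (coeff (φ f)).support.card < n := by
        rw [← hn]
        refine Finset.card_lt_card (Finset.ssubset_iff_subset_ne.2 ⟨fun β hβ => ?_, fun e => ?_⟩)
        · rw [Finsupp.mem_support_iff, hcoeff] at hβ
          exact Finsupp.mem_support_iff.2 (right_ne_zero_of_mul hβ)
        · rw [← e, Finsupp.mem_support_iff, hcoeff, sub_self, zero_mul] at hα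
          exact hα rfl
      have := ih _ hlt hmem rfl
      rw [hproj] at this
      exact (smul_mem_iff_of_ne_zero (sub_ne_zero.2 (Ne.symm hj))).1 this

end QTorus

end QuantumTorus

end DeletingDerivations

namespace DeletingDerivations

noncomputable section

/-! ## Restored families in quantum tori -/

variable {m p : ℕ}

/-- The position of an index in the lexicographic order, counted from `0`. -/
def lexIndex (b : Fin m × Fin p) : ℕ := (finProdFinEquiv b : ℕ)

theorem lexIndex_eq (b : Fin m × Fin p) : lexIndex b = b.2 + p * b.1 := rfl

/-- The index at position `N` of the lexicographic order. -/
def indexAt {N : ℕ} (h : N < m * p) : Fin m × Fin p := finProdFinEquiv.symm ⟨N, h⟩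

@[simp] theorem lexIndex_indexAt {N : ℕ} (h : N < m * p) :
    lexIndex (indexAt h : Fin m × Fin p) = N := by
  rw [lexIndex, indexAt, Equiv.apply_symm_apply]

theorem lexIndex_injective : Function.Injective (lexIndex : Fin m × Fin p → ℕ) :=
  Fin.val_injective.comp finProdFinEquiv.injective

theorem lexIndex_lt (b : Fin m × Fin p) : lexIndex b < m * p := (finProdFinEquiv b).2

theorem lexIndex_lt_of_row_lt {a b : Fin m × Fin p} (h : a.1 < b.1) : lexIndex a < lexIndex b := by
  have h1 : (a.1 : ℕ) + 1 ≤ b.1 := h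
  have h2 := Nat.mul_le_mul_left p h1
  have h3 := a.2.2
  simp only [lexIndex_eq]
  rw [mul_add] at h2
  omega

theorem lexIndex_lt_iff {a b : Fin m × Fin p} :
    lexIndex a < lexIndex b ↔ a.1 < b.1 ∨ (a.1 = b.1 ∧ a.2 < b.2) := by
  rcases lt_trichotomy a.1 b.1 with h | h | h
  · simp [h, lexIndex_lt_of_row_lt h]
  · simp [lexIndex_eq, h]
  · have := lexIndex_lt_of_row_lt h
    simp [h.ne', h.not_gt, this.le]

/-- The pivots whose correction terms are still present when `N` pivots are left. -/
def activeSet (m p N : ℕ) : Set (Fin m × Fin p) := {b | lexIndex b < N}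

theorem mem_activeSet {N : ℕ} {b : Fin m × Fin p} : b ∈ activeSet m p N ↔ lexIndex b < N := Iff.rfl

theorem activeSet_succ {N : ℕ} (h : N < m * p) :
    activeSet m p (N + 1) = insert (indexAt h) (activeSet m p N) := by
  ext b
  rw [Set.mem_insert_iff, mem_activeSet, mem_activeSet, Nat.lt_succ_iff_lt_or_eq, or_comm]
  refine or_congr_left ⟨fun e => lexIndex_injective (by rw [e, lexIndex_indexAt]), fun e => ?_⟩
  rw [e, lexIndex_indexAt]

theorem restoreSetting_of_stageRel {k B : Type*} [CommRing k] [Ring B] [Algebra k B] {q : kˣ}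
    {N : ℕ} {h : N < m * p} {V : Fin m × Fin p → B} (hV : StageRel q (activeSet m p N) V)
    (hu : IsUnit (V (indexAt h))) :
    RestoreSetting q (activeSet m p N) V ((indexAt h).1, (indexAt h).2) where
  rel := hV
  unit := hu
  northWest b h1 h2 h3 := by
    rw [mem_activeSet, ← lexIndex_indexAt h, lexIndex_lt_iff]
    rcases h1.lt_or_eq with h1 | h1
    · exact .inl h1
    · exact .inr ⟨h1, h2.lt_of_ne fun e => h3 (Prod.ext h1 e)⟩
  southEast b h1 h2 := by
    rw [mem_activeSet, ← lexIndex_indexAt h, lexIndex_lt_iff]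
    rintro (h3 | ⟨-, h3⟩)
    · exact h3.not_ge h1
    · exact h3.not_ge h2

theorem StageRel.restoreStep {k B : Type*} [CommRing k] [Ring B] [Algebra k B] {q : kˣ}
    {N : ℕ} (h : N < m * p) {V : Fin m × Fin p → B} (hV : StageRel q (activeSet m p N) V)
    (hu : IsUnit (V (indexAt h))) :
    StageRel q (activeSet m p (N + 1)) (restoreStep (indexAt h) V) := by
  rw [activeSet_succ h]
  exact (restoreSetting_of_stageRel hV hu).stageRel_restoreStep

/-- The commutation exponents `λ_{ab}`. -/
def lambdaInt (a b : Fin m × Fin p) : ℤ :=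
  if (a.1 = b.1 ∧ a.2 < b.2) ∨ (a.2 = b.2 ∧ a.1 < b.1) then 1
  else if (a.1 = b.1 ∧ b.2 < a.2) ∨ (a.2 = b.2 ∧ b.1 < a.1) then -1
  else 0

theorem lambdaMatrix_eq (a b : Fin m × Fin p) : lambdaMatrix m p a b = (lambdaInt a b : ℚ) := by
  unfold lambdaMatrix lambdaInt
  split_ifs <;> simp

theorem lambdaInt_swap (a b : Fin m × Fin p) : lambdaInt b a = -lambdaInt a b := by
  unfold lambdaInt
  split_ifs <;> first | rfl | (exfalso; simp only [Fin.lt_def, Fin.ext_iff] at *; omega)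

/-- The exponents of the cocycle of the quantum torus. -/
def cocycleExponent (a b : Fin m × Fin p) : ℤ := if lexIndex a < lexIndex b then lambdaInt a b else 0

theorem cocycleExponent_sub (a b : Fin m × Fin p) :
    cocycleExponent a b - cocycleExponent b a = lambdaInt a b := by
  unfold cocycleExponent
  rcases lt_trichotomy (lexIndex a) (lexIndex b) with h | h | h
  · simp [h, h.not_gt]
  · obtain rfl := lexIndex_injective h
    simp [lambdaInt]
  · simp [h, h.not_gt, lambdaInt_swap a b]

/-- The exponents of Laurent monomials in the generators with index outside of `w`. -/
abbrev Exponent (w : Finset (Fin m × Fin p)) : Type := {a : Fin m × Fin p // a ∉ w} → ℤ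

/-- The cocycle of the quantum torus with generators indexed by the complement of `w`. -/
def torusForm (w : Finset (Fin m × Fin p)) : Exponent w →+ Exponent w →+ ℤ :=
  AddMonoidHom.mk' (fun α => AddMonoidHom.mk'
    (fun β => ∑ a, ∑ c, cocycleExponent a.1 c.1 * α a * β c)
    (fun β β' => by simp only [Pi.add_apply, mul_add, Finset.sum_add_distrib]))
    (fun α α' => by
      refine AddMonoidHom.ext fun β => ?_
      simp only [AddMonoidHom.mk'_apply, AddMonoidHom.add_apply, Pi.add_apply, mul_add,
        add_mul, Finset.sum_add_distrib])

theorem torusForm_apply (w : Finset (Fin m × Fin p)) (α β : Exponent w) :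
    torusForm w α β = ∑ a, ∑ c, cocycleExponent a.1 c.1 * α a * β c := rfl

theorem torusForm_sub (w : Finset (Fin m × Fin p)) (α β : Exponent w) :
    torusForm w α β - torusForm w β α = ∑ a, ∑ c, lambdaInt a.1 c.1 * α a * β c := by
  rw [torusForm_apply, torusForm_apply, Finset.sum_comm (f := fun a c => _ * β a * α c),
    ← Finset.sum_sub_distrib]
  refine Finset.sum_congr rfl fun a _ => ?_
  rw [← Finset.sum_sub_distrib]
  refine Finset.sum_congr rfl fun c _ => ?_
  rw [← cocycleExponent_sub]; ring

theorem torusForm_single_sub (w : Finset (Fin m × Fin p)) (a : {a // a ∉ w}) (β : Exponent w) :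
    torusForm w (Pi.single a 1) β - torusForm w β (Pi.single a 1)
      = ∑ c, lambdaInt a.1 c.1 * β c := by
  rw [torusForm_sub, Finset.sum_eq_single a]
  · simp
  · intro c _ hc; simp [hc]
  · simp

variable {K : Type*} [Field K]

/-- The quantum torus with generators indexed by the complement of `w`. -/
abbrev DiagramTorus (q : Kˣ) (w : Finset (Fin m × Fin p)) : Type _ := QTorus q (torusForm w)

open Classical in
/-- The generators of the quantum torus attached to `w`; those with index in `w` are set to `0`. -/
def torusGen (q : Kˣ) (w : Finset (Fin m × Fin p)) (b : Fin m × Fin p) : DiagramTorus q w :=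
  if h : b ∉ w then QTorus.T q _ (Pi.single ⟨b, h⟩ 1) else 0

theorem torusGen_of_notMem {q : Kˣ} {w : Finset (Fin m × Fin p)} {b : Fin m × Fin p} (h : b ∉ w) :
    torusGen q w b = QTorus.T q _ (Pi.single ⟨b, h⟩ 1) := dif_pos h

theorem torusGen_of_mem {q : Kˣ} {w : Finset (Fin m × Fin p)} {b : Fin m × Fin p} (h : b ∈ w) :
    torusGen q w b = 0 := dif_neg (by simpa using h)

theorem torusGen_mul_comm (q : Kˣ) (w : Finset (Fin m × Fin p)) (a b : Fin m × Fin p) :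
    torusGen q w a * torusGen q w b
      = ((q ^ lambdaInt a b : Kˣ) : K) • (torusGen q w b * torusGen q w a) := by
  by_cases ha : a ∈ w
  · simp [torusGen_of_mem ha]
  by_cases hb : b ∈ w
  · simp [torusGen_of_mem hb]
  rw [torusGen_of_notMem ha, torusGen_of_notMem hb, QTorus.T_mul_comm, torusForm_single_sub,
    Finset.sum_eq_single ⟨b, hb⟩]
  · simp
  · intro c _ hc; simp [hc]
  · simp

/-- With `N ≤ 1` at most the top left index is active, and it is never the larger index of a
diagonal pair; so no correction term occurs. -/
theorem StageRel.of_mul_comm {B : Type*} [Ring B] [Algebra K B] {q : Kˣ}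
    {U : Fin m × Fin p → B} {N : ℕ} (hN : N ≤ 1)
    (h : ∀ a b, U a * U b = ((q ^ lambdaInt a b : Kˣ) : K) • (U b * U a)) :
    StageRel q (activeSet m p N) U where
  col i i' j hi := by rw [h]; simp [lambdaInt, hi]
  row i j j' hj := by rw [h]; simp [lambdaInt, hj]
  anti i i' j j' hi hj := by rw [h]; simp [lambdaInt, hi.ne, hj.ne']
  diag i i' j j' hi hj hS := by
    rw [mem_activeSet, lexIndex_eq] at hS
    have : (j : ℕ) < j' := hj
    simp only at hS
    omega
  comm i i' j j' hi hj _ := by rw [h]; simp [lambdaInt, hi.ne, hj.ne]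

theorem stageRel_torusGen (q : Kˣ) (w : Finset (Fin m × Fin p)) {N : ℕ} (hN : N ≤ 1) :
    StageRel q (activeSet m p N) (torusGen q w) :=
  .of_mul_comm hN (torusGen_mul_comm q w)

/-- The families obtained from the generators of the quantum torus attached to `w` by restoring the
first `N` pivots. -/
def restored (q : Kˣ) (w : Finset (Fin m × Fin p)) : ℕ → Fin m × Fin p → DiagramTorus q w
  | 0 => torusGen q w
  | N + 1 => if h : N < m * p then restoreStep (indexAt h) (restored q w N) else restored q w N

theorem restored_succ {q : Kˣ} {w : Finset (Fin m × Fin p)} {N : ℕ} (h : N < m * p) :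
    restored q w (N + 1) = restoreStep (indexAt h) (restored q w N) := dif_pos h

/-- A step changes only rows strictly above its pivot, and the first `p * (b.1 + 1)` pivots lie in
rows up to that of `b`. -/
theorem restored_eq_torusGen (q : Kˣ) (w : Finset (Fin m × Fin p)) {N : ℕ} {b : Fin m × Fin p}
    (h : N ≤ p * (b.1 + 1)) : restored q w N b = torusGen q w b := by
  induction N with
  | zero => rfl
  | succ N ih =>
    by_cases hN : N < m * p
    · rw [restored_succ hN, restoreStep, if_neg, ih (by omega)]
      rintro ⟨h1, -⟩
      have h2 : (b.1 : ℕ) + 1 ≤ (indexAt hN : Fin m × Fin p).1 := h1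
      have h3 := lexIndex_indexAt hN
      rw [lexIndex_eq] at h3
      have h4 := Nat.mul_le_mul_left p h2
      omega
    · rw [restored, dif_neg hN, ih (by omega)]

theorem restored_row_of_pivot (q : Kˣ) (w : Finset (Fin m × Fin p)) {N : ℕ} (h : N < m * p)
    (j : Fin p) : restored q w N ((indexAt h).1, j) = torusGen q w ((indexAt h).1, j) := by
  refine restored_eq_torusGen q w ?_
  have h3 := lexIndex_indexAt h
  rw [lexIndex_eq] at h3
  have := (indexAt h : Fin m × Fin p).2.2
  simp only [mul_add]
  omega

theorem restored_pivot (q : Kˣ) (w : Finset (Fin m × Fin p)) {N : ℕ} (h : N < m * p) :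
    restored q w N (indexAt h) = torusGen q w (indexAt h) :=
  restored_row_of_pivot q w h _

theorem isUnit_torusGen {q : Kˣ} {w : Finset (Fin m × Fin p)} {b : Fin m × Fin p} (h : b ∉ w) :
    IsUnit (torusGen q w b) := by
  rw [torusGen_of_notMem h]; exact QTorus.isUnit_T _

/-- Column entries above a pivot vanish if the corresponding indices all lie in `w`. -/
theorem restored_col_of_pivot (q : Kˣ) (w : Finset (Fin m × Fin p)) {N : ℕ} (h : N < m * p)
    (hw : ∀ i < (indexAt h).1, (i, (indexAt h).2) ∈ w) {i : Fin m} (hi : i < (indexAt h).1) :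
    restored q w N (i, (indexAt h).2) = 0 := by
  have : ∀ n ≤ N, ∀ i < (indexAt h : Fin m × Fin p).1,
      restored q w n (i, (indexAt h).2) = 0 := by
    intro n
    induction n with
    | zero => exact fun _ i hi => torusGen_of_mem (hw i hi)
    | succ n ih =>
      intro hn i hi
      have hn' : n < m * p := by omega
      rw [restored_succ hn', restoreStep, ih (by omega) i hi]
      split_ifs with hc
      · have hlt : (indexAt hn' : Fin m × Fin p).1 < (indexAt h : Fin m × Fin p).1 := by
          have h1 : lexIndex (indexAt hn' : Fin m × Fin p) < lexIndex (indexAt h : Fin m × Fin p) := by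
            rw [lexIndex_indexAt, lexIndex_indexAt]; omega
          rcases lexIndex_lt_iff.1 h1 with h2 | h2
          · exact h2
          · exact absurd h2.2 hc.2.not_gt
        rw [ih (by omega) _ hlt, mul_zero, add_zero]
      · rfl
  exact this N le_rfl i hi

/-- The first `N` indices satisfy the condition for Cauchon diagrams: with an index, the diagram
contains all the indices to the left of it or all the indices above it. -/
def IsCauchonBelow (w : Finset (Fin m × Fin p)) (N : ℕ) : Prop :=
  ∀ b ∈ w, lexIndex b < N → (∀ j < b.2, (b.1, j) ∈ w) ∨ (∀ i < b.1, (i, b.2) ∈ w)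

/-- Cauchon diagrams. -/
def IsCauchon (w : Finset (Fin m × Fin p)) : Prop := ∀ N, IsCauchonBelow w N

theorem IsCauchonBelow.mono {w : Finset (Fin m × Fin p)} {N N' : ℕ} (h : IsCauchonBelow w N')
    (hN : N ≤ N') : IsCauchonBelow w N := fun b hb hlt => h b hb (hlt.trans_le hN)

/-- `Ring.inverse` takes the value `0` at `0`, so the correction disappears. This is what happens at
the pivots in `w`. -/
theorem restoreStep_of_eq_zero {B : Type*} [Ring B] {a : Fin m × Fin p} {V : Fin m × Fin p → B}
    (h : V a = 0) : restoreStep a V = V := by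
  funext b; simp [restoreStep, h]

/-- For a vanishing pivot the relation with correction term degenerates to the vanishing of the
products of column and row entries. -/
theorem StageRel.insert_of_eq_zero {k B : Type*} [CommRing k] [Ring B] [Algebra k B] {q : kˣ}
    {S : Set (Fin m × Fin p)} {a : Fin m × Fin p} {V : Fin m × Fin p → B} (hV : StageRel q S V)
    (h0 : V a = 0) (h : ∀ i < a.1, ∀ j < a.2, V (i, a.2) * V (a.1, j) = 0) :
    StageRel q (insert a S) V where
  col := hV.col
  row := hV.row
  anti := hV.anti
  diag i i' j j' hi hj hS := by
    rcases hS with rfl | hS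
    · rw [h0, h i hi j hj]; simp
    · exact hV.diag i i' j j' hi hj hS
  comm i i' j j' hi hj hS := hV.comm i i' j j' hi hj fun h => hS (Set.mem_insert_of_mem _ h)

/-- A pivot outside of `w` is a unit and the restoration step applies. At a pivot in `w` nothing
changes, and the Cauchon condition kills either the row entries to its left or the column entries
above it, hence all products required to vanish. -/
theorem stageRel_restored (q : Kˣ) {w : Finset (Fin m × Fin p)} {N : ℕ} (hw : IsCauchonBelow w N)
    (hN : N ≤ m * p) : StageRel q (activeSet m p N) (restored q w N) := by
  induction N with
  | zero => exact stageRel_torusGen q w zero_le_one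
  | succ N ih =>
    have h : N < m * p := hN
    specialize ih (hw.mono N.le_succ) h.le
    rw [restored_succ h]
    by_cases ha : indexAt h ∈ w
    · have h0 : restored q w N (indexAt h) = 0 := by
        rw [restored_pivot, torusGen_of_mem ha]
      rw [restoreStep_of_eq_zero h0, activeSet_succ h]
      refine ih.insert_of_eq_zero h0 fun i hi j hj => ?_
      rcases hw _ ha (by rw [lexIndex_indexAt]; exact N.lt_succ_self) with h1 | h1
      · rw [restored_row_of_pivot, torusGen_of_mem (h1 j hj), mul_zero]
      · rw [restored_col_of_pivot q w h h1 hi, zero_mul]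
    · exact ih.restoreStep h (by rw [restored_pivot]; exact isUnit_torusGen ha)

end

end DeletingDerivations

namespace DeletingDerivations

noncomputable section

/-! ## Linear independence of ordered monomials -/

/-! ### Leading terms in a quantum torus -/

section LeadingTerm

variable {K Γ : Type*} [Field K] [AddCommGroup Γ] {q : Kˣ} {b : Γ →+ Γ →+ ℤ} (ω : Γ →+ ℤ)

/-- The elements of the quantum torus all of whose exponents have weight less than `d`. -/
def lowerTerms (q : Kˣ) (b : Γ →+ Γ →+ ℤ) (d : ℤ) : Submodule K (QTorus q b) :=
  Submodule.span K {x | ∃ α, ω α < d ∧ x = QTorus.T q b α}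

/-- The element `f` is a nonzero multiple of `T^α` up to terms of lower weight. -/
def HasLeadingTerm (f : QTorus q b) (α : Γ) : Prop :=
  ∃ c : K, c ≠ 0 ∧ f - c • QTorus.T q b α ∈ lowerTerms ω q b (ω α)

variable {ω}

theorem lowerTerms_mono {d e : ℤ} (h : d ≤ e) : lowerTerms ω q b d ≤ lowerTerms ω q b e :=
  Submodule.span_mono fun _ ⟨α, hα, hx⟩ => ⟨α, hα.trans_le h, hx⟩

theorem T_mem_lowerTerms {α : Γ} {d : ℤ} (h : ω α < d) : QTorus.T q b α ∈ lowerTerms ω q b d :=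
  Submodule.subset_span ⟨α, h, rfl⟩

theorem coeff_eq_zero_of_mem_lowerTerms {f : QTorus q b} {d : ℤ} (hf : f ∈ lowerTerms ω q b d)
    {α : Γ} (hα : d ≤ ω α) : QTorus.coeff f α = 0 := by
  classical
  induction hf using Submodule.span_induction with
  | mem x h =>
    obtain ⟨β, hβ, rfl⟩ := h
    rw [QTorus.coeff_T, Finsupp.single_apply, if_neg]
    rintro rfl; omega
  | zero => simp
  | add x y _ _ hx hy => simp [hx, hy]
  | smul c x _ hx => simp [hx]

/-- The bound `d + 1` encodes weight at most `d` for one factor; in the primed version the roles of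
the factors are exchanged. -/
theorem mul_mem_lowerTerms {f g : QTorus q b} {d e : ℤ} (hf : f ∈ lowerTerms ω q b (d + 1))
    (hg : g ∈ lowerTerms ω q b e) : f * g ∈ lowerTerms ω q b (d + e) := by
  have := Submodule.mul_mem_mul hf hg
  rw [lowerTerms, lowerTerms, Submodule.span_mul_span] at this
  refine (Submodule.span_le.2 ?_) this
  rintro _ ⟨_, ⟨α, hα, rfl⟩, _, ⟨β, hβ, rfl⟩, rfl⟩
  simp only [QTorus.T_mul]
  exact Submodule.smul_mem _ _ (T_mem_lowerTerms (by rw [map_add]; omega))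

theorem mul_mem_lowerTerms' {f g : QTorus q b} {d e : ℤ} (hf : f ∈ lowerTerms ω q b d)
    (hg : g ∈ lowerTerms ω q b (e + 1)) : f * g ∈ lowerTerms ω q b (d + e) := by
  have := Submodule.mul_mem_mul hf hg
  rw [lowerTerms, lowerTerms, Submodule.span_mul_span] at this
  refine (Submodule.span_le.2 ?_) this
  rintro _ ⟨_, ⟨α, hα, rfl⟩, _, ⟨β, hβ, rfl⟩, rfl⟩
  simp only [QTorus.T_mul]
  exact Submodule.smul_mem _ _ (T_mem_lowerTerms (by rw [map_add]; omega))

theorem hasLeadingTerm_T {c : K} (hc : c ≠ 0) (α : Γ) :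
    HasLeadingTerm ω (c • QTorus.T q b α) α := ⟨c, hc, by simp⟩

theorem HasLeadingTerm.mem_lowerTerms {f : QTorus q b} {α : Γ} (h : HasLeadingTerm ω f α) {d : ℤ}
    (hd : ω α < d) : f ∈ lowerTerms ω q b d := by
  obtain ⟨c, hc, h⟩ := h
  have := add_mem (lowerTerms_mono hd.le h) (Submodule.smul_mem _ c (T_mem_lowerTerms hd))
  simpa using this

theorem HasLeadingTerm.add {f g : QTorus q b} {α : Γ} (h : HasLeadingTerm ω f α)
    (hg : g ∈ lowerTerms ω q b (ω α)) : HasLeadingTerm ω (f + g) α := by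
  obtain ⟨c, hc, h⟩ := h
  exact ⟨c, hc, by convert add_mem h hg using 1; abel⟩

theorem HasLeadingTerm.mul {f g : QTorus q b} {α β : Γ} (hf : HasLeadingTerm ω f α)
    (hg : HasLeadingTerm ω g β) : HasLeadingTerm ω (f * g) (α + β) := by
  obtain ⟨d, hd, hg'⟩ := hg
  have hf' := hf
  obtain ⟨c, hc, hf⟩ := hf
  refine ⟨c * d * ((q ^ b α β : Kˣ) : K), mul_ne_zero (mul_ne_zero hc hd) (Units.ne_zero _), ?_⟩
  have h1 := mul_mem_lowerTerms (hf'.mem_lowerTerms (lt_add_one _)) hg'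
  have h2 := mul_mem_lowerTerms' hf
    (Submodule.smul_mem _ d (T_mem_lowerTerms (q := q) (b := b) (lt_add_one (ω β))))
  rw [map_add]
  convert add_mem h1 h2 using 1
  simp only [mul_sub, sub_mul, mul_smul_comm, smul_mul_assoc, QTorus.T_mul, smul_smul]
  module

theorem HasLeadingTerm.list_prod {ι : Type*} {U : ι → QTorus q b} {e : ι → Γ}
    (h : ∀ i, HasLeadingTerm ω (U i) (e i)) (l : List ι) :
    HasLeadingTerm ω (l.map U).prod (l.map e).sum := by
  induction l with
  | nil => exact ⟨1, one_ne_zero, by simp [QTorus.T_zero]⟩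
  | cons a l ih => simpa using (h a).mul ih

/-- In a vanishing combination look at an index `i` of maximal weight and at the coefficient of
`T^(e i)`. Every other member of the support contributes nothing to it, either by weight or because
its leading exponent differs. -/
theorem linearIndependent_of_hasLeadingTerm {ι : Type*} {U : ι → QTorus q b} {e : ι → Γ}
    (h : ∀ i, HasLeadingTerm ω (U i) (e i)) (he : Function.Injective e) :
    LinearIndependent K U := by
  classical
  rw [linearIndependent_iff]
  intro l hl
  by_contra hne
  obtain ⟨i, hi, hmax⟩ := l.support.exists_max_image (fun i => ω (e i))
    (Finsupp.support_nonempty_iff.2 hne)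
  have h1 := congrArg (fun f => QTorus.coeff f (e i)) hl
  simp only [Finsupp.linearCombination_apply, Finsupp.sum, map_sum, map_smul, map_zero,
    Finsupp.coe_zero, Pi.zero_apply, Finsupp.finsetSum_apply, Finsupp.smul_apply] at h1
  have hco : ∀ j, ∃ c : K, c ≠ 0 ∧ (ω (e j) ≤ ω (e i) →
      QTorus.coeff (U j) (e i) = if j = i then c else 0) := by
    intro j
    obtain ⟨c, hc, hj⟩ := h j
    refine ⟨c, hc, fun hle => ?_⟩
    have h2 := coeff_eq_zero_of_mem_lowerTerms hj hle
    rw [map_sub, Finsupp.sub_apply, sub_eq_zero, map_smul, QTorus.coeff_T, Finsupp.smul_apply,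
      Finsupp.single_apply] at h2
    rw [h2]
    by_cases hji : j = i
    · simp [hji]
    · simp [hji, he.ne hji]
  rw [Finset.sum_eq_single i] at h1
  · obtain ⟨c, hc, h2⟩ := hco i
    rw [h2 le_rfl, if_pos rfl, smul_eq_mul] at h1
    exact (mul_ne_zero (Finsupp.mem_support_iff.1 hi) hc) h1
  · intro j hj hji
    obtain ⟨c, hc, h2⟩ := hco j
    rw [h2 (hmax j hj), if_neg hji, smul_zero]
  · exact fun h => absurd hi h

end LeadingTerm

/-! ### Ordered monomials and universal relations of a stage -/

section PBW

variable {m p : ℕ} {K : Type*} [Field K]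

/-- The weight of an index. -/
def indexWeight (b : Fin m × Fin p) : ℕ := b.1 * b.2

/-- This is `(i' - i) * (j' - j) > 0`. It makes the correction term of a diagonal pair lighter than
the product it corrects, which is the reason for taking row times column as weight. -/
theorem indexWeight_lt {i i' : Fin m} {j j' : Fin p} (hi : i < i') (hj : j < j') :
    indexWeight (i, j') + indexWeight (i', j) < indexWeight (i, j) + indexWeight (i', j') := by
  simp only [indexWeight]
  have h1 : (i : ℕ) < i' := hi
  have h2 : (j : ℕ) < j' := hj
  nlinarith [Nat.mul_le_mul h1 h2]

theorem StageRel.almostCommutes {B : Type*} [Ring B] [Algebra K B] {q : Kˣ}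
    {S : Set (Fin m × Fin p)} {U : Fin m × Fin p → B} (h : StageRel q S U) :
    AlmostCommutes K U indexWeight := by
  have key : ∀ a b : Fin m × Fin p, lexIndex a < lexIndex b → ∃ c : K, c ≠ 0 ∧
      U a * U b - c • (U b * U a) ∈ wordSpan K U indexWeight (indexWeight a + indexWeight b) := by
    rintro ⟨i, j⟩ ⟨i', j'⟩ hlt
    rcases lexIndex_lt_iff.1 hlt with hi | ⟨hi, hj⟩
    · simp only at hi
      rcases lt_trichotomy j j' with hj | rfl | hj
      · refine ⟨1, one_ne_zero, ?_⟩
        rw [h.diag_correction hi hj, one_smul, add_sub_cancel_left]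
        refine Submodule.smul_mem _ _ (Submodule.subset_span ⟨[(i, j'), (i', j)], ?_, by simp⟩)
        simpa using indexWeight_lt hi hj
      · exact ⟨q, q.ne_zero, by rw [h.col _ _ _ hi]; simp⟩
      · exact ⟨1, one_ne_zero, by rw [h.anti _ _ _ _ hi hj]; simp⟩
    · simp only at hi hj
      subst hi
      exact ⟨q, q.ne_zero, by rw [h.row _ _ _ hj]; simp⟩
  intro a b
  rcases lt_trichotomy (lexIndex a) (lexIndex b) with hlt | heq | hlt
  · exact key a b hlt
  · obtain rfl := lexIndex_injective heq
    exact ⟨1, one_ne_zero, by simp⟩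
  · obtain ⟨c, hc, h⟩ := key b a hlt
    refine ⟨c⁻¹, inv_ne_zero hc, ?_⟩
    have := Submodule.smul_mem _ (-c⁻¹) h
    rw [add_comm] at this
    convert this using 1
    rw [smul_sub, smul_smul, neg_mul, inv_mul_cancel₀ hc]
    module

theorem StageRel.prod {B B' : Type*} [Ring B] [Algebra K B] [Ring B'] [Algebra K B'] {q : Kˣ}
    {S : Set (Fin m × Fin p)} {U : Fin m × Fin p → B} {U' : Fin m × Fin p → B'}
    (h : StageRel q S U) (h' : StageRel q S U') : StageRel q S (fun b => (U b, U' b)) where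
  col i i' j hi := Prod.ext (h.col i i' j hi) (h'.col i i' j hi)
  row i j j' hj := Prod.ext (h.row i j j' hj) (h'.row i j j' hj)
  anti i i' j j' hi hj := Prod.ext (h.anti i i' j j' hi hj) (h'.anti i i' j j' hi hj)
  diag i i' j j' hi hj hS := Prod.ext (h.diag i i' j j' hi hj hS) (h'.diag i i' j j' hi hj hS)
  comm i i' j j' hi hj hS := Prod.ext (h.comm i i' j j' hi hj hS) (h'.comm i i' j j' hi hj hS)

/-- The weight of an exponent. -/
def exponentWeight (m p : ℕ) : Exponent (∅ : Finset (Fin m × Fin p)) →+ ℤ :=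
  ∑ a, (indexWeight a.1 : ℤ) • Pi.evalAddMonoidHom (fun _ => ℤ) a

/-- The exponent of the generator with index `b`. -/
def unitExponent (b : Fin m × Fin p) : Exponent (∅ : Finset (Fin m × Fin p)) :=
  Pi.single ⟨b, Finset.notMem_empty b⟩ 1

theorem exponentWeight_unit (b : Fin m × Fin p) :
    exponentWeight m p (unitExponent b) = indexWeight b := by
  simp only [exponentWeight, AddMonoidHom.finsetSum_apply, AddMonoidHom.smul_apply,
    Pi.evalAddMonoidHom_apply, unitExponent]
  rw [Finset.sum_eq_single ⟨b, Finset.notMem_empty b⟩]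
  · simp
  · intro c _ hc; simp [hc]
  · simp

/-- The summand added at a step has the exponents of the column and the row entry minus that of the
pivot, which is lighter than the entry itself by `indexWeight_lt`. -/
theorem hasLeadingTerm_restored (q : Kˣ) (N : ℕ) (b : Fin m × Fin p) :
    HasLeadingTerm (exponentWeight m p) (restored q ∅ N b) (unitExponent b) := by
  have base : ∀ b : Fin m × Fin p, torusGen q ∅ b = QTorus.T q _ (unitExponent b) := fun b =>
    torusGen_of_notMem (Finset.notMem_empty b)
  induction N generalizing b with
  | zero =>
    rw [restored, base, ← one_smul K (QTorus.T q _ _)]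
    exact hasLeadingTerm_T one_ne_zero _
  | succ N ih =>
    by_cases hN : N < m * p
    swap
    · rw [restored, dif_neg hN]; exact ih b
    rw [restored_succ hN, restoreStep]
    split_ifs with hb
    swap
    · exact ih b
    refine (ih b).add ?_
    rw [restored_pivot, base, QTorus.inverse_T]
    refine (((ih _).mul (hasLeadingTerm_T (Units.ne_zero _) _)).mul (ih _)).mem_lowerTerms ?_
    rw [map_add, map_add, map_neg, exponentWeight_unit, exponentWeight_unit, exponentWeight_unit,
      exponentWeight_unit]
    have := indexWeight_lt hb.1 hb.2
    simp only [Prod.mk.eta] at this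
    omega

theorem linearIndependent_monomialProd_restored (q : Kˣ) (N : ℕ) :
    LinearIndependent K (monomialProd (restored q (∅ : Finset (Fin m × Fin p)) N)) := by
  classical
  refine linearIndependent_of_hasLeadingTerm (ω := exponentWeight m p)
    (e := fun s : Multiset (Fin m × Fin p) => (s.toList.map unitExponent).sum)
    (fun s => HasLeadingTerm.list_prod (hasLeadingTerm_restored q N) _) ?_
  intro s t hst
  have hcount : ∀ (l : List (Fin m × Fin p)) (b : Fin m × Fin p),
      (l.map unitExponent).sum ⟨b, Finset.notMem_empty b⟩ = (l.count b : ℤ) := by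
    intro l b
    induction l with
    | nil => simp
    | cons a l ih =>
      rw [List.map_cons, List.sum_cons, Pi.add_apply, ih, List.count_cons, unitExponent]
      by_cases hab : a = b
      · subst hab; simp [add_comm]
      · rw [Pi.single_eq_of_ne (by simpa using Ne.symm hab)]; simp [hab]
  rw [← Multiset.coe_toList s, ← Multiset.coe_toList t, Multiset.coe_eq_coe, List.perm_iff_count]
  intro b
  have := congrFun hst ⟨b, Finset.notMem_empty b⟩
  simp only [hcount] at this
  exact_mod_cast this

theorem isCauchon_empty : IsCauchon (∅ : Finset (Fin m × Fin p)) := by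
  simp [IsCauchon, IsCauchonBelow]

/-- A relation between the restored generators of the full quantum torus holds in every algebra
with the corresponding stage relations. -/
theorem lift_eq_zero_of_lift_restored {B : Type*} [Ring B] [Algebra K B] {q : Kˣ} {N : ℕ}
    (hN : N ≤ m * p) {U : Fin m × Fin p → B} (hU : StageRel q (activeSet m p N) U)
    {f : FreeAlgebra K (Fin m × Fin p)} (hf : FreeAlgebra.lift K (restored q ∅ N) f = 0) :
    FreeAlgebra.lift K U f = 0 := by
  -- Both families are treated at once in the product algebra. There `f` is a combination of ordered
  -- monomials; its coefficients vanish by independence in the torus, so its component in `B`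
  -- vanishes too.
  let W : Fin m × Fin p → B × DiagramTorus q ∅ := fun b => (U b, restored q ∅ N b)
  have hW := (hU.prod (stageRel_restored q (isCauchon_empty N) hN)).almostCommutes
  have h1 := lift_mem_span_monomialProd hW f
  obtain ⟨c, hc⟩ := (Finsupp.mem_span_range_iff_exists_finsupp).1 h1
  have efst : (AlgHom.fst K B (DiagramTorus q ∅)).comp (FreeAlgebra.lift K W)
      = FreeAlgebra.lift K U := by ext b; simp [W]
  have esnd : (AlgHom.snd K B (DiagramTorus q ∅)).comp (FreeAlgebra.lift K W)
      = FreeAlgebra.lift K (restored q ∅ N) := by ext b; simp [W]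
  have hsnd : ∀ s, (monomialProd W s).2 = monomialProd (restored q ∅ N) s := fun s => by
    have := map_list_prod (AlgHom.snd K B (DiagramTorus q (∅ : Finset (Fin m × Fin p))))
      (s.toList.map W)
    simpa [monomialProd, Function.comp_def, W] using this
  have h2 : c.sum (fun s a => a • monomialProd (restored q ∅ N) s) = 0 := by
    have := congrArg (AlgHom.snd K B (DiagramTorus q ∅)) hc
    rw [← AlgHom.comp_apply, esnd, hf, Finsupp.sum, map_sum] at this
    rw [← this, Finsupp.sum]
    exact Finset.sum_congr rfl fun s _ => by rw [map_smul, ← hsnd]; rfl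
  have h3 : c = 0 := (linearIndependent_iff.1 (linearIndependent_monomialProd_restored q N)) c h2
  rw [h3, Finsupp.sum_zero_index] at hc
  rw [← efst, AlgHom.comp_apply, ← hc, map_zero]

end PBW

end

end DeletingDerivations

namespace DeletingDerivations

noncomputable section

/-! ## Transfer between consecutive stages -/

universe u

variable {m p : ℕ} {K : Type u} [Field K]

/-- A family with the relations of stage `N + 1` in which the `N`-th generator is invertible. -/
structure PivotSetting {B : Type u} [Ring B] [Algebra K B] (q : Kˣ) {N : ℕ} (h : N < m * p)
    (U : Fin m × Fin p → B) : Prop where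
  rel : StageRel q (activeSet m p (N + 1)) U
  unit : IsUnit (U (indexAt h))

theorem indexAt_mem_activeSet {N : ℕ} (h : N < m * p) : indexAt h ∈ activeSet m p (N + 1) := by
  rw [mem_activeSet, lexIndex_indexAt]; exact Nat.lt_succ_self N

namespace StageRel

variable {B : Type u} [Ring B] [Algebra K B] {q : Kˣ} {N : ℕ} {h : N < m * p}
  {U : Fin m × Fin p → B}

theorem pivot_col_mul (hU : StageRel q (activeSet m p (N + 1)) U) {i : Fin m} (hi : i < (indexAt h).1) :
    U (i, (indexAt h).2) * U (indexAt h) = (q : K) • (U (indexAt h) * U (i, (indexAt h).2)) :=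
  hU.col _ _ _ hi

theorem pivot_row_mul (hU : StageRel q (activeSet m p (N + 1)) U) {j : Fin p} (hj : j < (indexAt h).2) :
    U ((indexAt h).1, j) * U (indexAt h) = (q : K) • (U (indexAt h) * U ((indexAt h).1, j)) :=
  hU.row _ _ _ hj

theorem pivot_northWest_mul (hU : StageRel q (activeSet m p (N + 1)) U) {b : Fin m × Fin p} (hi : b.1 < (indexAt h).1)
    (hj : b.2 < (indexAt h).2) : U b * U (indexAt h) = U (indexAt h) * U b
      + ((q : K) - ((q⁻¹ : Kˣ) : K)) • (U (b.1, (indexAt h).2) * U ((indexAt h).1, b.2)) :=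
  hU.diag _ _ _ _ hi hj (indexAt_mem_activeSet h)

theorem pivot_corner_mul (hU : StageRel q (activeSet m p (N + 1)) U) {b : Fin m × Fin p} (hi : b.1 < (indexAt h).1)
    (hj : b.2 < (indexAt h).2) :
    U (b.1, (indexAt h).2) * U ((indexAt h).1, b.2) * U (indexAt h)
      = ((q : K) * q) • (U (indexAt h) * (U (b.1, (indexAt h).2) * U ((indexAt h).1, b.2))) := by
  rw [mul_assoc, hU.pivot_row_mul hj, mul_smul_comm, ← mul_assoc, hU.pivot_col_mul hi, smul_mul_assoc,
    smul_smul, mul_assoc]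

theorem pivot_other_mul (hU : StageRel q (activeSet m p (N + 1)) U) {b : Fin m × Fin p}
    (hb : ¬ (b.1 < (indexAt h).1 ∧ b.2 < (indexAt h).2)) :
    U b * U (indexAt h) = ((q ^ lambdaInt b (indexAt h) : Kˣ) : K) • (U (indexAt h) * U b) := by
  generalize ha : indexAt h = a at *
  have hqi : ∀ {z w : B}, z = (q : K) • w → w = ((q ^ (-1 : ℤ) : Kˣ) : K) • z := fun e => by
    rw [zpow_neg_one]; exact smul_symm e
  obtain ⟨i, j⟩ := b
  obtain ⟨k, l⟩ := a
  simp only at hb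
  rcases lt_trichotomy i k with hi | rfl | hi <;> rcases lt_trichotomy j l with hj | rfl | hj
  · exact absurd ⟨hi, hj⟩ hb
  · rw [hU.col i k j hi]; simp [lambdaInt, hi]
  · rw [hU.anti i k j l hi hj]; simp [lambdaInt, hi.ne, hj.ne']
  · rw [hU.row i j l hj]; simp [lambdaInt, hj]
  · simp [lambdaInt]
  · rw [hqi (hU.row i l j hj)]; simp [lambdaInt, hj, hj.not_gt]
  · rw [hU.anti k i l j hi hj]; simp [lambdaInt, hi.ne', hj.ne]
  · rw [hqi (hU.col k i j hi)]; simp [lambdaInt, hi, hi.not_gt]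
  · rw [hU.comm k i l j hi hj]
    · simp [lambdaInt, hj.ne', hi.ne']
    · rw [mem_activeSet]
      have h2 := lexIndex_indexAt h
      rw [ha] at h2
      have := lexIndex_lt_of_row_lt (a := (k, l)) (b := (i, j)) hi
      omega

theorem pivot_other_mul_pow (hU : StageRel q (activeSet m p (N + 1)) U) {b : Fin m × Fin p}
    (hb : ¬ (b.1 < (indexAt h).1 ∧ b.2 < (indexAt h).2)) (n : ℕ) :
    U b * U (indexAt h) ^ n
      = U (indexAt h) ^ n * (((q ^ lambdaInt b (indexAt h) : Kˣ) : K) ^ n • U b) := by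
  induction n with
  | zero => simp
  | succ n ih =>
    rw [pow_succ, ← mul_assoc, ih, mul_assoc, smul_mul_assoc, hU.pivot_other_mul hb, mul_assoc,
      smul_smul, pow_succ, mul_smul_comm (_ ^ _ * _) (U (indexAt h))]

end StageRel

namespace PivotSetting

variable {B : Type u} [Ring B] [Algebra K B] {q : Kˣ} {N : ℕ} {h : N < m * p}
  {U : Fin m × Fin p → B}

theorem inverse_corner (hU : PivotSetting q h U) {b : Fin m × Fin p} (hj : b.2 < (indexAt h).2) :
    Ring.inverse (U (indexAt h)) * U ((indexAt h).1, b.2) * U (indexAt h)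
      = (q : K) • U ((indexAt h).1, b.2) := by
  rw [mul_assoc, hU.rel.pivot_row_mul hj, mul_smul_comm, Ring.inverse_mul_cancel_left _ _ hU.unit]

theorem corner_inverse (hU : PivotSetting q h U) {b : Fin m × Fin p} (hi : b.1 < (indexAt h).1) :
    U (indexAt h) * (U (b.1, (indexAt h).2) * Ring.inverse (U (indexAt h)))
      = ((q⁻¹ : Kˣ) : K) • U (b.1, (indexAt h).2) := by
  rw [← mul_assoc, smul_symm (hU.rel.pivot_col_mul hi), smul_mul_assoc,
    Ring.mul_inverse_cancel_right _ _ hU.unit]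

theorem deleteStep_mul_of_northWest (hU : PivotSetting q h U) {b : Fin m × Fin p}
    (hb : b.1 < (indexAt h).1 ∧ b.2 < (indexAt h).2) :
    deleteStep (indexAt h) U b * U (indexAt h) = U b * U (indexAt h)
      - (q : K) • (U (b.1, (indexAt h).2) * U ((indexAt h).1, b.2)) := by
  rw [deleteStep, if_pos hb, sub_mul, mul_assoc (U (b.1, _)), mul_assoc (U (b.1, _)),
    hU.inverse_corner hb.2, mul_smul_comm]

/-- This is the purpose of the step: the subtracted term passes the pivot with coefficients `q` and
`q⁻¹`, whose difference cancels the correction term. Afterwards the pivot commutes with every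
generator up to a scalar. -/
theorem deleteStep_mul (hU : PivotSetting q h U) (b : Fin m × Fin p) :
    deleteStep (indexAt h) U b * U (indexAt h)
      = ((q ^ lambdaInt b (indexAt h) : Kˣ) : K) • (U (indexAt h) * deleteStep (indexAt h) U b) := by
  by_cases hb : b.1 < (indexAt h).1 ∧ b.2 < (indexAt h).2
  · rw [hU.deleteStep_mul_of_northWest hb, deleteStep, if_pos hb, hU.rel.pivot_northWest_mul hb.1 hb.2, mul_sub,
      ← mul_assoc (U (indexAt h)) (_ * _), hU.corner_inverse hb.1]
    simp only [lambdaInt, hb.1.ne, hb.2.ne, smul_mul_assoc]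
    simp only [false_and, or_self, if_false, zpow_zero, Units.val_one, one_smul]
    module
  · rw [deleteStep, if_neg hb, hU.rel.pivot_other_mul hb]

/-- The automorphism of the free algebra that corresponds to conjugation by the generator with
index `a`. -/
def scaling (q : Kˣ) (a : Fin m × Fin p) :
    FreeAlgebra K (Fin m × Fin p) →ₐ[K] FreeAlgebra K (Fin m × Fin p) :=
  FreeAlgebra.lift K fun b => ((q ^ lambdaInt b a : Kˣ) : K) • FreeAlgebra.ι K b

theorem lift_deleteStep_mul (hU : PivotSetting q h U) (f : FreeAlgebra K (Fin m × Fin p)) :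
    FreeAlgebra.lift K (deleteStep (indexAt h) U) f * U (indexAt h)
      = U (indexAt h) * FreeAlgebra.lift K (deleteStep (indexAt h) U) (scaling q (indexAt h) f) := by
  induction f with
  | grade0 r => simp only [AlgHom.commutes]; exact Algebra.commutes _ _
  | grade1 b => simp [scaling, hU.deleteStep_mul]
  | add f g hf hg => simp only [map_add, add_mul, mul_add, hf, hg]
  | mul f g hf hg => rw [map_mul, mul_assoc, hg, ← mul_assoc, hf, mul_assoc, map_mul, map_mul]

theorem lift_deleteStep_mul_pow (hU : PivotSetting q h U) (f : FreeAlgebra K (Fin m × Fin p))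
    (j : ℕ) : FreeAlgebra.lift K (deleteStep (indexAt h) U) f * U (indexAt h) ^ j
      = U (indexAt h) ^ j
        * FreeAlgebra.lift K (deleteStep (indexAt h) U) ((scaling q (indexAt h))^[j] f) := by
  induction j generalizing f with
  | zero => simp
  | succ j ih =>
    rw [pow_succ', ← mul_assoc, hU.lift_deleteStep_mul, mul_assoc, ih, ← mul_assoc,
      Function.iterate_succ_apply]

end PivotSetting

/-- The constant is chosen before the algebra. Such uniform witnesses make it possible to use the
same fraction in the full torus, in the torus of `w` and in a ring of fractions. -/
theorem exists_northWest_mul_pow (q : Kˣ) (n : ℕ) : ∃ c : K, ∀ {N : ℕ} (h : N < m * p)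
    (B : Type u) [Ring B] [Algebra K B] (U : Fin m × Fin p → B), StageRel q (activeSet m p (N + 1)) U →
      ∀ b : Fin m × Fin p, b.1 < (indexAt h).1 → b.2 < (indexAt h).2 →
        U b * U (indexAt h) ^ (n + 1) = U (indexAt h) ^ n * (U b * U (indexAt h)
          + c • (U (b.1, (indexAt h).2) * U ((indexAt h).1, b.2))) := by
  induction n with
  | zero => exact ⟨0, by simp⟩
  | succ n ih =>
    obtain ⟨c, ih⟩ := ih
    refine ⟨((q : K) - ((q⁻¹ : Kˣ) : K)) * ((q : K) * q) + c * ((q : K) * q),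
      fun h B _ _ U hU b hi hj => ?_⟩
    rw [pow_succ _ (n + 1), ← mul_assoc, ih h B U hU b hi hj, pow_succ, mul_assoc, mul_assoc]
    congr 1
    rw [add_mul, smul_mul_assoc, hU.pivot_corner_mul hi hj]
    nth_rw 1 [hU.pivot_northWest_mul hi hj]
    rw [add_mul, smul_mul_assoc, hU.pivot_corner_mul hi hj, mul_add, mul_smul_comm, mul_assoc]
    module

/-- The right Ore condition for the powers of the pivot. -/
theorem exists_mul_pow_eq (q : Kˣ) {N : ℕ} (h : N < m * p) (f : FreeAlgebra K (Fin m × Fin p))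
    (j : ℕ) : ∃ (j' : ℕ) (g : FreeAlgebra K (Fin m × Fin p)), ∀ (B : Type u) [Ring B] [Algebra K B]
      (U : Fin m × Fin p → B), StageRel q (activeSet m p (N + 1)) U →
        FreeAlgebra.lift K U f * U (indexAt h) ^ j' = U (indexAt h) ^ j * FreeAlgebra.lift K U g := by
  induction f generalizing j with
  | grade0 r =>
    exact ⟨j, algebraMap K _ r, fun B _ _ U _ => by
      simp only [AlgHom.commutes]; exact Algebra.commutes _ _⟩
  | grade1 b =>
    by_cases hb : b.1 < (indexAt h).1 ∧ b.2 < (indexAt h).2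
    · obtain ⟨c, hc⟩ := exists_northWest_mul_pow (m := m) (p := p) q j
      refine ⟨j + 1, FreeAlgebra.ι K b * FreeAlgebra.ι K (indexAt h) + c •
        (FreeAlgebra.ι K (b.1, (indexAt h).2) * FreeAlgebra.ι K ((indexAt h).1, b.2)),
        fun B _ _ U hU => ?_⟩
      simp [hc h B U hU b hb.1 hb.2]
    · refine ⟨j, ((q ^ lambdaInt b (indexAt h) : Kˣ) : K) ^ j • FreeAlgebra.ι K b,
        fun B _ _ U hU => ?_⟩
      rw [map_smul, FreeAlgebra.lift_ι_apply, hU.pivot_other_mul_pow hb]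
  | add f₁ f₂ h₁ h₂ =>
    obtain ⟨j₁, g₁, h₁⟩ := h₁ j
    obtain ⟨j₂, g₂, h₂⟩ := h₂ j
    refine ⟨j₁ + j₂, g₁ * FreeAlgebra.ι K (indexAt h) ^ j₂
      + g₂ * FreeAlgebra.ι K (indexAt h) ^ j₁, fun B _ _ U hU => ?_⟩
    have e₁ := h₁ B U hU
    have e₂ := h₂ B U hU
    simp only [map_add, map_mul, map_pow, FreeAlgebra.lift_ι_apply, add_mul, mul_add]
    rw [pow_add, ← mul_assoc, e₁, ← pow_add, add_comm j₁, pow_add, ← mul_assoc, e₂, mul_assoc,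
      mul_assoc]
  | mul f₁ f₂ h₁ h₂ =>
    obtain ⟨j₁, g₁, h₁⟩ := h₁ j
    obtain ⟨j₂, g₂, h₂⟩ := h₂ j₁
    refine ⟨j₂, g₁ * g₂, fun B _ _ U hU => ?_⟩
    rw [map_mul, mul_assoc, h₂ B U hU, ← mul_assoc, h₁ B U hU, mul_assoc, map_mul]

/-- Every element of the algebra after a step is a right fraction of elements before the step. -/
theorem exists_lift_deleteStep_mul_pow (q : Kˣ) {N : ℕ} (h : N < m * p)
    (f : FreeAlgebra K (Fin m × Fin p)) : ∃ (M : ℕ) (g : FreeAlgebra K (Fin m × Fin p)),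
      ∀ (B : Type u) [Ring B] [Algebra K B] (U : Fin m × Fin p → B), PivotSetting q h U →
        FreeAlgebra.lift K (deleteStep (indexAt h) U) f * U (indexAt h) ^ M
          = FreeAlgebra.lift K U g := by
  induction f with
  | grade0 r => exact ⟨0, algebraMap K _ r, fun B _ _ U _ => by simp⟩
  | grade1 b =>
    by_cases hb : b.1 < (indexAt h).1 ∧ b.2 < (indexAt h).2
    · refine ⟨1, FreeAlgebra.ι K b * FreeAlgebra.ι K (indexAt h) - (q : K) •
        (FreeAlgebra.ι K (b.1, (indexAt h).2) * FreeAlgebra.ι K ((indexAt h).1, b.2)),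
        fun B _ _ U hU => ?_⟩
      simp [hU.deleteStep_mul_of_northWest hb]
    · exact ⟨0, FreeAlgebra.ι K b, fun B _ _ U _ => by simp [deleteStep, if_neg hb]⟩
  | add f₁ f₂ h₁ h₂ =>
    obtain ⟨j₁, g₁, h₁⟩ := h₁
    obtain ⟨j₂, g₂, h₂⟩ := h₂
    refine ⟨j₁ + j₂, g₁ * FreeAlgebra.ι K (indexAt h) ^ j₂
      + g₂ * FreeAlgebra.ι K (indexAt h) ^ j₁, fun B _ _ U hU => ?_⟩
    simp only [map_add, map_mul, map_pow, FreeAlgebra.lift_ι_apply, add_mul]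
    rw [pow_add, ← mul_assoc, h₁ B U hU, ← pow_add, add_comm j₁, pow_add, ← mul_assoc, h₂ B U hU]
  | mul f₁ f₂ h₁ h₂ =>
    obtain ⟨j₁, g₁, h₁⟩ := h₁
    obtain ⟨j₂, g₂, h₂⟩ := h₂
    -- The denominator of the left factor has to be moved past the numerator of the right one, by
    -- the Ore condition.
    obtain ⟨j', g, hg⟩ := exists_mul_pow_eq q h g₂ j₁
    refine ⟨j₂ + j', g₁ * g, fun B _ _ U hU => ?_⟩
    rw [map_mul, mul_assoc, pow_add, ← mul_assoc _ (_ ^ j₂), h₂ B U hU, hg B U hU.rel, ← mul_assoc,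
      h₁ B U hU, map_mul]

/-- Every element of the algebra before a step is a right fraction of elements after the step. -/
theorem exists_lift_mul_pow (q : Kˣ) {N : ℕ} (h : N < m * p)
    (f : FreeAlgebra K (Fin m × Fin p)) : ∃ (M : ℕ) (g : FreeAlgebra K (Fin m × Fin p)),
      ∀ (B : Type u) [Ring B] [Algebra K B] (U : Fin m × Fin p → B), PivotSetting q h U →
        FreeAlgebra.lift K U f * U (indexAt h) ^ M
          = FreeAlgebra.lift K (deleteStep (indexAt h) U) g := by
  have hpiv : ∀ (B : Type u) [Ring B] (U : Fin m × Fin p → B),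
      deleteStep (indexAt h) U (indexAt h) = U (indexAt h) := fun B _ U => by simp [deleteStep]
  induction f with
  | grade0 r => exact ⟨0, algebraMap K _ r, fun B _ _ U _ => by simp⟩
  | grade1 b =>
    by_cases hb : b.1 < (indexAt h).1 ∧ b.2 < (indexAt h).2
    · refine ⟨1, FreeAlgebra.ι K b * FreeAlgebra.ι K (indexAt h) + (q : K) •
        (FreeAlgebra.ι K (b.1, (indexAt h).2) * FreeAlgebra.ι K ((indexAt h).1, b.2)),
        fun B _ _ U hU => ?_⟩
      simp only [FreeAlgebra.lift_ι_apply, pow_one, map_add, map_mul, map_smul]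
      rw [hpiv, hU.deleteStep_mul_of_northWest hb]
      simp [deleteStep]
    · exact ⟨0, FreeAlgebra.ι K b, fun B _ _ U _ => by simp [deleteStep, if_neg hb]⟩
  | add f₁ f₂ h₁ h₂ =>
    obtain ⟨j₁, g₁, h₁⟩ := h₁
    obtain ⟨j₂, g₂, h₂⟩ := h₂
    refine ⟨j₁ + j₂, g₁ * FreeAlgebra.ι K (indexAt h) ^ j₂
      + g₂ * FreeAlgebra.ι K (indexAt h) ^ j₁, fun B _ _ U hU => ?_⟩
    simp only [map_add, map_mul, map_pow, FreeAlgebra.lift_ι_apply, add_mul, hpiv]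
    rw [pow_add, ← mul_assoc, h₁ B U hU, ← pow_add, add_comm j₁, pow_add, ← mul_assoc, h₂ B U hU]
  | mul f₁ f₂ h₁ h₂ =>
    obtain ⟨j₁, g₁, h₁⟩ := h₁
    obtain ⟨j₂, g₂, h₂⟩ := h₂
    refine ⟨j₂ + j₁, g₁ * (PivotSetting.scaling q (indexAt h))^[j₁] g₂, fun B _ _ U hU => ?_⟩
    rw [map_mul, mul_assoc, pow_add, ← mul_assoc _ (_ ^ j₂), h₂ B U hU, hU.lift_deleteStep_mul_pow,
      ← mul_assoc, h₁ B U hU, map_mul]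

/-- The two corrections are built from the pivot and its row and column, which neither step touches,
so they cancel without any invertibility. -/
theorem deleteStep_restoreStep {B : Type*} [Ring B] (a : Fin m × Fin p) (U : Fin m × Fin p → B) :
    deleteStep a (restoreStep a U) = U := by
  funext b
  by_cases hb : b.1 < a.1 ∧ b.2 < a.2 <;> simp [restoreStep, deleteStep, hb]

theorem StageRel.of_lift {B B' : Type*} [Ring B] [Algebra K B] [Ring B'] [Algebra K B'] {q : Kˣ}
    {S : Set (Fin m × Fin p)} {V : Fin m × Fin p → B} {U : Fin m × Fin p → B'} (h : StageRel q S V)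
    (hVU : ∀ f, FreeAlgebra.lift K V f = 0 → FreeAlgebra.lift K U f = 0) : StageRel q S U := by
  have key : ∀ f g, FreeAlgebra.lift K V f = FreeAlgebra.lift K V g →
      FreeAlgebra.lift K U f = FreeAlgebra.lift K U g := fun f g e => by
    have := hVU (f - g) (by rw [map_sub, e, sub_self])
    rwa [map_sub, sub_eq_zero] at this
  constructor
  · intro i i' j hi
    have := key (FreeAlgebra.ι K (i, j) * FreeAlgebra.ι K (i', j))
      ((q : K) • (FreeAlgebra.ι K (i', j) * FreeAlgebra.ι K (i, j))) (by simp [h.col i i' j hi])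
    simpa using this
  · intro i j j' hj
    have := key (FreeAlgebra.ι K (i, j) * FreeAlgebra.ι K (i, j'))
      ((q : K) • (FreeAlgebra.ι K (i, j') * FreeAlgebra.ι K (i, j))) (by simp [h.row i j j' hj])
    simpa using this
  · intro i i' j j' hi hj
    have := key (FreeAlgebra.ι K (i, j) * FreeAlgebra.ι K (i', j'))
      (FreeAlgebra.ι K (i', j') * FreeAlgebra.ι K (i, j)) (by simp [h.anti i i' j j' hi hj])
    simpa using this
  · intro i i' j j' hi hj hS
    have := key (FreeAlgebra.ι K (i, j) * FreeAlgebra.ι K (i', j'))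
      (FreeAlgebra.ι K (i', j') * FreeAlgebra.ι K (i, j) + ((q : K) - ((q⁻¹ : Kˣ) : K)) •
        (FreeAlgebra.ι K (i, j') * FreeAlgebra.ι K (i', j)))
      (by simp only [map_add, map_mul, map_smul, FreeAlgebra.lift_ι_apply]
          exact h.diag i i' j j' hi hj hS)
    simpa only [map_add, map_mul, map_smul, FreeAlgebra.lift_ι_apply] using this
  · intro i i' j j' hi hj hS
    have := key (FreeAlgebra.ι K (i, j) * FreeAlgebra.ι K (i', j'))
      (FreeAlgebra.ι K (i', j') * FreeAlgebra.ι K (i, j)) (by simp [h.comm i i' j j' hi hj hS])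
    simpa using this

theorem pivotSetting_restored (q : Kˣ) {w : Finset (Fin m × Fin p)} {N : ℕ}
    (hw : IsCauchonBelow w (N + 1)) (h : N < m * p) (ha : indexAt h ∉ w) : PivotSetting q h (restored q w (N + 1)) where
  rel := stageRel_restored q hw h
  unit := by
    rw [restored_succ h, restoreStep]
    simp [restored_pivot, isUnit_torusGen ha]

theorem deleteStep_restored (q : Kˣ) (w : Finset (Fin m × Fin p)) {N : ℕ} (h : N < m * p) :
    deleteStep (indexAt h) (restored q w (N + 1)) = restored q w N := by
  rw [restored_succ h, deleteStep_restoreStep]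

end

end DeletingDerivations

namespace DeletingDerivations

noncomputable section

/-! ## Steps on ideals -/

universe u

variable {m p : ℕ} {K : Type u} [Field K]

/-- A prime ideal of the `N`-th algebra, as an ideal of the free algebra. -/
structure StageIdeal (q : Kˣ) (N : ℕ) (I : TwoSidedIdeal (FreeAlgebra K (Fin m × Fin p))) :
    Prop where
  ker : ∀ f, FreeAlgebra.lift K (restored q ∅ N) f = 0 → f ∈ I
  prime : TwoSidedIdealIsPrime I

/-- Regularity of the pivot modulo an ideal that does not contain it. -/
structure PivotRegular {N : ℕ} (h : N < m * p) (I : TwoSidedIdeal (FreeAlgebra K (Fin m × Fin p))) :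
    Prop where
  corner : FreeAlgebra.ι K (indexAt h) ∈ I → ∀ i < (indexAt h).1, ∀ j < (indexAt h).2,
    FreeAlgebra.ι K (i, (indexAt h).2) * FreeAlgebra.ι K ((indexAt h).1, j) ∈ I
  left : FreeAlgebra.ι K (indexAt h) ∉ I → ∀ g, FreeAlgebra.ι K (indexAt h) * g ∈ I → g ∈ I
  right : FreeAlgebra.ι K (indexAt h) ∉ I → ∀ g, g * FreeAlgebra.ι K (indexAt h) ∈ I → g ∈ I

/-- The ideal `I'` of the `N`-th algebra corresponds to the ideal `I` of the previous algebra. -/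
structure IsNext (q : Kˣ) {N : ℕ} (h : N < m * p)
    (I I' : TwoSidedIdeal (FreeAlgebra K (Fin m × Fin p))) : Prop where
  of_mem : FreeAlgebra.ι K (indexAt h) ∈ I → I' = I
  of_notMem : FreeAlgebra.ι K (indexAt h) ∉ I → ∀ f M g,
    FreeAlgebra.lift K (restored q ∅ N) f * restored q ∅ (N + 1) (indexAt h) ^ M
      = FreeAlgebra.lift K (restored q ∅ (N + 1)) g → (f ∈ I' ↔ g ∈ I)

/-! ### Subspaces stable under diagonal automorphisms -/

section Eigenvectors

variable {ι : Type*} {c : ι → Kˣ}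

theorem span_eigenvectors (φ : FreeAlgebra K ι →ₐ[K] FreeAlgebra K ι)
    (h : ∀ i, φ (FreeAlgebra.ι K i) = (c i : K) • FreeAlgebra.ι K i) (f : FreeAlgebra K ι) :
    f ∈ Submodule.span K {e | ∃ d : K, d ≠ 0 ∧ φ e = d • e} := by
  induction f with
  | grade0 r =>
    rw [Algebra.algebraMap_eq_smul_one]
    exact Submodule.smul_mem _ _ (Submodule.subset_span ⟨1, one_ne_zero, by simp⟩)
  | grade1 i => exact Submodule.subset_span ⟨c i, Units.ne_zero _, h i⟩
  | add f g hf hg => exact add_mem hf hg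
  | mul f g hf hg =>
    have := Submodule.mul_mem_mul hf hg
    rw [Submodule.span_mul_span] at this
    refine (Submodule.span_mono ?_) this
    rintro _ ⟨e, ⟨d, hd, he⟩, e', ⟨d', hd', he'⟩, rfl⟩
    exact ⟨d * d', mul_ne_zero hd hd', by
      simp only [map_mul, he, he', smul_mul_assoc, mul_smul_comm, smul_smul, mul_comm d d']⟩

/-- An element is a finite combination of eigenvectors with nonzero eigenvalues `d`. The product of
the factors `X - d` annihilates it and has nonzero constant term. -/
theorem exists_aeval_eq_zero (φ : FreeAlgebra K ι →ₐ[K] FreeAlgebra K ι)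
    (h : ∀ i, φ (FreeAlgebra.ι K i) = (c i : K) • FreeAlgebra.ι K i) (f : FreeAlgebra K ι) :
    ∃ P : Polynomial K, P.coeff 0 ≠ 0 ∧ Polynomial.aeval φ.toLinearMap P f = 0 := by
  induction span_eigenvectors φ h f using Submodule.span_induction with
  | mem e he =>
    obtain ⟨d, hd, he⟩ := he
    exact ⟨Polynomial.X - Polynomial.C d, by simpa using hd, by simp [he]⟩
  | zero => exact ⟨1, by simp, by simp⟩
  | add f g _ _ hf hg =>
    obtain ⟨P, hP, hf⟩ := hf
    obtain ⟨Q, hQ, hg⟩ := hg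
    refine ⟨P * Q, by simpa [Polynomial.mul_coeff_zero] using ⟨hP, hQ⟩, ?_⟩
    rw [map_add]
    nth_rw 1 [mul_comm P Q]
    simp [map_mul, Module.End.mul_apply, hf, hg]
  | smul d f _ hf =>
    obtain ⟨P, hP, hf⟩ := hf
    exact ⟨P, hP, by simp [hf]⟩

/-- A subspace of the free algebra that is stable under a diagonal automorphism is stable under its
inverse. -/
theorem inverse_mem_of_stable {φ ψ : FreeAlgebra K ι →ₐ[K] FreeAlgebra K ι}
    (h : ∀ i, φ (FreeAlgebra.ι K i) = (c i : K) • FreeAlgebra.ι K i) (hψ : ∀ f, ψ (φ f) = f)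
    {C : Submodule K (FreeAlgebra K ι)} (hC : ∀ f ∈ C, φ f ∈ C) {f : FreeAlgebra K ι}
    (hf : f ∈ C) : ψ f ∈ C := by
  obtain ⟨P, hP, h0⟩ := exists_aeval_eq_zero φ h f
  have hstab : ∀ Q : Polynomial K, ∀ g ∈ C, Polynomial.aeval φ.toLinearMap Q g ∈ C := by
    intro Q
    induction Q using Polynomial.induction_on' with
    | add Q R hQ hR => intro g hg; rw [map_add]; exact add_mem (hQ g hg) (hR g hg)
    | monomial n r =>
      intro g hg
      rw [Polynomial.aeval_monomial, Module.End.mul_apply, Module.algebraMap_end_apply]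
      refine C.smul_mem _ ?_
      induction n with
      | zero => simpa using hg
      | succ n ih => rw [pow_succ', Module.End.mul_apply]; exact hC _ ih
  have h1 := hstab P.divX f hf
  -- Writing `P` as `X` times `P.divX` plus its constant term and applying `ψ` expresses `ψ f` as a
  -- scalar multiple of `P.divX` evaluated at `φ` and applied to `f`.
  rw [← Polynomial.X_mul_divX_add P, map_add, map_mul, Polynomial.aeval_X, Polynomial.aeval_C,
    LinearMap.add_apply, Module.End.mul_apply, Module.algebraMap_end_apply,
    AlgHom.toLinearMap_apply] at h0
  have h2 := congrArg ψ h0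
  rw [map_add, hψ, map_smul, map_zero, add_comm, ← eq_neg_iff_add_eq_zero] at h2
  have h3 := C.smul_mem (P.coeff 0)⁻¹ (neg_mem h1)
  rwa [← h2, smul_smul, inv_mul_cancel₀ hP, one_smul] at h3

end Eigenvectors

theorem scaling_ι (q : Kˣ) (a b : Fin m × Fin p) :
    PivotSetting.scaling q a (FreeAlgebra.ι K b)
      = ((q ^ lambdaInt b a : Kˣ) : K) • FreeAlgebra.ι K b := by
  simp [PivotSetting.scaling]

theorem scaling_inv_scaling (q : Kˣ) (a : Fin m × Fin p) (f : FreeAlgebra K (Fin m × Fin p)) :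
    PivotSetting.scaling q⁻¹ a (PivotSetting.scaling q a f) = f := by
  have : (PivotSetting.scaling q⁻¹ a).comp (PivotSetting.scaling q a)
      = AlgHom.id K (FreeAlgebra K (Fin m × Fin p)) := by
    ext b
    simp only [Function.comp_apply, AlgHom.comp_apply, scaling_ι, map_smul, smul_smul,
      ← Units.val_mul, inv_zpow, mul_inv_cancel, AlgHom.id_apply, Units.val_one, one_smul]
  exact DFunLike.congr_fun this f

namespace StageIdeal

variable {q : Kˣ} {N : ℕ} {h : N < m * p} {I I' : TwoSidedIdeal (FreeAlgebra K (Fin m × Fin p))}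

theorem mem_congr (hI : StageIdeal q N I) {f g : FreeAlgebra K (Fin m × Fin p)}
    (e : FreeAlgebra.lift K (restored q ∅ N) f = FreeAlgebra.lift K (restored q ∅ N) g) :
    f ∈ I ↔ g ∈ I := by
  have h1 : f - g ∈ I := hI.ker _ (by rw [map_sub, e, sub_self])
  constructor
  · intro hf; simpa using I.sub_mem hf h1
  · intro hg; simpa using I.add_mem h1 hg

end StageIdeal

theorem pivotSetting_full (q : Kˣ) {N : ℕ} (h : N < m * p) :
    PivotSetting q h (restored q (∅ : Finset (Fin m × Fin p)) (N + 1)) :=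
  pivotSetting_restored q (isCauchon_empty _) h (Finset.notMem_empty _)

theorem PivotRegular.mul_pow_mem {N : ℕ} {h : N < m * p}
    {I : TwoSidedIdeal (FreeAlgebra K (Fin m × Fin p))} (hR : PivotRegular h I)
    (ha : FreeAlgebra.ι K (indexAt h) ∉ I) (g : FreeAlgebra K (Fin m × Fin p)) (n : ℕ) :
    g * FreeAlgebra.ι K (indexAt h) ^ n ∈ I ↔ g ∈ I := by
  refine ⟨fun hg => ?_, fun hg => I.mul_mem_right _ _ hg⟩
  induction n with
  | zero => simpa using hg
  | succ n ih => rw [pow_succ, ← mul_assoc] at hg; exact ih (hR.right ha _ hg)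

theorem PivotRegular.pow_mul_mem {N : ℕ} {h : N < m * p}
    {I : TwoSidedIdeal (FreeAlgebra K (Fin m × Fin p))} (hR : PivotRegular h I)
    (ha : FreeAlgebra.ι K (indexAt h) ∉ I) (g : FreeAlgebra K (Fin m × Fin p)) (n : ℕ) :
    FreeAlgebra.ι K (indexAt h) ^ n * g ∈ I ↔ g ∈ I := by
  refine ⟨fun hg => ?_, fun hg => I.mul_mem_left _ _ hg⟩
  induction n with
  | zero => simpa using hg
  | succ n ih => rw [pow_succ', mul_assoc] at hg; exact ih (hR.left ha _ hg)

/-! ### The localized ideal and its primeness -/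

section Localized

variable {q : Kˣ} {N : ℕ} {h : N < m * p} {I : TwoSidedIdeal (FreeAlgebra K (Fin m × Fin p))}

/-- The condition that defines the next ideal does not depend on the choice of the fraction. -/
theorem mem_iff_of_fraction (hI : StageIdeal q (N + 1) I) (hR : PivotRegular h I)
    (ha : FreeAlgebra.ι K (indexAt h) ∉ I) {z : DiagramTorus q (∅ : Finset (Fin m × Fin p))}
    {M M' : ℕ} {g g' : FreeAlgebra K (Fin m × Fin p)}
    (e : z * restored q ∅ (N + 1) (indexAt h) ^ M = FreeAlgebra.lift K (restored q ∅ (N + 1)) g)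
    (e' : z * restored q ∅ (N + 1) (indexAt h) ^ M'
      = FreeAlgebra.lift K (restored q ∅ (N + 1)) g') : g ∈ I ↔ g' ∈ I := by
  rw [← hR.mul_pow_mem ha g M', ← hR.mul_pow_mem ha g' M]
  refine hI.mem_congr ?_
  simp only [map_mul, map_pow, FreeAlgebra.lift_ι_apply, ← e, ← e', mul_assoc, ← pow_add,
    add_comm M]

/-- Take the elements having a fraction with numerator in `I`. Closure under multiplication on
either side uses the right Ore condition, and on the left also cancellation of powers of the pivot
modulo `I`. -/
theorem exists_localized (hI : StageIdeal q (N + 1) I) (hR : PivotRegular h I)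
    (ha : FreeAlgebra.ι K (indexAt h) ∉ I) : ∃ I' : TwoSidedIdeal (FreeAlgebra K (Fin m × Fin p)),
      ∀ f M g, FreeAlgebra.lift K (restored q ∅ N) f * restored q ∅ (N + 1) (indexAt h) ^ M
        = FreeAlgebra.lift K (restored q ∅ (N + 1)) g → (f ∈ I' ↔ g ∈ I) := by
  have hS := pivotSetting_full q h
  have hx := hS.unit
  have key : ∀ f : FreeAlgebra K (Fin m × Fin p), ∃ (M : ℕ) (g : FreeAlgebra K (Fin m × Fin p)),
      FreeAlgebra.lift K (restored q ∅ N) f * restored q ∅ (N + 1) (indexAt h) ^ M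
        = FreeAlgebra.lift K (restored q ∅ (N + 1)) g := fun f => by
    obtain ⟨M, g, hg⟩ := exists_lift_deleteStep_mul_pow q h f
    exact ⟨M, g, by rw [← hg _ _ hS, deleteStep_restored]⟩
  refine ⟨TwoSidedIdeal.mk' {f | ∃ M g, g ∈ I ∧
    FreeAlgebra.lift K (restored q ∅ N) f * restored q ∅ (N + 1) (indexAt h) ^ M
      = FreeAlgebra.lift K (restored q ∅ (N + 1)) g} ?_ ?_ ?_ ?_ ?_, fun f M g e => ?_⟩
  · exact ⟨0, 0, I.zero_mem, by simp⟩
  · rintro f f' ⟨M, g, hg, e⟩ ⟨M', g', hg', e'⟩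
    refine ⟨M + M', g * FreeAlgebra.ι K (indexAt h) ^ M' + g' * FreeAlgebra.ι K (indexAt h) ^ M,
      I.add_mem (I.mul_mem_right _ _ hg) (I.mul_mem_right _ _ hg'), ?_⟩
    simp only [map_add, map_mul, map_pow, FreeAlgebra.lift_ι_apply, ← e, ← e', add_mul, mul_assoc,
      ← pow_add, add_comm M']
  · rintro f ⟨M, g, hg, e⟩
    exact ⟨M, -g, I.neg_mem hg, by rw [map_neg, neg_mul, e, map_neg]⟩
  · rintro f f' ⟨M, g, hg, e⟩
    obtain ⟨M', g', e'⟩ := key f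
    obtain ⟨j, g'', e''⟩ := exists_mul_pow_eq q h g M'
    have e3 := e'' _ _ hS.rel
    refine ⟨M + j, g' * g'', I.mul_mem_left _ _ ?_, ?_⟩
    · rw [← hR.pow_mul_mem ha g'' M', ← hI.mem_congr (f := g * FreeAlgebra.ι K (indexAt h) ^ j)]
      · exact I.mul_mem_right _ _ hg
      · simpa using e3
    · rw [map_mul, mul_assoc, pow_add, ← mul_assoc _ (_ ^ M), e, e3, ← mul_assoc, e', map_mul]
  · rintro f f' ⟨M, g, hg, e⟩
    obtain ⟨M', g', e'⟩ := key f'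
    obtain ⟨j, g'', e''⟩ := exists_mul_pow_eq q h g' M
    have e3 := e'' _ _ hS.rel
    refine ⟨M' + j, g * g'', I.mul_mem_right _ _ hg, ?_⟩
    rw [map_mul, mul_assoc, pow_add, ← mul_assoc _ (_ ^ M'), e', e3, ← mul_assoc, e, map_mul]
  · rw [TwoSidedIdeal.mem_mk']
    constructor
    · rintro ⟨M', g', hg', e'⟩
      exact (mem_iff_of_fraction hI hR ha e e').2 hg'
    · exact fun hg => ⟨M, g, hg, e⟩

/-- For primeness, denominators between the factors of `f₁ * r * f₂` must be cleared. The right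
factor gets twisted by conjugation with the pivot, so one needs the condition on `f₂` to be stable
under this conjugation and under its inverse. -/
theorem stageIdeal_of_localized (hI : StageIdeal q (N + 1) I) (hR : PivotRegular h I)
    (ha : FreeAlgebra.ι K (indexAt h) ∉ I) {I' : TwoSidedIdeal (FreeAlgebra K (Fin m × Fin p))}
    (hI' : ∀ f M g, FreeAlgebra.lift K (restored q ∅ N) f * restored q ∅ (N + 1) (indexAt h) ^ M
        = FreeAlgebra.lift K (restored q ∅ (N + 1)) g → (f ∈ I' ↔ g ∈ I)) : StageIdeal q N I' := by
  have hS := pivotSetting_full q h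
  set x := restored q ∅ (N + 1) (indexAt h) with hxdef
  have hx : IsUnit x := hS.unit
  have key : ∀ f : FreeAlgebra K (Fin m × Fin p), ∃ (M : ℕ) (g : FreeAlgebra K (Fin m × Fin p)),
      FreeAlgebra.lift K (restored q ∅ N) f * x ^ M
        = FreeAlgebra.lift K (restored q ∅ (N + 1)) g := fun f => by
    obtain ⟨M, g, hg⟩ := exists_lift_deleteStep_mul_pow q h f
    exact ⟨M, g, by rw [← hg _ _ hS, deleteStep_restored]⟩
  have hxN : FreeAlgebra.lift K (restored q ∅ N) (FreeAlgebra.ι K (indexAt h)) = x := by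
    rw [FreeAlgebra.lift_ι_apply, hxdef, ← deleteStep_restored q ∅ h]; simp [deleteStep]
  have hσ : ∀ (f : FreeAlgebra K (Fin m × Fin p)) (j : ℕ),
      FreeAlgebra.lift K (restored q ∅ N) f * x ^ j
      = x ^ j * FreeAlgebra.lift K (restored q ∅ N)
        ((PivotSetting.scaling q (indexAt h))^[j] f) := fun f j => by
    have := hS.lift_deleteStep_mul_pow f j
    rwa [deleteStep_restored] at this
  have hinv : ∀ f : FreeAlgebra K (Fin m × Fin p),
      PivotSetting.scaling q (indexAt h) (PivotSetting.scaling q⁻¹ (indexAt h) f) = f := fun f => by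
    have := scaling_inv_scaling q⁻¹ (indexAt h) f
    rwa [inv_inv] at this
  have hτ : ∀ f : FreeAlgebra K (Fin m × Fin p), x * FreeAlgebra.lift K (restored q ∅ N) f
      = FreeAlgebra.lift K (restored q ∅ N) (PivotSetting.scaling q⁻¹ (indexAt h) f) * x :=
    fun f => by
      have := hσ (PivotSetting.scaling q⁻¹ (indexAt h) f) 1
      rw [Function.iterate_one, hinv, pow_one] at this
      exact this.symm
  have hτn : ∀ (f : FreeAlgebra K (Fin m × Fin p)) (j : ℕ),
      x ^ j * FreeAlgebra.lift K (restored q ∅ N) f = FreeAlgebra.lift K (restored q ∅ N)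
        ((PivotSetting.scaling q⁻¹ (indexAt h))^[j] f) * x ^ j := by
    intro f j
    induction j generalizing f with
    | zero => simp
    | succ j ih =>
      rw [pow_succ, mul_assoc, hτ, ← mul_assoc, ih, mul_assoc, Function.iterate_succ_apply]
  have hdiv : ∀ F G : FreeAlgebra K (Fin m × Fin p), FreeAlgebra.lift K (restored q ∅ N) F * x
      = FreeAlgebra.lift K (restored q ∅ N) G → G ∈ I' → F ∈ I' := by
    intro F G e hG
    obtain ⟨M, g, hg⟩ := key G
    refine (hI' F (M + 1) g ?_).2 ((hI' G M g hg).1 hG)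
    rw [pow_succ', ← mul_assoc, e, hg]
  refine ⟨fun f hf => ?_, fun h1 => ?_, fun f₁ f₂ h12 => ?_⟩
  · exact (hI' f 0 0 (by simp [hf])).2 I.zero_mem
  · exact hI.prime.1 ((hI' 1 0 1 (by simp)).1 h1)
  · by_contra hcon
    push Not at hcon
    obtain ⟨h1, h2⟩ := hcon
    obtain ⟨M₁, g₁, e₁⟩ := key f₁
    obtain ⟨M₂, g₂, e₂⟩ := key f₂
    rw [hI' _ _ _ e₁] at h1
    rw [hI' _ _ _ e₂] at h2
    have hr : ∃ r, g₁ * r * g₂ ∉ I := by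
      by_contra hno
      push Not at hno
      exact (hI.prime.2 g₁ g₂ hno).elim h1 h2
    obtain ⟨r, hr⟩ := hr
    obtain ⟨j, r', e'⟩ := exists_lift_mul_pow q h r
    have e3 := e' _ _ hS
    rw [deleteStep_restored] at e3
    let C : Submodule K (FreeAlgebra K (Fin m × Fin p)) :=
      { carrier := {f | ∀ g, f₁ * g * f ∈ I'}
        zero_mem' := fun g => by rw [mul_zero]; exact I'.zero_mem
        add_mem' := fun hf hf' g => by rw [mul_add]; exact I'.add_mem (hf g) (hf' g)
        smul_mem' := fun c f hf g => by
          rw [mul_smul_comm, Algebra.smul_def]; exact I'.mul_mem_left _ _ (hf g) }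
    -- Up to right multiplication by the pivot, the twisted element after `f₁ * g` is the original
    -- one after `f₁ * g * x`, and the pivot can be divided out in `I'`.
    have hCτ : ∀ f ∈ C, PivotSetting.scaling q⁻¹ (indexAt h) f ∈ C := by
      intro f hf g
      refine hdiv _ (f₁ * (g * FreeAlgebra.ι K (indexAt h)) * f) ?_ (hf _)
      simp only [map_mul]
      rw [hxN, mul_assoc, ← hτ]
      simp only [mul_assoc]
    -- The opposite direction is not visible directly; it holds because the twist is diagonalizable.
    have hCσ : ∀ f ∈ C, PivotSetting.scaling q (indexAt h) f ∈ C := fun f hf =>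
      inverse_mem_of_stable (φ := PivotSetting.scaling q⁻¹ (indexAt h)) (scaling_ι q⁻¹ (indexAt h))
        hinv hCτ hf
    have hit : ∀ (φ : FreeAlgebra K (Fin m × Fin p) →ₐ[K] FreeAlgebra K (Fin m × Fin p)),
        (∀ f ∈ C, φ f ∈ C) → ∀ n, ∀ f ∈ C, φ^[n] f ∈ C := by
      intro φ hφ n
      induction n with
      | zero => exact fun f hf => hf
      | succ n ih => exact fun f hf => by rw [Function.iterate_succ_apply]; exact ih _ (hφ f hf)
    have hfin := hit _ hCτ M₁ _ (hit _ hCσ j f₂ h12)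
    refine hr ((hR.mul_pow_mem ha _ j).1 ((hI' _ (M₁ + M₂) _ ?_).1
      (hfin ((PivotSetting.scaling q⁻¹ (indexAt h))^[M₁] r'))))
    simp only [map_mul, map_pow, FreeAlgebra.lift_ι_apply, ← hxdef]
    rw [← e₁, ← e₂]
    have e4 : FreeAlgebra.lift K (restored q ∅ (N + 1)) r
        * (FreeAlgebra.lift K (restored q ∅ N) f₂ * x ^ j)
        = FreeAlgebra.lift K (restored q ∅ N) r' * FreeAlgebra.lift K (restored q ∅ N)
          ((PivotSetting.scaling q (indexAt h))^[j] f₂) := by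
      rw [hσ, ← mul_assoc, e3]
    have e5 := hτn r' M₁
    have e6 := hτn ((PivotSetting.scaling q (indexAt h))^[j] f₂) M₁
    rw [pow_add, ← mul_assoc, mul_assoc _ _ (x ^ M₁), ← e6, ← mul_assoc,
      mul_assoc _ _ (x ^ M₁), ← e5, mul_assoc _ (_ * _) (x ^ j), mul_assoc _ _ (x ^ j), ← pow_add,
      add_comm M₂, pow_add]
    simp only [mul_assoc] at e4 ⊢
    congr 2
    rw [← mul_assoc _ _ (x ^ M₂), ← e4]
    simp only [mul_assoc]

end Localized

end

end DeletingDerivations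

namespace DeletingDerivations

noncomputable section

/-! ## Regularity of pivots modulo prime ideals -/

universe u

variable {m p : ℕ} {K : Type u} [Field K]

section Quotient

variable {ι : Type*}

/-- The projection of the free algebra onto its quotient by a two-sided ideal. -/
def freeProj (I : TwoSidedIdeal (FreeAlgebra K ι)) : FreeAlgebra K ι →ₐ[K] I.ringCon.Quotient :=
  { I.ringCon.mk' with commutes' := fun _ => rfl }

theorem freeProj_surjective (I : TwoSidedIdeal (FreeAlgebra K ι)) :
    Function.Surjective (freeProj I) := I.ringCon.mk'_surjective

theorem freeProj_eq_zero {I : TwoSidedIdeal (FreeAlgebra K ι)} {f : FreeAlgebra K ι} :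
    freeProj I f = 0 ↔ f ∈ I := by
  rw [TwoSidedIdeal.mem_iff, ← RingCon.eq]; rfl

theorem lift_freeProj_ι (I : TwoSidedIdeal (FreeAlgebra K ι)) :
    FreeAlgebra.lift K (fun b => freeProj I (FreeAlgebra.ι K b)) = freeProj I := by
  ext b; simp

theorem adjoin_freeProj_ι (I : TwoSidedIdeal (FreeAlgebra K ι)) :
    Algebra.adjoin K (Set.range fun b => freeProj I (FreeAlgebra.ι K b)) = ⊤ := by
  rw [Algebra.adjoin_range_eq_range_freeAlgebra_lift, lift_freeProj_ι, AlgHom.range_eq_top]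
  exact freeProj_surjective I

end Quotient

/-- A ring is prime if the zero ideal is. -/
def IsPrimeRing (B : Type*) [Ring B] : Prop := ∀ a b : B, (∀ r, a * r * b = 0) → a = 0 ∨ b = 0

theorem isPrimeRing_freeProj {ι : Type*} {I : TwoSidedIdeal (FreeAlgebra K ι)}
    (hI : TwoSidedIdealIsPrime I) : IsPrimeRing I.ringCon.Quotient := by
  intro a b hab
  obtain ⟨a, rfl⟩ := freeProj_surjective I a
  obtain ⟨b, rfl⟩ := freeProj_surjective I b
  rw [freeProj_eq_zero, freeProj_eq_zero]
  refine hI.2 a b fun r => ?_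
  rw [← freeProj_eq_zero, map_mul, map_mul]
  exact hab _

theorem StageIdeal.stageRel {q : Kˣ} {N : ℕ} {I : TwoSidedIdeal (FreeAlgebra K (Fin m × Fin p))}
    (hN : N ≤ m * p) (hI : StageIdeal q N I) :
    StageRel q (activeSet m p N) fun b => freeProj I (FreeAlgebra.ι K b) := by
  refine (stageRel_restored q (isCauchon_empty N) hN).of_lift fun f hf => ?_
  rw [lift_freeProj_ι, freeProj_eq_zero]
  exact hI.ker f hf

theorem StageRel.of_insert {k B : Type*} [CommRing k] [Ring B] [Algebra k B] {q : kˣ}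
    {S : Set (Fin m × Fin p)} {a : Fin m × Fin p} {V : Fin m × Fin p → B}
    (hV : StageRel q (insert a S) V) (h0 : V a = 0) : StageRel q S V where
  col := hV.col
  row := hV.row
  anti := hV.anti
  diag i i' j j' hi hj hS := hV.diag i i' j j' hi hj (Set.mem_insert_of_mem _ hS)
  comm i i' j j' hi hj hS := by
    by_cases ha : (i', j') = a
    · rw [ha, h0, mul_zero, zero_mul]
    · exact hV.comm i i' j j' hi hj fun h => h.elim ha hS

/-- If the pivot lies in the ideal, the ideal is also an ideal of the next algebra. -/
theorem StageIdeal.of_pivot_mem {q : Kˣ} {N : ℕ} {h : N < m * p}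
    {I : TwoSidedIdeal (FreeAlgebra K (Fin m × Fin p))} (hI : StageIdeal q (N + 1) I)
    (ha : FreeAlgebra.ι K (indexAt h) ∈ I) : StageIdeal q N I := by
  refine ⟨fun f hf => ?_, hI.prime⟩
  have h1 := hI.stageRel h
  rw [activeSet_succ h] at h1
  have h2 := lift_eq_zero_of_lift_restored h.le (h1.of_insert (freeProj_eq_zero.2 ha)) hf
  rwa [lift_freeProj_ι, freeProj_eq_zero] at h2

theorem exists_isNext {q : Kˣ} {N : ℕ} {h : N < m * p}
    {I : TwoSidedIdeal (FreeAlgebra K (Fin m × Fin p))} (hI : StageIdeal q (N + 1) I)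
    (hR : PivotRegular h I) : ∃ I', IsNext q h I I' ∧ StageIdeal q N I' := by
  by_cases ha : FreeAlgebra.ι K (indexAt h) ∈ I
  · exact ⟨I, ⟨fun _ => rfl, fun hn => absurd ha hn⟩, hI.of_pivot_mem ha⟩
  · obtain ⟨I', hI'⟩ := exists_localized hI hR ha
    exact ⟨I', ⟨fun hn => absurd hn ha, fun _ => hI'⟩, stageIdeal_of_localized hI hR ha hI'⟩

/-! ### The opposite algebra -/

theorem StageRel.op {B : Type*} [Ring B] [Algebra K B] {q : Kˣ} {S : Set (Fin m × Fin p)}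
    {U : Fin m × Fin p → B} (h : StageRel q S U) :
    StageRel q⁻¹ S fun b => MulOpposite.op (U b) where
  col i i' j hi := by
    rw [← MulOpposite.op_mul, ← MulOpposite.op_mul, h.col i i' j hi, MulOpposite.op_smul, smul_smul]
    simp
  row i j j' hj := by
    rw [← MulOpposite.op_mul, ← MulOpposite.op_mul, h.row i j j' hj, MulOpposite.op_smul, smul_smul]
    simp
  anti i i' j j' hi hj := by
    rw [← MulOpposite.op_mul, ← MulOpposite.op_mul, h.anti i i' j j' hi hj]
  diag i i' j j' hi hj hS := by
    simp only [← MulOpposite.op_mul, ← MulOpposite.op_smul, ← MulOpposite.op_add]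
    rw [h.diag i i' j j' hi hj hS, ← h.anti i i' j' j hi hj, inv_inv]
    congr 1
    module
  comm i i' j j' hi hj hS := by
    rw [← MulOpposite.op_mul, ← MulOpposite.op_mul, h.comm i i' j j' hi hj hS]

theorem adjoin_op {B ι : Type*} [Ring B] [Algebra K B] {U : ι → B}
    (h : Algebra.adjoin K (Set.range U) = ⊤) :
    Algebra.adjoin K (Set.range fun b => MulOpposite.op (U b)) = ⊤ := by
  have := congrArg Subalgebra.op h
  rw [Subalgebra.op_adjoin, Subalgebra.op_top] at this
  rw [← this]
  congr 1
  ext x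
  constructor
  · rintro ⟨b, rfl⟩; exact ⟨b, rfl⟩
  · rintro ⟨b, hb⟩; exact ⟨b, MulOpposite.unop_injective hb⟩

theorem IsPrimeRing.op {B : Type*} [Ring B] (h : IsPrimeRing B) : IsPrimeRing Bᵐᵒᵖ := by
  intro a b hab
  refine (h b.unop a.unop fun r => ?_).symm.imp ?_ ?_
  · have := congrArg MulOpposite.unop (hab (MulOpposite.op r))
    simpa [mul_assoc] using this
  · exact fun e => MulOpposite.unop_injective e
  · exact fun e => MulOpposite.unop_injective e

/-! ### Normality of the corner elements -/

section Corner

variable {B : Type u} [Ring B] [Algebra K B] {q : Kˣ} {N : ℕ} {h : N < m * p}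
  {U : Fin m × Fin p → B}

/-- A left ideal spanned by `Y` absorbs right multiplication if it does so on generators. -/
theorem mul_mem_span_of_generators {ι κ : Type*} {U : ι → B}
    (htop : Algebra.adjoin K (Set.range U) = ⊤) {Y : κ → B}
    (hY : ∀ i b, Y i * U b ∈ Ideal.span (Set.range Y)) {z : B} (hz : z ∈ Ideal.span (Set.range Y))
    (r : B) : z * r ∈ Ideal.span (Set.range Y) := by
  have hr : r ∈ Algebra.adjoin K (Set.range U) := htop ▸ Algebra.mem_top
  induction hr using Algebra.adjoin_induction generalizing z with
  | mem r hr =>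
    obtain ⟨b, rfl⟩ := hr
    induction hz using Submodule.span_induction with
    | mem z hz => obtain ⟨i, rfl⟩ := hz; exact hY i b
    | zero => simp
    | add z z' _ _ h1 h2 => rw [add_mul]; exact add_mem h1 h2
    | smul c z _ h1 => rw [smul_eq_mul, mul_assoc]; exact Ideal.mul_mem_left _ _ h1
  | algebraMap c =>
    rw [← Algebra.commutes]; exact Ideal.mul_mem_left _ _ hz
  | add r r' _ _ h1 h2 => rw [mul_add]; exact add_mem (h1 hz) (h2 hz)
  | mul r r' _ _ h1 h2 => rw [← mul_assoc]; exact h2 (h1 hz)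

/-- Entries in the row of the pivot. -/
def rowEntries (U : Fin m × Fin p → B) (a : Fin m × Fin p) (j : {j : Fin p // j < a.2}) : B :=
  U (a.1, j)

/-- Entries in the column of the pivot. -/
def colEntries (U : Fin m × Fin p → B) (a : Fin m × Fin p) (i : {i : Fin m // i < a.1}) : B :=
  U (i, a.2)

/-- Products of an entry in the column and an entry in the row of the pivot. -/
def cornerEntries (U : Fin m × Fin p → B) (a : Fin m × Fin p)
    (c : {i : Fin m // i < a.1} × {j : Fin p // j < a.2}) : B :=
  U (c.1, a.2) * U (a.1, c.2)

theorem mem_span_of_eq_smul {Y : Set B} {y z w : B} (hy : y ∈ Y) {c : K}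
    (hz : z = c • (w * y)) : z ∈ Ideal.span Y := by
  rw [hz, ← smul_mul_assoc]
  exact Ideal.mul_mem_left _ _ (Ideal.subset_span hy)

/-- Each relation moves a generator past the row entry so that every term ends in an entry of that
row. A correction term arises only for generators strictly north-west and ends in an entry further
left; generators strictly south-east are not active, being lexicographically after the pivot. -/
theorem row_mul_mem (hU : StageRel q (activeSet m p (N + 1)) U)
    (j : {j : Fin p // j < (indexAt h : Fin m × Fin p).2}) (c : Fin m × Fin p) :
    rowEntries U (indexAt h) j * U c ∈ Ideal.span (Set.range (rowEntries U (indexAt h))) := by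
  have hN := lexIndex_indexAt h
  generalize (indexAt h : Fin m × Fin p) = a at *
  obtain ⟨k, l⟩ := a
  obtain ⟨j, hj⟩ := j
  obtain ⟨i₂, j₂⟩ := c
  simp only at hj
  have hone : ∀ {z : B} {t : K}, U (k, j) * U (i₂, j₂) = t • (z * U (k, j)) →
      rowEntries U (k, l) ⟨j, hj⟩ * U (i₂, j₂) ∈ Ideal.span (Set.range (rowEntries U (k, l))) :=
    fun e => mem_span_of_eq_smul (y := U (k, j)) ⟨⟨j, hj⟩, rfl⟩ e
  rcases lt_trichotomy i₂ k with hi | rfl | hi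
  · rcases lt_trichotomy j₂ j with hj' | rfl | hj'
    · have e := hU.diag_correction hi hj'
      have e2 : rowEntries U (k, l) ⟨j, hj⟩ * U (i₂, j₂) = U (i₂, j₂) * U (k, j)
          - correction q (activeSet m p (N + 1)) (k, j) • (U (i₂, j) * U (k, j₂)) := by
        rw [e]; simp [rowEntries]
      rw [e2]
      refine sub_mem (mem_span_of_eq_smul (Set.mem_range_self ⟨j, hj⟩) (one_smul K _).symm) ?_
      exact mem_span_of_eq_smul (Set.mem_range_self ⟨j₂, hj'.trans hj⟩) rfl
    · exact hone (smul_symm (hU.col _ _ _ hi))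
    · exact hone (by rw [one_smul]; exact (hU.anti _ _ _ _ hi hj').symm)
  · rcases lt_trichotomy j₂ j with hj' | rfl | hj'
    · exact hone (smul_symm (hU.row _ _ _ hj'))
    · exact hone (one_smul K _).symm
    · exact hone (hU.row _ _ _ hj')
  · rcases lt_trichotomy j₂ j with hj' | rfl | hj'
    · exact hone (by rw [one_smul]; exact hU.anti _ _ _ _ hi hj')
    · exact hone (hU.col _ _ _ hi)
    · have hS : (i₂, j₂) ∉ activeSet m p (N + 1) := by
        rw [mem_activeSet]
        have := lexIndex_lt_of_row_lt (a := (k, l)) (b := (i₂, j₂)) hi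
        omega
      exact hone (by rw [one_smul]; exact hU.comm _ _ _ _ hi hj' hS)

/-- As for the row, except that a generator strictly south-east of the column entry may be active.
It then lies in a row above the pivot, so the correction term ends in another entry of the column
above the pivot. -/
theorem col_mul_mem (hU : StageRel q (activeSet m p (N + 1)) U)
    (i : {i : Fin m // i < (indexAt h : Fin m × Fin p).1}) (c : Fin m × Fin p) :
    colEntries U (indexAt h) i * U c ∈ Ideal.span (Set.range (colEntries U (indexAt h))) := by
  have hN := lexIndex_indexAt h
  generalize (indexAt h : Fin m × Fin p) = a at *
  obtain ⟨k, l⟩ := a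
  obtain ⟨i, hi⟩ := i
  obtain ⟨i₂, j₂⟩ := c
  simp only at hi
  have hone : ∀ {z : B} {t : K}, U (i, l) * U (i₂, j₂) = t • (z * U (i, l)) →
      colEntries U (k, l) ⟨i, hi⟩ * U (i₂, j₂) ∈ Ideal.span (Set.range (colEntries U (k, l))) :=
    fun e => mem_span_of_eq_smul (y := U (i, l)) ⟨⟨i, hi⟩, rfl⟩ e
  rcases lt_trichotomy i₂ i with hi' | rfl | hi'
  · rcases lt_trichotomy j₂ l with hj' | rfl | hj'
    · have e := hU.diag_correction hi' hj'
      have e2 : colEntries U (k, l) ⟨i, hi⟩ * U (i₂, j₂) = U (i₂, j₂) * U (i, l)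
          - correction q (activeSet m p (N + 1)) (i, l) • (U (i, j₂) * U (i₂, l)) := by
        rw [e, hU.anti _ _ _ _ hi' hj']; simp [colEntries]
      rw [e2]
      refine sub_mem (mem_span_of_eq_smul (Set.mem_range_self ⟨i, hi⟩) (one_smul K _).symm) ?_
      exact mem_span_of_eq_smul (Set.mem_range_self ⟨i₂, hi'.trans hi⟩) rfl
    · exact hone (smul_symm (hU.col _ _ _ hi'))
    · exact hone (by rw [one_smul]; exact (hU.anti _ _ _ _ hi' hj').symm)
  · rcases lt_trichotomy j₂ l with hj' | rfl | hj'
    · exact hone (smul_symm (hU.row _ _ _ hj'))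
    · exact hone (one_smul K _).symm
    · exact hone (hU.row _ _ _ hj')
  · rcases lt_trichotomy j₂ l with hj' | rfl | hj'
    · exact hone (by rw [one_smul]; exact hU.anti _ _ _ _ hi' hj')
    · exact hone (hU.col _ _ _ hi')
    · by_cases hk : i₂ < k
      · have e := hU.diag_correction hi' hj'
        rw [show colEntries U (k, l) ⟨i, hi⟩ = U (i, l) from rfl, e]
        refine add_mem (mem_span_of_eq_smul (Set.mem_range_self ⟨i, hi⟩) (one_smul K _).symm) ?_
        exact mem_span_of_eq_smul (y := U (i₂, l)) ⟨⟨i₂, hk⟩, rfl⟩ rfl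
      · have hS : (i₂, j₂) ∉ activeSet m p (N + 1) := by
          rw [mem_activeSet]
          have : lexIndex (k, l) < lexIndex (i₂, j₂) := by
            rw [lexIndex_lt_iff]
            rcases (not_lt.1 hk).lt_or_eq with h1 | h1
            · exact .inl h1
            · exact .inr ⟨h1, hj'⟩
          omega
        exact hone (by rw [one_smul]; exact hU.comm _ _ _ _ hi' hj' hS)

/-- The products generate the column ideal times the row ideal, and each of these absorbs
multiplication on the right. -/
theorem corner_mul_mem (hU : StageRel q (activeSet m p (N + 1)) U)
    (htop : Algebra.adjoin K (Set.range U) = ⊤) {z : B}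
    (hz : z ∈ Ideal.span (Set.range (cornerEntries U (indexAt h)))) (r : B) :
    z * r ∈ Ideal.span (Set.range (cornerEntries U (indexAt h))) := by
  refine mul_mem_span_of_generators htop (fun c b => ?_) hz r
  have h1 := row_mul_mem hU c.2 b
  have h2 : ∀ z ∈ Ideal.span (Set.range (colEntries U (indexAt h))), ∀ j,
      z * rowEntries U (indexAt h) j ∈ Ideal.span (Set.range (cornerEntries U (indexAt h))) := by
    intro z hz j
    induction hz using Submodule.span_induction with
    | mem z hz => obtain ⟨i, rfl⟩ := hz; exact Ideal.subset_span ⟨(i, j), rfl⟩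
    | zero => simp
    | add z z' _ _ h1 h2 => rw [add_mul]; exact add_mem h1 h2
    | smul c z _ h1 => rw [smul_eq_mul, mul_assoc]; exact Ideal.mul_mem_left _ _ h1
  have h3 : ∀ z ∈ Ideal.span (Set.range (rowEntries U (indexAt h))),
      ∀ y ∈ Ideal.span (Set.range (colEntries U (indexAt h))),
        y * z ∈ Ideal.span (Set.range (cornerEntries U (indexAt h))) := by
    intro z hz
    induction hz using Submodule.span_induction with
    | mem z hz => obtain ⟨j, rfl⟩ := hz; exact fun y hy => h2 y hy j
    | zero => simp
    | add z z' _ _ h1 h2 => exact fun y hy => by rw [mul_add]; exact add_mem (h1 y hy) (h2 y hy)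
    | smul d z _ ih =>
      intro y hy
      rw [smul_eq_mul, ← mul_assoc]
      exact ih _ (mul_mem_span_of_generators htop (col_mul_mem hU) hy d)
  rw [cornerEntries, mul_assoc]
  exact h3 _ h1 _ (Ideal.subset_span ⟨c.1, rfl⟩)

/-! ### Regularity -/

theorem sub_inv_ne_zero {q : Kˣ} (hq : ∀ n : ℕ, 0 < n → (q : K) ^ n ≠ 1) :
    (q : K) - ((q⁻¹ : Kˣ) : K) ≠ 0 := by
  rw [sub_ne_zero, Units.val_inv_eq_inv_val]
  intro e
  refine hq 2 two_pos ?_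
  nth_rw 1 [pow_two, e]
  exact inv_mul_cancel₀ q.ne_zero

/-- A vanishing geometric sum in `q⁻²` would make `q` a root of unity. -/
theorem sum_pow_ne_zero (hq : ∀ n : ℕ, 0 < n → (q : K) ^ n ≠ 1) (n : ℕ) :
    ∑ i ∈ Finset.range (n + 1), (((q⁻¹ : Kˣ) : K) * ((q⁻¹ : Kˣ) : K)) ^ i ≠ 0 := by
  intro h0
  have h1 := geom_sum_mul (((q⁻¹ : Kˣ) : K) * ((q⁻¹ : Kˣ) : K)) (n + 1)
  rw [h0, zero_mul, eq_comm, sub_eq_zero, ← pow_two, ← pow_mul, Units.val_inv_eq_inv_val, inv_pow,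
    inv_eq_one] at h1
  exact hq _ (by positivity) h1

/-- The `q`-analogue of differentiating a power: the entry passes the pivots one at a time, and the
correction terms produced differ by powers of `q⁻²`. -/
theorem northWest_mul_pivot_pow (hU : StageRel q (activeSet m p (N + 1)) U) {b : Fin m × Fin p}
    (hi : b.1 < (indexAt h).1) (hj : b.2 < (indexAt h).2) (n : ℕ) :
    U b * U (indexAt h) ^ (n + 1) = U (indexAt h) ^ (n + 1) * U b
      + (((q : K) - ((q⁻¹ : Kˣ) : K))
        * ∑ i ∈ Finset.range (n + 1), (((q⁻¹ : Kˣ) : K) * ((q⁻¹ : Kˣ) : K)) ^ i) •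
          (U (b.1, (indexAt h).2) * U ((indexAt h).1, b.2) * U (indexAt h) ^ n) := by
  have hc : ∀ n, U (indexAt h) ^ n * (U (b.1, (indexAt h).2) * U ((indexAt h).1, b.2))
      = (((q⁻¹ : Kˣ) : K) * ((q⁻¹ : Kˣ) : K)) ^ n •
        (U (b.1, (indexAt h).2) * U ((indexAt h).1, b.2) * U (indexAt h) ^ n) := by
    intro n
    induction n with
    | zero => simp
    | succ n ih =>
      have h1 := hU.pivot_corner_mul hi hj
      have h2 := smul_symm (q := q * q) h1
      rw [mul_inv, Units.val_mul] at h2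
      rw [pow_succ, mul_assoc, h2, mul_smul_comm, ← mul_assoc, ih, smul_mul_assoc, smul_smul,
        mul_assoc _ (_ ^ n), ← pow_succ']
  induction n with
  | zero => simp [hU.pivot_northWest_mul hi hj]
  | succ n ih =>
    rw [pow_succ, ← mul_assoc, ih, add_mul, mul_assoc (_ ^ (n + 1)), hU.pivot_northWest_mul hi hj,
      smul_mul_assoc, mul_assoc _ (_ ^ n), ← pow_succ, mul_add, mul_smul_comm, hc (n + 1),
      ← mul_assoc, ← pow_succ, Finset.sum_range_succ _ (n + 1)]
    module

/-- Suppose `x ^ (n + 1) = 0` but `x ^ n ≠ 0`. By the `q`-Leibniz formula the products of column and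
row entries annihilate `x ^ n` from the left. The left ideal they span is two-sided, so they vanish
in a prime ring. Then `x` is normal, `x * r * x ^ n` is a left multiple of `x ^ (n + 1)`, and
primeness gives a contradiction. -/
theorem pivot_pow_ne_zero (hq : ∀ n : ℕ, 0 < n → (q : K) ^ n ≠ 1)
    (hU : StageRel q (activeSet m p (N + 1)) U) (htop : Algebra.adjoin K (Set.range U) = ⊤)
    (hP : IsPrimeRing B) (hx : U (indexAt h) ≠ 0) (n : ℕ) : U (indexAt h) ^ n ≠ 0 := by
  induction n with
  | zero =>
    rw [pow_zero]; intro h1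
    exact hx (by rw [← mul_one (U _), h1, mul_zero])
  | succ n ih =>
    intro h0
    have hD : ∀ c, cornerEntries U (indexAt h) c * U (indexAt h) ^ n = 0 := by
      intro c
      have h1 := northWest_mul_pivot_pow (h := h) hU (b := (c.1.1, c.2.1)) c.1.2 c.2.2 n
      rw [h0, mul_zero, zero_mul, zero_add] at h1
      refine (smul_eq_zero.1 h1.symm).resolve_left (mul_ne_zero ?_ (sum_pow_ne_zero hq n))
      exact sub_inv_ne_zero hq
    let L : Ideal B :=
      { carrier := {z | z * U (indexAt h) ^ n = 0}
        zero_mem' := zero_mul _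
        add_mem' := fun {y z} hy hz => by
          simp only [Set.mem_ofPred_eq] at hy hz ⊢; rw [add_mul, hy, hz, add_zero]
        smul_mem' := fun c z hz => by
          simp only [Set.mem_ofPred_eq] at hz ⊢; rw [smul_eq_mul, mul_assoc, hz, mul_zero] }
    have hL : Ideal.span (Set.range (cornerEntries U (indexAt h))) ≤ L :=
      Ideal.span_le.2 (by rintro _ ⟨c, rfl⟩; exact hD c)
    have hD0 : ∀ c, cornerEntries U (indexAt h) c = 0 := fun c =>
      (hP _ _ fun r => hL (corner_mul_mem hU htop (Ideal.subset_span ⟨c, rfl⟩) r)).resolve_right ih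
    have hnorm : ∀ r, ∃ r', U (indexAt h) * r = r' * U (indexAt h) := by
      intro r
      have hr : r ∈ Algebra.adjoin K (Set.range U) := htop ▸ Algebra.mem_top
      induction hr using Algebra.adjoin_induction with
      | mem r hr =>
        obtain ⟨b, rfl⟩ := hr
        by_cases hb : b.1 < (indexAt h).1 ∧ b.2 < (indexAt h).2
        · refine ⟨U b, ?_⟩
          rw [hU.pivot_northWest_mul hb.1 hb.2]
          have := hD0 (⟨b.1, hb.1⟩, ⟨b.2, hb.2⟩)
          rw [cornerEntries] at this
          rw [this, smul_zero, add_zero]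
        · exact ⟨_, by rw [smul_symm (hU.pivot_other_mul hb), ← smul_mul_assoc]⟩
      | algebraMap c => exact ⟨algebraMap K B c, (Algebra.commutes _ _).symm⟩
      | add r s _ _ h1 h2 =>
        obtain ⟨r', h1⟩ := h1
        obtain ⟨s', h2⟩ := h2
        exact ⟨r' + s', by rw [mul_add, h1, h2, add_mul]⟩
      | mul r s _ _ h1 h2 =>
        obtain ⟨r', h1⟩ := h1
        obtain ⟨s', h2⟩ := h2
        exact ⟨r' * s', by rw [← mul_assoc, h1, mul_assoc, h2, mul_assoc]⟩
    refine (hP (U (indexAt h)) (U (indexAt h) ^ n) fun r => ?_).elim hx ih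
    obtain ⟨r', hr⟩ := hnorm r
    rw [hr, mul_assoc, ← pow_succ', h0, mul_zero]

/-- The elements killed from the right by some power of the pivot form a left ideal; by
noetherianity one power kills them all. The Ore condition puts `g * r` into this ideal for all `r`,
and primeness applies since that power is nonzero. -/
theorem eq_zero_of_mul_pivot_eq_zero (hq : ∀ n : ℕ, 0 < n → (q : K) ^ n ≠ 1)
    (hU : StageRel q (activeSet m p (N + 1)) U) (htop : Algebra.adjoin K (Set.range U) = ⊤)
    (hP : IsPrimeRing B) (hx : U (indexAt h) ≠ 0) {g : B} (hg : g * U (indexAt h) = 0) :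
    g = 0 := by
  have hne := pivot_pow_ne_zero hq hU htop hP hx
  have : IsNoetherianRing B := hU.almostCommutes.isNoetherianRing htop
  let Z : Ideal B :=
    { carrier := {z | ∃ n, z * U (indexAt h) ^ n = 0}
      zero_mem' := ⟨0, zero_mul _⟩
      add_mem' := by
        rintro y z ⟨n, hy⟩ ⟨n', hz⟩
        refine ⟨n + n', ?_⟩
        rw [add_mul, pow_add, ← mul_assoc, hy, zero_mul, ← pow_add, add_comm n, pow_add,
          ← mul_assoc, hz, zero_mul, add_zero]
      smul_mem' := by
        rintro c z ⟨n, hz⟩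
        exact ⟨n, by rw [smul_eq_mul, mul_assoc, hz, mul_zero]⟩ }
  have hunif : ∃ n, ∀ z ∈ Z, z * U (indexAt h) ^ n = 0 := by
    obtain ⟨S, hS⟩ := (isNoetherianRing_iff_ideal_fg B).1 this Z
    have hSZ : ∀ s ∈ S, ∃ n, s * U (indexAt h) ^ n = 0 := fun s hs => by
      have : s ∈ Z := hS ▸ Ideal.subset_span hs
      exact this
    choose! e he using hSZ
    refine ⟨S.sup e, fun z hz => ?_⟩
    rw [← hS] at hz
    induction hz using Submodule.span_induction with
    | mem z hz =>
      rw [← Nat.add_sub_cancel' (Finset.le_sup (f := e) hz), pow_add, ← mul_assoc, he z hz,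
        zero_mul]
    | zero => exact zero_mul _
    | add y z _ _ hy hz => rw [add_mul, hy, hz, add_zero]
    | smul c z _ hz => rw [smul_eq_mul, mul_assoc, hz, mul_zero]
  obtain ⟨n, hn⟩ := hunif
  refine (hP g (U (indexAt h) ^ n) fun r => hn _ ?_).resolve_right (hne n)
  have hr : r ∈ (FreeAlgebra.lift K U).range := by
    rw [← Algebra.adjoin_range_eq_range_freeAlgebra_lift, htop]; trivial
  obtain ⟨f, rfl⟩ := hr
  obtain ⟨j, f', hf⟩ := exists_mul_pow_eq q h f 1
  refine ⟨j, ?_⟩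
  have e := hf B U hU
  rw [pow_one] at e
  rw [mul_assoc]
  exact (congrArg (g * ·) e).trans (by rw [← mul_assoc, hg, zero_mul])

end Corner

/-- For `q` not a root of unity, pivots are regular modulo prime ideals. -/
theorem StageIdeal.pivotRegular {q : Kˣ} (hq : ∀ n : ℕ, 0 < n → (q : K) ^ n ≠ 1) {N : ℕ}
    {h : N < m * p} {I : TwoSidedIdeal (FreeAlgebra K (Fin m × Fin p))}
    (hI : StageIdeal q (N + 1) I) : PivotRegular h I := by
  have hU := hI.stageRel h
  have htop := adjoin_freeProj_ι I
  have hP := isPrimeRing_freeProj hI.prime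
  refine ⟨fun ha i hi j hj => ?_, fun ha g hg => ?_, fun ha g hg => ?_⟩
  -- With the pivot zero in the quotient, its relation with the entry at `(i, j)` reduces to `q -
  -- q⁻¹` times the product in question.
  · have h1 := hU.pivot_northWest_mul (h := h) (b := (i, j)) hi hj
    rw [freeProj_eq_zero.2 ha, mul_zero, zero_mul, zero_add, eq_comm, smul_eq_zero,
      ← map_mul, freeProj_eq_zero] at h1
    exact h1.resolve_left (sub_inv_ne_zero hq)
  -- Cancellation on the left is cancellation on the right in the opposite algebra, whose parameter
  -- is `q⁻¹`.
  · have hq' : ∀ n : ℕ, 0 < n → ((q⁻¹ : Kˣ) : K) ^ n ≠ 1 := fun n hn => by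
      rw [Units.val_inv_eq_inv_val, inv_pow, Ne, inv_eq_one]; exact hq n hn
    rw [← freeProj_eq_zero] at ha hg ⊢
    rw [map_mul] at hg
    refine MulOpposite.op_injective (eq_zero_of_mul_pivot_eq_zero (h := h) hq' hU.op (adjoin_op htop)
      hP.op (fun e => ha (MulOpposite.op_injective e)) ?_)
    rw [← MulOpposite.op_mul, hg]; rfl
  · rw [← freeProj_eq_zero] at ha hg ⊢
    rw [map_mul] at hg
    exact eq_zero_of_mul_pivot_eq_zero (h := h) hq hU htop hP ha hg

/-! ### Chains of ideals -/

/-- A class of ideals that is stable under the steps of the algorithm. -/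
structure StageClass (q : Kˣ) (G : ℕ → TwoSidedIdeal (FreeAlgebra K (Fin m × Fin p)) → Prop) :
    Prop where
  stageIdeal : ∀ {N I}, N ≤ m * p → G N I → StageIdeal q N I
  regular : ∀ {N I} (h : N < m * p), G (N + 1) I → PivotRegular h I
  next : ∀ {N I I'} (h : N < m * p), G (N + 1) I → IsNext q h I I' → StageIdeal q N I' → G N I'

theorem stageClass_stageIdeal {q : Kˣ} (hq : ∀ n : ℕ, 0 < n → (q : K) ^ n ≠ 1) :
    StageClass (m := m) (p := p) q (StageIdeal q) where
  stageIdeal _ h := h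
  regular _ h := h.pivotRegular hq
  next _ _ _ h := h

/-- The sequence of ideals obtained from an ideal by the successive steps. -/
structure IsChain (q : Kˣ) (G : ℕ → TwoSidedIdeal (FreeAlgebra K (Fin m × Fin p)) → Prop)
    (J : ℕ → TwoSidedIdeal (FreeAlgebra K (Fin m × Fin p))) : Prop where
  mem : ∀ N ≤ m * p, G N (J N)
  next : ∀ N (h : N < m * p), IsNext q h (J (N + 1)) (J N)

theorem StageClass.exists_isChain {q : Kˣ}
    {G : ℕ → TwoSidedIdeal (FreeAlgebra K (Fin m × Fin p)) → Prop} (hG : StageClass q G)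
    {I : TwoSidedIdeal (FreeAlgebra K (Fin m × Fin p))} (hI : G (m * p) I) :
    ∃ J, IsChain q G J ∧ J (m * p) = I := by
  -- The next ideal is made a total function, constrained only where it matters, so that the chain
  -- can be defined by recursion on the number of steps.
  have step : ∀ t (I : TwoSidedIdeal (FreeAlgebra K (Fin m × Fin p))), ∃ I',
      (t < m * p → G (m * p - t) I →
        G (m * p - (t + 1)) I' ∧ ∀ h : m * p - (t + 1) < m * p, IsNext q h I I') := by
    intro t I
    by_cases ht : t < m * p
    · by_cases hI : G (m * p - t) I
      · have h : m * p - (t + 1) < m * p := by omega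
        rw [show m * p - t = m * p - (t + 1) + 1 by omega] at hI
        obtain ⟨I', h1, h2⟩ := exists_isNext (hG.stageIdeal h hI) (hG.regular h hI)
        exact ⟨I', fun _ _ => ⟨hG.next h hI h1 h2, fun _ => h1⟩⟩
      · exact ⟨I, fun _ h => absurd h hI⟩
    · exact ⟨I, fun h => absurd h ht⟩
  choose s hs using step
  let A : ℕ → TwoSidedIdeal (FreeAlgebra K (Fin m × Fin p)) := fun t => Nat.rec I s t
  have hA : ∀ t ≤ m * p, G (m * p - t) (A t) := by
    intro t
    induction t with
    | zero => exact fun _ => hI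
    | succ t ih => exact fun ht => (hs t (A t) ht (ih (by omega))).1
  refine ⟨fun N => A (m * p - N), ⟨fun N hN => ?_, fun N h => ?_⟩, by simp [A]⟩
  · have := hA (m * p - N) (Nat.sub_le _ _)
    rwa [Nat.sub_sub_self hN] at this
  · have h1 := (hs (m * p - (N + 1)) (A (m * p - (N + 1))) (by omega) (hA _ (Nat.sub_le _ _))).2
    have e : m * p - (m * p - (N + 1) + 1) = N := by omega
    have h2 := h1 (by omega)
    have e2 : m * p - N = m * p - (N + 1) + 1 := by omega
    simp only [e2]
    convert h2 using 1
    exact e.symm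

end

end DeletingDerivations

namespace DeletingDerivations

noncomputable section

/-! ## Ideals of the final algebra -/

universe u

variable {m p : ℕ} {K : Type u} [Field K]

/-- The homomorphism of quantum tori induced by a homomorphism of exponents that preserves the
cocycles. -/
def QTorus.map {Γ Γ' : Type*} [AddCommGroup Γ] [AddCommGroup Γ'] (q : Kˣ) {b : Γ →+ Γ →+ ℤ}
    {b' : Γ' →+ Γ' →+ ℤ} (φ : Γ →+ Γ') (h : ∀ α β, b' (φ α) (φ β) = b α β) :
    QTorus q b →ₐ[K] QTorus q b' :=
  AlgHom.ofLinearMap (QTorus.lin fun α => QTorus.T q b' (φ α))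
    (by rw [← QTorus.T_zero, QTorus.lin_T, map_zero, QTorus.T_zero])
    (fun f g => by
      induction f using QTorus.induction_linear with
      | h0 => simp
      | hadd f f' hf hf' => simp [add_mul, hf, hf']
      | hT c α =>
        induction g using QTorus.induction_linear with
        | h0 => simp
        | hadd g g' hg hg' => simp only [mul_add, map_add, hg, hg']
        | hT d β =>
          simp only [smul_mul_assoc, mul_smul_comm, QTorus.T_mul, map_smul, QTorus.lin_T, h,
            map_add])

theorem QTorus.map_T {Γ Γ' : Type*} [AddCommGroup Γ] [AddCommGroup Γ'] (q : Kˣ) {b : Γ →+ Γ →+ ℤ}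
    {b' : Γ' →+ Γ' →+ ℤ} (φ : Γ →+ Γ') (h : ∀ α β, b' (φ α) (φ β) = b α β) (α : Γ) :
    QTorus.map q φ h (QTorus.T q b α) = QTorus.T q b' (φ α) :=
  QTorus.lin_T _ _

theorem QTorus.mul_fromLaurent {Γ : Type*} [AddCommGroup Γ] {q : Kˣ} {b : Γ →+ Γ →+ ℤ} {s : ℕ}
    (D : QTorus.RadicalChart b s) (z : LaurentRing K s) (g : QTorus q b) :
    g * QTorus.fromLaurent D q z = QTorus.fromLaurent D q z * g := by
  induction g using QTorus.induction_linear with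
  | h0 => simp
  | hadd f g hf hg => rw [add_mul, hf, hg, mul_add]
  | hT c β =>
    have : (LinearMap.mulLeft K (QTorus.T q b β)) ∘ₗ (QTorus.fromLaurent D q).toLinearMap
        = (LinearMap.mulRight K (QTorus.T q b β)) ∘ₗ (QTorus.fromLaurent D q).toLinearMap :=
      QTorus.laurent_hom_ext fun n => by
        have h := (D.mem_range _).1 ⟨n, rfl⟩ β
        simp only [LinearMap.comp_apply, AlgHom.toLinearMap_apply, QTorus.fromLaurent_monomial,
          LinearMap.mulLeft_apply, LinearMap.mulRight_apply, mul_smul_comm, smul_mul_assoc]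
        rw [QTorus.T_mul_comm, h, sub_self]; simp
    have h2 := LinearMap.congr_fun this z
    simp only [LinearMap.comp_apply, AlgHom.toLinearMap_apply, LinearMap.mulLeft_apply,
      LinearMap.mulRight_apply] at h2
    rw [smul_mul_assoc, h2, mul_smul_comm]

/-- Extension of exponents by zero. -/
def extendExponent (w : Finset (Fin m × Fin p)) :
    Exponent w →+ Exponent (∅ : Finset (Fin m × Fin p)) where
  toFun α a := if h : a.1 ∉ w then α ⟨a.1, h⟩ else 0
  map_zero' := by ext a; simp
  map_add' α β := by
    ext a
    simp only [Pi.add_apply]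
    split_ifs <;> simp

theorem torusForm_extendExponent (w : Finset (Fin m × Fin p)) (α β : Exponent w) :
    torusForm ∅ (extendExponent w α) (extendExponent w β) = torusForm w α β := by
  have hinj : Function.Injective fun a : {a : Fin m × Fin p // a ∉ w} =>
      (⟨a.1, Finset.notMem_empty _⟩ : {a : Fin m × Fin p // a ∉ (∅ : Finset _)}) :=
    fun a c h => Subtype.ext (congrArg (fun x => x.1) h)
  have hext : ∀ (γ : Exponent w) (a : {a // a ∉ (∅ : Finset (Fin m × Fin p))}),
      a ∉ Set.range (fun a : {a : Fin m × Fin p // a ∉ w} =>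
        (⟨a.1, Finset.notMem_empty _⟩ : {a : Fin m × Fin p // a ∉ (∅ : Finset _)})) →
      extendExponent w γ a = 0 := fun γ a ha => dif_neg fun h => ha ⟨⟨a.1, h⟩, rfl⟩
  have hval : ∀ (γ : Exponent w) (a : {a : Fin m × Fin p // a ∉ w}),
      extendExponent w γ ⟨a.1, Finset.notMem_empty _⟩ = γ a := fun γ a => dif_pos a.2
  rw [torusForm_apply, torusForm_apply]
  refine (Fintype.sum_of_injective _ hinj _ _ (fun a ha => ?_) fun a => ?_).symm
  · simp [hext α a ha]
  · refine Fintype.sum_of_injective _ hinj _ _ (fun c hc => ?_) fun c => ?_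
    · simp [hext β c hc]
    · simp only [hval]

/-- The pivot at position `0` has nothing north-west of it, so restoring it has no effect. The
algorithm ends at stage `1`, or at stage `0` if there are no indices. -/
theorem restored_of_le_one (q : Kˣ) (w : Finset (Fin m × Fin p)) {N : ℕ} (hN : N ≤ 1) :
    restored q w N = torusGen q w := by
  funext b
  refine restored_eq_torusGen q w ?_
  have h1 : 0 < p := b.2.pos
  have := Nat.mul_le_mul_right ((b.1 : ℕ) + 1) h1
  omega

section Final

variable {q : Kˣ} {N : ℕ} {I : TwoSidedIdeal (FreeAlgebra K (Fin m × Fin p))}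
  {w : Finset (Fin m × Fin p)}

/-- A relation in the quantum torus attached to `w` holds modulo every ideal of the final algebra
that contains the generators with index in `w`. -/
theorem StageIdeal.mem_of_lift_torusGen (hI : StageIdeal q N I) (hN : N ≤ 1)
    (hw : ∀ b ∈ w, FreeAlgebra.ι K b ∈ I) {f : FreeAlgebra K (Fin m × Fin p)}
    (hf : FreeAlgebra.lift K (torusGen q w) f = 0) : f ∈ I := by
  classical
  -- `π` sets the generators in `w` to zero and is the identity modulo `I`. Extending exponents by
  -- zero maps the torus of `w` to the full torus, where the relation after `π` can be read off.
  let π : FreeAlgebra K (Fin m × Fin p) →ₐ[K] FreeAlgebra K (Fin m × Fin p) :=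
    FreeAlgebra.lift K fun b => if b ∈ w then 0 else FreeAlgebra.ι K b
  have h1 : (freeProj I).comp π = freeProj I := by
    ext b
    by_cases hb : b ∈ w
    · simp [π, hb, freeProj_eq_zero.2 (hw b hb)]
    · simp [π, hb]
  have h2 : (QTorus.map q (extendExponent w) (torusForm_extendExponent w)).comp
      (FreeAlgebra.lift K (torusGen q w))
      = (FreeAlgebra.lift K (restored q ∅ N)).comp π := by
    ext b
    by_cases hb : b ∈ w
    · simp [π, hb, torusGen_of_mem]
    · simp only [Function.comp_apply, AlgHom.comp_apply, FreeAlgebra.lift_ι_apply, π, hb, if_false,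
        restored_of_le_one q ∅ hN, torusGen_of_notMem hb, QTorus.map_T,
        torusGen_of_notMem (Finset.notMem_empty b)]
      congr 1
      ext a
      by_cases hab : a.1 = b
      · obtain ⟨a, ha⟩ := a
        simp only at hab
        subst hab
        simp [extendExponent, hb]
      · rw [Pi.single_eq_of_ne (by rintro rfl; exact hab rfl)]
        simp only [extendExponent, AddMonoidHom.coe_mk, ZeroHom.coe_mk]
        split_ifs with ha
        · rfl
        · rw [Pi.single_eq_of_ne (fun e => hab (congrArg Subtype.val e))]
  have h3 := DFunLike.congr_fun h2 f
  simp only [AlgHom.comp_apply, hf, map_zero] at h3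
  rw [← freeProj_eq_zero, ← h1, AlgHom.comp_apply, freeProj_eq_zero]
  exact hI.ker _ h3.symm

/-- The monomials in the generators with index outside of `w`. -/
def freeMonomials (K : Type u) [Field K] (w : Finset (Fin m × Fin p)) :
    Submonoid (FreeAlgebra K (Fin m × Fin p)) :=
  Submonoid.closure {x | ∃ b ∉ w, x = FreeAlgebra.ι K b}

theorem lift_torusGen_mul (f : FreeAlgebra K (Fin m × Fin p)) (a : Fin m × Fin p) :
    FreeAlgebra.lift K (torusGen q w) f * torusGen q w a
      = torusGen q w a * FreeAlgebra.lift K (torusGen q w) (PivotSetting.scaling q a f) := by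
  induction f with
  | grade0 r => simp only [AlgHom.commutes]; exact Algebra.commutes _ _
  | grade1 b => simp [PivotSetting.scaling, torusGen_mul_comm q w b a]
  | add f g hf hg => simp only [map_add, add_mul, mul_add, hf, hg]
  | mul f g hf hg => rw [map_mul, mul_assoc, hg, ← mul_assoc, hf, mul_assoc, map_mul, map_mul]

theorem scaling_freeMonomials (q : Kˣ) (a : Fin m × Fin p) {s : FreeAlgebra K (Fin m × Fin p)}
    (hs : s ∈ freeMonomials K w) : ∃ c : K, c ≠ 0 ∧ PivotSetting.scaling q a s = c • s := by
  induction hs using Submonoid.closure_induction with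
  | mem x hx =>
    obtain ⟨b, -, rfl⟩ := hx
    exact ⟨_, Units.ne_zero _, scaling_ι q a b⟩
  | one => exact ⟨1, one_ne_zero, by simp⟩
  | mul x y _ _ hx hy =>
    obtain ⟨c, hc, hx⟩ := hx
    obtain ⟨d, hd, hy⟩ := hy
    exact ⟨c * d, mul_ne_zero hc hd, by
      rw [map_mul, hx, hy, smul_mul_assoc, mul_smul_comm, smul_smul]⟩

theorem isUnit_lift_freeMonomials {s : FreeAlgebra K (Fin m × Fin p)} (hs : s ∈ freeMonomials K w) :
    IsUnit (FreeAlgebra.lift K (torusGen q w) s) := by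
  induction hs using Submonoid.closure_induction with
  | mem x hx =>
    obtain ⟨b, hb, rfl⟩ := hx
    rw [FreeAlgebra.lift_ι_apply]; exact isUnit_torusGen hb
  | one => simp
  | mul x y _ _ hx hy => rw [map_mul]; exact hx.mul hy

/-- Monomials are normal elements. -/
theorem exists_lift_mul_freeMonomials (q : Kˣ) {s : FreeAlgebra K (Fin m × Fin p)}
    (hs : s ∈ freeMonomials K w) (f : FreeAlgebra K (Fin m × Fin p)) : ∃ g,
      FreeAlgebra.lift K (torusGen q w) f * FreeAlgebra.lift K (torusGen q w) s
        = FreeAlgebra.lift K (torusGen q w) s * FreeAlgebra.lift K (torusGen q w) g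
      ∧ (f ∈ freeMonomials K w → ∃ c : K, g = c • f) := by
  induction hs using Submonoid.closure_induction generalizing f with
  | mem x hx =>
    obtain ⟨b, -, rfl⟩ := hx
    refine ⟨PivotSetting.scaling q b f, by rw [FreeAlgebra.lift_ι_apply, lift_torusGen_mul],
      fun hf => ?_⟩
    obtain ⟨c, -, h⟩ := scaling_freeMonomials q b hf
    exact ⟨c, h⟩
  | one => exact ⟨f, by simp, fun _ => ⟨1, by simp⟩⟩
  | mul x y _ _ hx hy =>
    obtain ⟨g, hg, hg'⟩ := hx f
    by_cases hf : f ∈ freeMonomials K w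
    · obtain ⟨c, rfl⟩ := hg' hf
      obtain ⟨g', e, h'⟩ := hy f
      obtain ⟨d, rfl⟩ := h' hf
      refine ⟨(c * d) • f, ?_, fun _ => ⟨_, rfl⟩⟩
      rw [map_mul, ← mul_assoc, hg, mul_assoc, map_smul, smul_mul_assoc, e]
      simp only [map_smul, mul_smul_comm, smul_smul, mul_assoc]
    · obtain ⟨g', hg', -⟩ := hy g
      exact ⟨g', by rw [map_mul, ← mul_assoc, hg, mul_assoc, hg', mul_assoc],
        fun h => absurd h hf⟩

/-- Every element of the quantum torus is a right fraction with a monomial as denominator. -/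
theorem exists_mul_lift_torusGen (q : Kˣ) (z : DiagramTorus q w) : ∃ s ∈ freeMonomials K w, ∃ f,
    z * FreeAlgebra.lift K (torusGen q w) s = FreeAlgebra.lift K (torusGen q w) f := by
  let A : Set (DiagramTorus q w) := {z | ∃ s ∈ freeMonomials K w, ∃ f,
    z * FreeAlgebra.lift K (torusGen q w) s = FreeAlgebra.lift K (torusGen q w) f}
  have hmul : ∀ z ∈ A, ∀ z' ∈ A, z * z' ∈ A := by
    rintro z ⟨s, hs, f, e⟩ z' ⟨s', hs', f', e'⟩
    obtain ⟨g, hg, -⟩ := exists_lift_mul_freeMonomials q hs f'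
    exact ⟨s' * s, mul_mem hs' hs, f * g, by
      rw [map_mul, mul_assoc, ← mul_assoc z', e', hg, ← mul_assoc, e, map_mul]⟩
  have hadd : ∀ z ∈ A, ∀ z' ∈ A, z + z' ∈ A := by
    rintro z ⟨s, hs, f, e⟩ z' ⟨s', hs', f', e'⟩
    obtain ⟨g, hg, hg'⟩ := exists_lift_mul_freeMonomials q hs' s
    obtain ⟨c, rfl⟩ := hg' hs
    refine ⟨s * s', mul_mem hs hs', f * s' + c • (f' * s), ?_⟩
    rw [add_mul, map_add, map_mul, ← mul_assoc, e, map_mul, hg, map_smul, mul_smul_comm,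
      mul_smul_comm, ← mul_assoc, e', map_smul, map_mul]
  have hsmul : ∀ c : K, ∀ z ∈ A, c • z ∈ A := by
    rintro c z ⟨s, hs, f, e⟩
    exact ⟨s, hs, c • f, by rw [smul_mul_assoc, e, map_smul]⟩
  -- Exponents that are attained together with their negatives form a subgroup containing the unit
  -- vectors.
  let S : AddSubgroup (Exponent w) :=
    { carrier := {α | QTorus.T q (torusForm w) α ∈ A ∧ QTorus.T q (torusForm w) (-α) ∈ A}
      zero_mem' := by
        simp only [Set.mem_ofPred_eq, neg_zero, and_self]
        exact ⟨1, one_mem _, 1, by simp [QTorus.T_zero]⟩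
      add_mem' := by
        have key : ∀ α β, QTorus.T q (torusForm w) α ∈ A → QTorus.T q (torusForm w) β ∈ A →
            QTorus.T q (torusForm w) (α + β) ∈ A := fun α β hα hβ => by
          have := hsmul ((q ^ torusForm w α β : Kˣ)⁻¹ : Kˣ) _ (hmul _ hα _ hβ)
          rwa [QTorus.T_mul, smul_smul, Units.inv_mul, one_smul] at this
        rintro α β ⟨h1, h2⟩ ⟨h3, h4⟩
        exact ⟨key _ _ h1 h3, by rw [neg_add]; exact key _ _ h2 h4⟩
      neg_mem' := by rintro α ⟨h1, h2⟩; exact ⟨h2, by rwa [neg_neg]⟩ }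
  have hS : ∀ α, α ∈ S := by
    intro α
    rw [← Finset.univ_sum_single α]
    refine sum_mem fun a _ => ?_
    rw [show Pi.single a (α a) = α a • (Pi.single a 1 : Exponent w) by
      rw [← Pi.single_smul, smul_eq_mul, mul_one]]
    have ha : (Pi.single a 1 : Exponent w) ∈ S := by
      refine ⟨⟨1, one_mem _, FreeAlgebra.ι K a.1, ?_⟩, FreeAlgebra.ι K a.1,
        Submonoid.subset_closure ⟨a.1, a.2, rfl⟩,
        algebraMap K _ ((q ^ torusForm w (-Pi.single a 1) (Pi.single a 1) : Kˣ) : K), ?_⟩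
      · simp [torusGen_of_notMem a.2]
      · rw [FreeAlgebra.lift_ι_apply, torusGen_of_notMem a.2, QTorus.T_mul, neg_add_cancel,
          QTorus.T_zero, AlgHom.commutes, Algebra.algebraMap_eq_smul_one]
    exact zsmul_mem ha _
  induction z using QTorus.induction_linear with
  | h0 => exact ⟨1, one_mem _, 0, by simp⟩
  | hadd f g hf hg => exact hadd _ hf _ hg
  | hT c α => exact hsmul c _ (hS α).1

variable (hI : StageIdeal q N I) (hN : N ≤ 1) (hw : ∀ b, FreeAlgebra.ι K b ∈ I ↔ b ∈ w)

include hI hN hw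

theorem StageIdeal.mem_congr_torusGen {f g : FreeAlgebra K (Fin m × Fin p)}
    (e : FreeAlgebra.lift K (torusGen q w) f = FreeAlgebra.lift K (torusGen q w) g) :
    f ∈ I ↔ g ∈ I := by
  have h1 : f - g ∈ I := hI.mem_of_lift_torusGen hN (fun b hb => (hw b).2 hb)
    (by rw [map_sub, e, sub_self])
  constructor
  · intro hf; simpa using I.sub_mem hf h1
  · intro hg; simpa using I.add_mem h1 hg

/-- The generators outside of `w` are normal modulo `I`, and a normal element outside of a prime
ideal is regular modulo it. -/
theorem StageIdeal.freeMonomials_regular {s : FreeAlgebra K (Fin m × Fin p)}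
    (hs : s ∈ freeMonomials K w) (g : FreeAlgebra K (Fin m × Fin p)) :
    (s * g ∈ I ↔ g ∈ I) ∧ (g * s ∈ I ↔ g ∈ I) := by
  induction hs using Submonoid.closure_induction generalizing g with
  | one => simp
  | mul x y _ _ hx hy =>
    rw [mul_assoc, (hx _).1, (hy _).1, ← mul_assoc, (hy _).2, (hx _).2]
    exact ⟨Iff.rfl, Iff.rfl⟩
  | mem x hx =>
    obtain ⟨b, hb, rfl⟩ := hx
    have hb' : FreeAlgebra.ι K b ∉ I := fun h => hb ((hw b).1 h)
    refine ⟨⟨fun hg => (hI.prime.2 _ _ fun r => ?_).resolve_left hb', I.mul_mem_left _ _⟩,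
      ⟨fun hg => (hI.prime.2 _ _ fun r => ?_).resolve_right hb', I.mul_mem_right _ _⟩⟩
    · obtain ⟨r, rfl⟩ : ∃ r', PivotSetting.scaling q b r' = r :=
        ⟨PivotSetting.scaling q⁻¹ b r, by
          have := scaling_inv_scaling q⁻¹ b r
          rwa [inv_inv] at this⟩
      rw [← hI.mem_congr_torusGen hN hw (f := r * FreeAlgebra.ι K b * g)]
      · rw [mul_assoc]; exact I.mul_mem_left _ _ hg
      · simp only [map_mul, FreeAlgebra.lift_ι_apply, lift_torusGen_mul]
    · rw [hI.mem_congr_torusGen hN hw (g := g * (FreeAlgebra.ι K b * PivotSetting.scaling q b r))]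
      · rw [← mul_assoc]; exact I.mul_mem_right _ _ hg
      · simp only [map_mul, FreeAlgebra.lift_ι_apply, mul_assoc, lift_torusGen_mul]

/-- The extension of an ideal of the final algebra to the quantum torus. -/
def torusIdeal : Ideal (DiagramTorus q w) where
  carrier := {z | ∃ s ∈ freeMonomials K w, ∃ f ∈ I,
    z * FreeAlgebra.lift K (torusGen q w) s = FreeAlgebra.lift K (torusGen q w) f}
  zero_mem' := ⟨1, one_mem _, 0, I.zero_mem, by simp⟩
  add_mem' := by
    rintro z z' ⟨s, hs, f, hf, e⟩ ⟨s', hs', f', hf', e'⟩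
    obtain ⟨g, hg, hg'⟩ := exists_lift_mul_freeMonomials q hs' s
    obtain ⟨c, rfl⟩ := hg' hs
    refine ⟨s * s', mul_mem hs hs', f * s' + f' * (c • s),
      I.add_mem (I.mul_mem_right _ _ hf) (I.mul_mem_right _ _ hf'), ?_⟩
    rw [add_mul, map_add, map_mul, ← mul_assoc, e, map_mul, hg, ← mul_assoc, e', map_mul]
  smul_mem' := by
    rintro g z ⟨s, hs, f, hf, e⟩
    obtain ⟨s', hs', f', e'⟩ := exists_mul_lift_torusGen q g
    obtain ⟨f'', h'', -⟩ := exists_lift_mul_freeMonomials q hs' f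
    refine ⟨s * s', mul_mem hs hs', f' * f'', I.mul_mem_left _ _ ?_, ?_⟩
    · rw [← (hI.freeMonomials_regular hN hw hs' f'').1,
        ← hI.mem_congr_torusGen hN hw (f := f * s') (by simp only [map_mul, h''])]
      exact I.mul_mem_right _ _ hf
    · rw [map_mul, smul_eq_mul, mul_assoc, ← mul_assoc z, e, h'', ← mul_assoc, e', map_mul]

theorem mem_torusIdeal_of_eq {z : DiagramTorus q w} {s f : FreeAlgebra K (Fin m × Fin p)}
    (hs : s ∈ freeMonomials K w)
    (e : z * FreeAlgebra.lift K (torusGen q w) s = FreeAlgebra.lift K (torusGen q w) f) :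
    z ∈ torusIdeal hI hN hw ↔ f ∈ I := by
  refine ⟨?_, fun hf => ⟨s, hs, f, hf, e⟩⟩
  rintro ⟨s', hs', f', hf', e'⟩
  obtain ⟨g, hg, hg'⟩ := exists_lift_mul_freeMonomials q hs' s
  obtain ⟨c, rfl⟩ := hg' hs
  rw [← (hI.freeMonomials_regular hN hw hs' f).2,
    hI.mem_congr_torusGen hN hw (g := f' * (c • s))]
  · exact I.mul_mem_right _ _ hf'
  · rw [map_mul, ← e, mul_assoc, hg, ← mul_assoc, e', map_mul]

theorem lift_mem_torusIdeal (f : FreeAlgebra K (Fin m × Fin p)) :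
    FreeAlgebra.lift K (torusGen q w) f ∈ torusIdeal hI hN hw ↔ f ∈ I :=
  mem_torusIdeal_of_eq hI hN hw (one_mem _) (by simp)

theorem mul_mem_torusIdeal {z : DiagramTorus q w} (hz : z ∈ torusIdeal hI hN hw)
    (g : DiagramTorus q w) : z * g ∈ torusIdeal hI hN hw := by
  obtain ⟨s, hs, f, hf, e⟩ := hz
  obtain ⟨x, hx⟩ := isUnit_lift_freeMonomials (q := q) hs
  obtain ⟨s', hs', f', e'⟩ := exists_mul_lift_torusGen q (x⁻¹.val * g)
  refine ⟨s', hs', f * f', I.mul_mem_right _ _ hf, ?_⟩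
  rw [map_mul, ← e, ← e', ← hx, mul_assoc z x.val, mul_assoc (x⁻¹).val, Units.mul_inv_cancel_left, mul_assoc]

/-- The ideal of the quantum torus is induced from a prime ideal of the center, provided that it is
stable under diagonal operators that detect the center. -/
theorem exists_torusIdeal_eq_induced {s : ℕ} (D : QTorus.RadicalChart (torusForm w) s) {ι : Type*}
    (μ : ι → Exponent w → K)
    (hQ : ∀ j, ∀ f ∈ torusIdeal hI hN hw,
      QTorus.lin (fun α => μ j α • QTorus.T q _ α) f ∈ torusIdeal hI hN hw)
    (h0 : ∀ j, ∀ γ ∈ Set.range D.emb, μ j γ = μ j 0)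
    (hsep : ∀ γ ∉ Set.range D.emb, ∃ j, μ j γ ≠ μ j 0) :
    ∃ 𝔭 : PrimeSpectrum (LaurentRing K s),
      torusIdeal hI hN hw = QTorus.induced D 𝔭.asIdeal := by
  let Q := torusIdeal hI hN hw
  have hind : Q = QTorus.induced D (Q.comap (QTorus.fromLaurent D q)) := by
    refine QTorus.eq_induced_of_projection_mem fun f hf => ?_
    exact QTorus.projection_mem (Q := Q.restrictScalars K) μ hQ h0 hsep hf
  refine ⟨⟨Q.comap (QTorus.fromLaurent D q), ⟨?_, fun {y z} hyz => ?_⟩⟩, hind⟩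
  · rw [Ideal.ne_top_iff_one, Ideal.mem_comap, map_one]
    intro h1
    rw [← map_one (FreeAlgebra.lift K (torusGen q w)), lift_mem_torusIdeal] at h1
    exact hI.prime.1 h1
  · rw [Ideal.mem_comap, map_mul] at hyz
    obtain ⟨s₁, hs₁, f₁, e₁⟩ := exists_mul_lift_torusGen q (QTorus.fromLaurent D q y)
    obtain ⟨s₂, hs₂, f₂, e₂⟩ := exists_mul_lift_torusGen q (QTorus.fromLaurent D q z)
    rw [Ideal.mem_comap, Ideal.mem_comap, mem_torusIdeal_of_eq hI hN hw hs₁ e₁,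
      mem_torusIdeal_of_eq hI hN hw hs₂ e₂]
    -- Since `z` is central, the image of `f₁ * r * f₂` is the product `y * z` times an element of
    -- the torus.
    refine hI.prime.2 _ _ fun r => ?_
    have h := mul_mem_torusIdeal hI hN hw hyz (FreeAlgebra.lift K (torusGen q w) s₁ *
      FreeAlgebra.lift K (torusGen q w) r * FreeAlgebra.lift K (torusGen q w) s₂)
    rw [← lift_mem_torusIdeal hI hN hw, map_mul, map_mul, ← e₁, ← e₂]
    convert h using 1
    simp only [← mul_assoc]
    congr 1
    rw [mul_assoc (QTorus.fromLaurent D q y), mul_assoc (QTorus.fromLaurent D q y),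
      QTorus.mul_fromLaurent]
    simp only [mul_assoc]

end Final

end

end DeletingDerivations

namespace DeletingDerivations

noncomputable section

/-! ## Classification of chains -/

universe u

variable {m p : ℕ} {K : Type u} [Field K]

theorem mem_range_emb_iff {w : Finset (Fin m × Fin p)} {s : ℕ}
    (D : QTorus.RadicalChart (torusForm w) s) (γ : Exponent w) :
    γ ∈ Set.range D.emb ↔ ∀ a : {a // a ∉ w}, ∑ c, lambdaInt a.1 c.1 * γ c = 0 := by
  rw [D.mem_range]
  constructor
  · intro h a
    rw [← torusForm_single_sub, h, sub_self]
  · intro h β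
    rw [eq_comm, ← sub_eq_zero, torusForm_sub]
    refine Finset.sum_eq_zero fun a _ => ?_
    rw [← mul_zero (β a), ← h a, Finset.mul_sum]
    exact Finset.sum_congr rfl fun c _ => by ring

theorem zpow_ne_one {q : Kˣ} (hq : ∀ n : ℕ, 0 < n → (q : K) ^ n ≠ 1) {n : ℤ} (hn : n ≠ 0) :
    ((q ^ n : Kˣ) : K) ≠ 1 := by
  have key : ∀ n : ℕ, 0 < n → q ^ n ≠ 1 := fun n h e => hq n h (by
    rw [← Units.val_pow_eq_pow_val, e, Units.val_one])
  rw [Ne, Units.val_eq_one]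
  obtain ⟨k, rfl | rfl⟩ := n.eq_nat_or_neg
  · rw [zpow_natCast]; exact key k (by omega)
  · rw [zpow_neg, inv_eq_one, zpow_natCast]; exact key k (by omega)

/-- For `q` not a root of unity, all prime ideals of the final algebra are induced from the center
of a quantum torus. -/
theorem exists_torusIdeal_eq_induced_of_not_root {q : Kˣ} (hq : ∀ n : ℕ, 0 < n → (q : K) ^ n ≠ 1)
    {N : ℕ} {I : TwoSidedIdeal (FreeAlgebra K (Fin m × Fin p))} {w : Finset (Fin m × Fin p)}
    (hI : StageIdeal q N I) (hN : N ≤ 1) (hw : ∀ b, FreeAlgebra.ι K b ∈ I ↔ b ∈ w) {s : ℕ}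
    (D : QTorus.RadicalChart (torusForm w) s) : ∃ 𝔭 : PrimeSpectrum (LaurentRing K s),
      torusIdeal hI hN hw = QTorus.induced D 𝔭.asIdeal := by
  refine exists_torusIdeal_eq_induced hI hN hw D
    (fun (a : {a // a ∉ w}) γ => ((q ^ (∑ c, lambdaInt a.1 c.1 * γ c) : Kˣ) : K))
    (fun a f hf => ?_) (fun a γ hγ => ?_) (fun γ hγ => ?_)
  -- The diagonal operator is conjugation by the generator with index `a`, which preserves two-sided
  -- ideals.
  · have h1 : QTorus.lin (fun α : Exponent w =>
        ((q ^ (∑ c, lambdaInt a.1 c.1 * α c) : Kˣ) : K) • QTorus.T q (torusForm w) α) f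
        = QTorus.T q (torusForm w) (Pi.single a 1) * f
          * (QTorus.Tunit q (torusForm w) (Pi.single a 1))⁻¹.val := by
      clear hf
      induction f using QTorus.induction_linear with
      | h0 => simp
      | hadd f g hf hg => rw [map_add, hf, hg, mul_add, add_mul]
      | hT c α =>
        rw [map_smul, QTorus.lin_T, ← torusForm_single_sub, mul_smul_comm, QTorus.T_mul_comm,
          ← QTorus.val_Tunit (Pi.single a 1), smul_mul_assoc, smul_mul_assoc, Units.mul_inv_cancel_right]
    rw [h1]
    exact mul_mem_torusIdeal hI hN hw (Ideal.mul_mem_left _ _ hf) _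
  · rw [mem_range_emb_iff] at hγ
    simp [hγ a]
  · rw [mem_range_emb_iff] at hγ
    push Not at hγ
    obtain ⟨a, ha⟩ := hγ
    exact ⟨a, by simpa using zpow_ne_one hq ha⟩

/-- The ideal of the `N`-th algebra attached to an ideal of the center of a quantum torus. -/
def stageKernel {w : Finset (Fin m × Fin p)} {s : ℕ} (D : QTorus.RadicalChart (torusForm w) s)
    (q : Kˣ) (N : ℕ) (I : Ideal (LaurentRing K s)) :
    TwoSidedIdeal (FreeAlgebra K (Fin m × Fin p)) :=
  TwoSidedIdeal.mk' {f | FreeAlgebra.lift K (restored q w N) f ∈ QTorus.induced D I}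
    (by simp) (fun {f g} hf hg => by
      simp only [Set.mem_ofPred_eq, map_add] at hf hg ⊢; exact add_mem hf hg)
    (fun {f} hf => by simp only [Set.mem_ofPred_eq, map_neg] at hf ⊢; exact neg_mem hf)
    (fun {f g} hg => by
      simp only [Set.mem_ofPred_eq, map_mul] at hg ⊢; exact Ideal.mul_mem_left _ _ hg)
    (fun {f g} hf => by
      simp only [Set.mem_ofPred_eq, map_mul] at hf ⊢; exact QTorus.mul_mem_induced hf _)

theorem mem_stageKernel {w : Finset (Fin m × Fin p)} {s : ℕ}
    {D : QTorus.RadicalChart (torusForm w) s} {q : Kˣ} {N : ℕ} {I : Ideal (LaurentRing K s)}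
    {f : FreeAlgebra K (Fin m × Fin p)} : f ∈ stageKernel D q N I
      ↔ FreeAlgebra.lift K (restored q w N) f ∈ QTorus.induced D I := by
  rw [stageKernel, TwoSidedIdeal.mem_mk']; rfl

/-- Relations between fractions are inherited along with relations between generators. -/
theorem PivotSetting.fraction_eq_of_imp {q : Kˣ} {N : ℕ} {h : N < m * p} {B B' : Type u} [Ring B]
    [Algebra K B] [Ring B'] [Algebra K B'] {U : Fin m × Fin p → B} {U' : Fin m × Fin p → B'}
    (hU : PivotSetting q h U) (hU' : PivotSetting q h U')
    (himp : ∀ f, FreeAlgebra.lift K U f = 0 → FreeAlgebra.lift K U' f = 0)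
    {f g : FreeAlgebra K (Fin m × Fin p)} {M : ℕ}
    (e : FreeAlgebra.lift K (deleteStep (indexAt h) U) f * U (indexAt h) ^ M
      = FreeAlgebra.lift K U g) :
    FreeAlgebra.lift K (deleteStep (indexAt h) U') f * U' (indexAt h) ^ M
      = FreeAlgebra.lift K U' g := by
  obtain ⟨M₀, g₀, h₀⟩ := exists_lift_deleteStep_mul_pow q h f
  have h1 := h₀ _ _ hU
  have h2 := himp (g * FreeAlgebra.ι K (indexAt h) ^ M₀ - g₀ * FreeAlgebra.ι K (indexAt h) ^ M) (by
      simp only [map_sub, map_mul, map_pow, FreeAlgebra.lift_ι_apply, ← e, ← h1, mul_assoc,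
        ← pow_add, add_comm M, sub_self])
  simp only [map_sub, map_mul, map_pow, FreeAlgebra.lift_ι_apply, sub_eq_zero] at h2
  rw [← h₀ B' U' hU', mul_assoc, ← pow_add, add_comm, pow_add, ← mul_assoc] at h2
  exact ((hU'.unit.pow M₀).mul_right_cancel h2).symm

/-- Relations between fractions hold in every algebra if they hold in the full quantum torus. -/
theorem PivotSetting.fraction_eq {q : Kˣ} {N : ℕ} {h : N < m * p} {B : Type u} [Ring B]
    [Algebra K B] {U : Fin m × Fin p → B} (hU : PivotSetting q h U)
    {f g : FreeAlgebra K (Fin m × Fin p)} {M : ℕ}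
    (e : FreeAlgebra.lift K (restored q ∅ N) f * restored q ∅ (N + 1) (indexAt h) ^ M
      = FreeAlgebra.lift K (restored q ∅ (N + 1)) g) :
    FreeAlgebra.lift K (deleteStep (indexAt h) U) f * U (indexAt h) ^ M
      = FreeAlgebra.lift K U g :=
  (pivotSetting_full q h).fraction_eq_of_imp hU
    (fun _ hf => lift_eq_zero_of_lift_restored h hU.rel hf) (by rw [deleteStep_restored, e])

theorem restored_succ_pivot (q : Kˣ) (w : Finset (Fin m × Fin p)) {N : ℕ} (h : N < m * p) :
    restored q w (N + 1) (indexAt h) = torusGen q w (indexAt h) := by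
  rw [restored_succ h, restoreStep]
  simp [restored_pivot]

theorem torusGen_mem_induced_iff {q : Kˣ} {w : Finset (Fin m × Fin p)} {s : ℕ}
    {D : QTorus.RadicalChart (torusForm w) s} {I : Ideal (LaurentRing K s)} (hI : I ≠ ⊤)
    {b : Fin m × Fin p} : torusGen q w b ∈ QTorus.induced D I ↔ b ∈ w := by
  constructor
  · intro h
    by_contra hb
    have := Ideal.eq_top_of_isUnit_mem _ h (isUnit_torusGen hb)
    exact QTorus.one_notMem_induced (D := D) hI (this ▸ Submodule.mem_top)
  · intro hb; rw [torusGen_of_mem hb]; exact zero_mem _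

/-! ### Recovering a chain from its final ideal; Cauchon diagrams -/

section Ascent

variable {q : Kˣ} {w : Finset (Fin m × Fin p)} {s : ℕ} {D : QTorus.RadicalChart (torusForm w) s}
  {𝔭 : PrimeSpectrum (LaurentRing K s)}

theorem mul_unit_mem_induced {I : Ideal (LaurentRing K s)} {z x : DiagramTorus q w}
    (hx : IsUnit x) : z * x ∈ QTorus.induced D I ↔ z ∈ QTorus.induced D I := by
  refine ⟨fun h => ?_, fun h => QTorus.mul_mem_induced h x⟩
  obtain ⟨x, rfl⟩ := hx
  have := QTorus.mul_mem_induced h x⁻¹.val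
  rwa [Units.mul_inv_cancel_right] at this

theorem pivot_mem_stageKernel_succ {N : ℕ} (h : N < m * p) :
    FreeAlgebra.ι K (indexAt h) ∈ stageKernel D q (N + 1) 𝔭.asIdeal ↔ indexAt h ∈ w := by
  rw [mem_stageKernel, FreeAlgebra.lift_ι_apply, restored_succ_pivot,
    torusGen_mem_induced_iff 𝔭.isPrime.ne_top]

theorem pivot_mem_stageKernel {N : ℕ} (h : N < m * p) :
    FreeAlgebra.ι K (indexAt h) ∈ stageKernel D q N 𝔭.asIdeal ↔ indexAt h ∈ w := by
  rw [mem_stageKernel, FreeAlgebra.lift_ι_apply, restored_pivot,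
    torusGen_mem_induced_iff 𝔭.isPrime.ne_top]

theorem stageKernel_succ_of_mem {N : ℕ} (h : N < m * p) (ha : indexAt h ∈ w)
    (I : Ideal (LaurentRing K s)) : stageKernel D q (N + 1) I = stageKernel D q N I := by
  have : restored q w (N + 1) = restored q w N := by
    rw [restored_succ h, restoreStep_of_eq_zero]
    rw [restored_pivot, torusGen_of_mem ha]
  ext f
  rw [mem_stageKernel, mem_stageKernel, this]

theorem mem_stageKernel_of_fraction {N : ℕ} {h : N < m * p} (hw : IsCauchonBelow w (N + 1))
    (ha : indexAt h ∉ w) (I : Ideal (LaurentRing K s)) {f g : FreeAlgebra K (Fin m × Fin p)} {M : ℕ}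
    (e : FreeAlgebra.lift K (restored q ∅ N) f * restored q ∅ (N + 1) (indexAt h) ^ M
      = FreeAlgebra.lift K (restored q ∅ (N + 1)) g) :
    f ∈ stageKernel D q N I ↔ g ∈ stageKernel D q (N + 1) I := by
  have hS := pivotSetting_restored q hw h ha
  have h1 := hS.fraction_eq e
  rw [deleteStep_restored] at h1
  rw [mem_stageKernel, mem_stageKernel, ← h1, mul_unit_mem_induced (hS.unit.pow M)]

/-- The ideals attached to a prime ideal of the center form a chain. -/
theorem isNext_stageKernel {N : ℕ} (h : N < m * p) (hw : IsCauchonBelow w (N + 1)) :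
    IsNext q h (stageKernel D q (N + 1) 𝔭.asIdeal) (stageKernel D q N 𝔭.asIdeal) where
  of_mem ha := (stageKernel_succ_of_mem h ((pivot_mem_stageKernel_succ h).1 ha) _).symm
  of_notMem ha _ _ _ e :=
    mem_stageKernel_of_fraction hw (fun h' => ha ((pivot_mem_stageKernel_succ h).2 h')) _ e

theorem stageIdeal_stageKernel {N : ℕ} (hN : N ≤ m * p) (hw : IsCauchonBelow w N) :
    StageIdeal q N (stageKernel D q N 𝔭.asIdeal) where
  ker f hf := by
    rw [mem_stageKernel, lift_eq_zero_of_lift_restored hN (stageRel_restored q hw hN) hf]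
    exact zero_mem _
  prime := by
    refine ⟨fun h => ?_, fun a b hab => ?_⟩
    · rw [mem_stageKernel, map_one] at h
      exact QTorus.one_notMem_induced (D := D) 𝔭.isPrime.ne_top h
    · have := hab 1
      rw [mul_one, mem_stageKernel, map_mul] at this
      rw [mem_stageKernel, mem_stageKernel]
      exact QTorus.mem_or_mem_of_mul_mem_induced 𝔭.isPrime this

/-- Column entries above a pivot are not changed as long as the entries between them and the pivot
belong to `w`. -/
theorem restored_eq_torusGen_of_col {N : ℕ} (h : N < m * p) {i : Fin m}
    (hi : i < (indexAt h).1)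
    (hc : ∀ i' < (indexAt h).1, i < i' → (i', (indexAt h).2) ∈ w) :
    restored q w N (i, (indexAt h).2) = torusGen q w (i, (indexAt h).2) := by
  have : ∀ n ≤ N, ∀ i' < (indexAt h : Fin m × Fin p).1, i ≤ i' →
      restored q w n (i', (indexAt h).2) = torusGen q w (i', (indexAt h).2) := by
    intro n
    induction n with
    | zero => exact fun _ i hi _ => rfl
    | succ n ih =>
      intro hn i' hi' hle
      have hn' : n < m * p := by omega
      rw [restored_succ hn', restoreStep, ih (by omega) i' hi' hle]
      split_ifs with hcond
      · have hlt : (indexAt hn' : Fin m × Fin p).1 < (indexAt h : Fin m × Fin p).1 := by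
          have h1 : lexIndex (indexAt hn' : Fin m × Fin p)
              < lexIndex (indexAt h : Fin m × Fin p) := by
            rw [lexIndex_indexAt, lexIndex_indexAt]; omega
          rcases lexIndex_lt_iff.1 h1 with h2 | h2
          · exact h2
          · exact absurd h2.2 hcond.2.not_gt
        have hlt2 := hle.trans_lt hcond.1
        rw [ih (by omega) _ hlt hlt2.le, torusGen_of_mem (hc _ hlt hlt2), mul_zero, add_zero]
      · rfl
  exact this N le_rfl i hi le_rfl

/-- If an index left of the pivot is not in `w`, its entry is a unit, so by `hc` all column entries
above the pivot lie in the induced ideal. Proceeding upwards from the pivot, each of them is still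
an unmodified torus generator, hence its index is in `w`. -/
theorem isCauchonBelow_succ {N : ℕ} (h : N < m * p) (hw : IsCauchonBelow w N)
    (hc : indexAt h ∈ w → ∀ i < (indexAt h).1, ∀ j < (indexAt h).2,
      FreeAlgebra.ι K (i, (indexAt h).2) * FreeAlgebra.ι K ((indexAt h).1, j)
        ∈ stageKernel D q N 𝔭.asIdeal) : IsCauchonBelow w (N + 1) := by
  intro b hb hlt
  rcases (Nat.lt_succ_iff_lt_or_eq.1 hlt) with hlt | heq
  · exact hw b hb hlt
  obtain rfl : indexAt h = b := lexIndex_injective (by rw [lexIndex_indexAt, heq])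
  by_contra hcon
  push Not at hcon
  obtain ⟨⟨j, hj, hjw⟩, hiw⟩ := hcon
  have hcol : ∀ i < (indexAt h).1,
      restored q w N (i, (indexAt h).2) ∈ QTorus.induced D 𝔭.asIdeal := by
    intro i hi
    have h1 := hc hb i hi j hj
    rw [mem_stageKernel, map_mul, FreeAlgebra.lift_ι_apply, FreeAlgebra.lift_ι_apply,
      restored_row_of_pivot] at h1
    exact (mul_unit_mem_induced (isUnit_torusGen hjw)).1 h1
  have hall : ∀ n : ℕ, ∀ i < (indexAt h).1, (indexAt h).1.val - i.val = n →
      (i, (indexAt h).2) ∈ w := by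
    intro n
    induction n using Nat.strong_induction_on with
    | _ n ih =>
      intro i hi hn
      have h1 := hcol i hi
      rw [restored_eq_torusGen_of_col h hi, torusGen_mem_induced_iff 𝔭.isPrime.ne_top] at h1
      · exact h1
      · intro i' hi' hlt
        refine ih _ ?_ i' hi' rfl
        have h2 : (i : ℕ) < i' := hlt
        have h3 : (i' : ℕ) < (indexAt h : Fin m × Fin p).1 := hi'
        omega
  obtain ⟨i, hi, hi'⟩ := hiw
  exact hi' (hall _ i hi rfl)

/-- A chain of ideals is determined by its final ideal. -/
theorem chain_eq_stageKernel {G : ℕ → TwoSidedIdeal (FreeAlgebra K (Fin m × Fin p)) → Prop}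
    (hG : StageClass q G) {J : ℕ → TwoSidedIdeal (FreeAlgebra K (Fin m × Fin p))}
    (hJ : IsChain q G J) {N₀ : ℕ} (h0 : J N₀ = stageKernel D q N₀ 𝔭.asIdeal)
    (hw0 : IsCauchonBelow w N₀) {N : ℕ} (hN₀ : N₀ ≤ N) (hN : N ≤ m * p) :
    J N = stageKernel D q N 𝔭.asIdeal ∧ IsCauchonBelow w N := by
  induction N, hN₀ using Nat.le_induction with
  | base => exact ⟨h0, hw0⟩
  | succ N hle ih =>
    have h : N < m * p := hN
    obtain ⟨hJN, hwN⟩ := ih h.le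
    have hmem := hJ.mem (N + 1) hN
    have hreg := hG.regular h hmem
    have hnext := hJ.next N h
    by_cases ha : FreeAlgebra.ι K (indexAt h) ∈ J (N + 1)
    · have hJ' := hnext.of_mem ha
      have ha' : indexAt h ∈ w := by
        rw [← hJ', hJN, pivot_mem_stageKernel] at ha; exact ha
      refine ⟨by rw [← hJ', hJN, stageKernel_succ_of_mem h ha'], ?_⟩
      -- Pivot regularity puts the products of column and row entries into the ideal, which is what
      -- the diagram condition at this pivot requires.
      refine isCauchonBelow_succ (D := D) (q := q) (𝔭 := 𝔭) h hwN fun _ i hi j hj => ?_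
      rw [← hJN, hJ']
      exact hreg.corner ha i hi j hj
    · have hx : restored q (∅ : Finset (Fin m × Fin p)) N (indexAt h)
          = restored q ∅ (N + 1) (indexAt h) := by
        rw [restored_succ_pivot, restored_pivot]
      have ha' : indexAt h ∉ w := by
        have := hnext.of_notMem ha (FreeAlgebra.ι K (indexAt h)) 0 (FreeAlgebra.ι K (indexAt h))
          (by simp [hx])
        rw [hJN, pivot_mem_stageKernel] at this
        exact fun h' => ha (this.1 h')
      have hw' : IsCauchonBelow w (N + 1) :=
        isCauchonBelow_succ (D := D) (q := q) (𝔭 := 𝔭) h hwN fun h' => absurd h' ha'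
      refine ⟨?_, hw'⟩
      ext g
      -- Multiplying `g` by a high power of the pivot gives an element of the later algebra and does
      -- not affect membership; thus `J (N + 1)` can be recovered from `J N`.
      obtain ⟨M, f, hf⟩ := exists_lift_mul_pow q h g
      have e := hf _ _ (pivotSetting_full q h)
      rw [deleteStep_restored] at e
      have e' : FreeAlgebra.lift K (restored q ∅ N) f * restored q ∅ (N + 1) (indexAt h) ^ 0
          = FreeAlgebra.lift K (restored q ∅ (N + 1)) (g * FreeAlgebra.ι K (indexAt h) ^ M) := by
        rw [pow_zero, mul_one, ← e, map_mul, map_pow, FreeAlgebra.lift_ι_apply]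
      rw [← hreg.mul_pow_mem ha g M, ← hnext.of_notMem ha f 0 _ e', hJN,
        mem_stageKernel_of_fraction hw' ha' _ e', mem_stageKernel, mem_stageKernel, map_mul, map_pow,
        FreeAlgebra.lift_ι_apply,
        mul_unit_mem_induced ((pivotSetting_restored q hw' h ha').unit.pow M)]

end Ascent

end

end DeletingDerivations

namespace DeletingDerivations

noncomputable section

/-! ## The deleting derivations algorithm in rings of fractions -/

universe u

variable {m p : ℕ} {K : Type u} [Field K]

/-- A family in a ring of fractions with the same relations as the restored family of the full
quantum torus. -/
structure StageModel {L : Type u} [Ring L] [Algebra K L] (q : Kˣ) (N : ℕ)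
    (U : Fin m × Fin p → L) : Prop where
  zero_iff : ∀ f, FreeAlgebra.lift K U f = 0 ↔ FreeAlgebra.lift K (restored q ∅ N) f = 0
  isUnit : ∀ f, FreeAlgebra.lift K U f ≠ 0 → IsUnit (FreeAlgebra.lift K U f)

section StageModel

variable {L : Type u} [Ring L] [Algebra K L] {q : Kˣ} {N : ℕ} {U : Fin m × Fin p → L}

theorem StageModel.pivotSetting (h : N < m * p) (hU : StageModel q (N + 1) U) :
    PivotSetting q h U where
  rel := (stageRel_restored q (isCauchon_empty _) h).of_lift fun f hf => (hU.zero_iff f).2 hf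
  unit := by
    have h1 := hU.isUnit (FreeAlgebra.ι K (indexAt h)) fun h0 => by
      rw [hU.zero_iff, FreeAlgebra.lift_ι_apply] at h0
      exact (pivotSetting_full q h).unit.ne_zero h0
    rwa [FreeAlgebra.lift_ι_apply] at h1

/-- Both conditions pass through fractions, which have the same numerators and denominators in `L`
and in the full torus. -/
theorem StageModel.deleteStep (h : N < m * p) (hU : StageModel q (N + 1) U) :
    StageModel q N (deleteStep (indexAt h) U) := by
  have hS := hU.pivotSetting h
  have key : ∀ f, ∃ M g, FreeAlgebra.lift K (DeletingDerivations.restored q ∅ N) f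
      * restored q ∅ (N + 1) (indexAt h) ^ M = FreeAlgebra.lift K (restored q ∅ (N + 1)) g
      ∧ FreeAlgebra.lift K (_root_.deleteStep (indexAt h) U) f * U (indexAt h) ^ M
        = FreeAlgebra.lift K U g := fun f => by
    obtain ⟨M, g, hg⟩ := exists_lift_deleteStep_mul_pow q h f
    have h1 := hg _ _ (pivotSetting_full q h)
    rw [deleteStep_restored] at h1
    exact ⟨M, g, h1, hg _ _ hS⟩
  refine ⟨fun f => ?_, fun f hf => ?_⟩ <;> obtain ⟨M, g, h1, h2⟩ := key f
  · rw [← (hS.unit.pow M).mul_left_eq_zero, h2, hU.zero_iff, ← h1,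
      ((pivotSetting_full q h).unit.pow M).mul_left_eq_zero]
  · obtain ⟨x, hx⟩ := hS.unit.pow M
    rw [← hx] at h2
    have h3 := hU.isUnit g (by rw [← h2]; exact fun h0 => hf (x.isUnit.mul_left_eq_zero.1 h0))
    rw [← h2] at h3
    simpa using h3

variable {I I' : TwoSidedIdeal (FreeAlgebra K (Fin m × Fin p))}

theorem StageModel.lift_mem_image (hU : StageModel q N U) (hI : StageIdeal q N I)
    {f : FreeAlgebra K (Fin m × Fin p)} :
    FreeAlgebra.lift K U f ∈ FreeAlgebra.lift K U '' {f | f ∈ I} ↔ f ∈ I := by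
  refine ⟨fun ⟨g, hg, e⟩ => ?_, fun hf => ⟨f, hf, rfl⟩⟩
  refine (hI.mem_congr (f := g) ?_).1 hg
  rw [← sub_eq_zero, ← map_sub, ← hU.zero_iff, map_sub, e, sub_self]

/-- This links the set-level step inside `L` with `IsNext`, which is phrased in the full torus. If
the pivot lies in the ideal, both use the same polynomial expressions; otherwise identities between
fractions are transported between the two rings. -/
theorem StageModel.spectrumStep_image (h : N < m * p) (hU : StageModel q (N + 1) U)
    (hI : StageIdeal q (N + 1) I) (hn : IsNext q h I I') :
    spectrumStep K (indexAt h) U (_root_.deleteStep (indexAt h) U)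
        (FreeAlgebra.lift K U '' {f | f ∈ I})
      = FreeAlgebra.lift K (_root_.deleteStep (indexAt h) U) '' {f | f ∈ I'} := by
  have hS := hU.pivotSetting h
  have hpiv : U (indexAt h) ∈ FreeAlgebra.lift K U '' {f | f ∈ I}
      ↔ FreeAlgebra.ι K (indexAt h) ∈ I := by
    have := hU.lift_mem_image hI (f := FreeAlgebra.ι K (indexAt h))
    rwa [FreeAlgebra.lift_ι_apply] at this
  unfold spectrumStep
  split_ifs with ha
  · rw [hn.of_mem (hpiv.1 ha)]
    ext c
    constructor
    · rintro ⟨f, hf, rfl⟩; exact ⟨f, (hU.lift_mem_image hI).1 hf, rfl⟩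
    · rintro ⟨f, hf, rfl⟩; exact ⟨f, (hU.lift_mem_image hI).2 hf, rfl⟩
  · have hn' := hn.of_notMem fun h' => ha (hpiv.2 h')
    obtain ⟨x, hx⟩ := hS.unit
    have hinv : ∀ (c d : L) (n : ℕ), c = d * Ring.inverse (U (indexAt h)) ^ n
        ↔ c * U (indexAt h) ^ n = d := fun c d n => by
      rw [← hx, Ring.inverse_unit, ← Units.val_pow_eq_pow_val, ← Units.val_pow_eq_pow_val,
        inv_pow, Units.eq_mul_inv_iff_mul_eq]
    ext c
    constructor
    · rintro ⟨hc, _, ⟨g, hg, rfl⟩, n, e⟩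
      rw [Algebra.adjoin_range_eq_range_freeAlgebra_lift] at hc
      obtain ⟨f, rfl⟩ := hc
      rw [hinv] at e
      refine ⟨f, (hn' f n g ?_).2 hg, rfl⟩
      have := hS.fraction_eq_of_imp (pivotSetting_full q h) (fun f hf => (hU.zero_iff f).1 hf) e
      rwa [deleteStep_restored] at this
    · rintro ⟨f, hf, rfl⟩
      obtain ⟨M, g, hg⟩ := exists_lift_deleteStep_mul_pow q h f
      have h1 := hg _ _ (pivotSetting_full q h)
      rw [deleteStep_restored] at h1
      refine ⟨?_, FreeAlgebra.lift K U g, ⟨g, (hn' f M g h1).1 hf, rfl⟩, M, ?_⟩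
      · rw [Algebra.adjoin_range_eq_range_freeAlgebra_lift]; exact ⟨f, rfl⟩
      · rw [hinv]; exact hg _ _ hS

variable {X : Fin m × Fin p → L}

theorem pivot_eq_indexAt (t : Fin (m * p)) :
    pivot t = (indexAt (show m * p - (t + 1) < m * p by omega) : Fin m × Fin p) := by
  unfold pivot indexAt
  congr 1

theorem deletedGens_succ {t : ℕ} (ht : t < m * p) (X : Fin m × Fin p → L) :
    deletedGens X (t + 1) = _root_.deleteStep
      (indexAt (show m * p - (t + 1) < m * p by omega)) (deletedGens X t) := by
  rw [deletedGens, dif_pos ht, pivot_eq_indexAt]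

theorem StageModel.deletedGens (hX : StageModel q (m * p) X) {t : ℕ} (ht : t ≤ m * p) :
    StageModel q (m * p - t) (deletedGens X t) := by
  induction t with
  | zero => exact hX
  | succ t ih =>
    specialize ih (by omega)
    rw [deletedGens_succ ht]
    refine StageModel.deleteStep _ ?_
    rwa [show m * p - (t + 1) + 1 = m * p - t by omega]

theorem StageModel.spectrumSteps_image
    {G : ℕ → TwoSidedIdeal (FreeAlgebra K (Fin m × Fin p)) → Prop} (hG : StageClass q G)
    {J : ℕ → TwoSidedIdeal (FreeAlgebra K (Fin m × Fin p))} (hJ : IsChain q G J)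
    (hX : StageModel q (m * p) X) {t : ℕ} (ht : t ≤ m * p) :
    spectrumSteps K X (FreeAlgebra.lift K X '' {f | f ∈ J (m * p)}) t
      = FreeAlgebra.lift K (_root_.deletedGens X t) '' {f | f ∈ J (m * p - t)} := by
  induction t with
  | zero => rfl
  | succ t ih =>
    specialize ih (by omega)
    have ht' : t < m * p := ht
    rw [spectrumSteps, dif_pos ht', ih, pivot_eq_indexAt, deletedGens_succ ht']
    have hU := hX.deletedGens (t := t) (by omega)
    have e : m * p - t = m * p - (t + 1) + 1 := by omega
    rw [e] at hU ⊢
    exact hU.spectrumStep_image _ (hG.stageIdeal (by omega) (hJ.mem _ (by omega))) (hJ.next _ _)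

/-- The stratum of a prime ideal can be read off from the final ideal of its chain. -/
theorem StageModel.finalGens_mem_iff
    {G : ℕ → TwoSidedIdeal (FreeAlgebra K (Fin m × Fin p)) → Prop} (hG : StageClass q G)
    {J : ℕ → TwoSidedIdeal (FreeAlgebra K (Fin m × Fin p))} (hJ : IsChain q G J)
    (hX : StageModel q (m * p) X) (b : Fin m × Fin p) :
    finalGens X b ∈ canonicalEmbedding K X (FreeAlgebra.lift K X '' {f | f ∈ J (m * p)})
      ↔ FreeAlgebra.ι K b ∈ J (m * p - (m * p - 1)) := by
  rw [canonicalEmbedding, finalGens, hX.spectrumSteps_image hG hJ (Nat.sub_le _ _)]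
  have := (hX.deletedGens (Nat.sub_le (m * p) 1)).lift_mem_image
    (hG.stageIdeal (Nat.sub_le _ _) (hJ.mem _ (Nat.sub_le _ _))) (f := FreeAlgebra.ι K b)
  rwa [FreeAlgebra.lift_ι_apply] at this

end StageModel

end

end DeletingDerivations

namespace DeletingDerivations

noncomputable section

/-! ## The center of the quantum tori -/

universe u

variable {m p : ℕ}

/-- The lattice of exponents of central monomials. -/
def radicalLattice (w : Finset (Fin m × Fin p)) : Submodule ℤ (Exponent w) where
  carrier := {γ | ∀ a : {a // a ∉ w}, ∑ c, lambdaInt a.1 c.1 * γ c = 0}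
  zero_mem' := by simp
  add_mem' := fun {γ δ} hγ hδ a => by
    simp only [Pi.add_apply, mul_add, Finset.sum_add_distrib, hγ a, hδ a, add_zero]
  smul_mem' := fun n γ hγ a => by
    simp only [Pi.smul_apply, smul_eq_mul, mul_left_comm _ n, ← Finset.mul_sum, hγ a, mul_zero]

theorem mem_radicalLattice {w : Finset (Fin m × Fin p)} {γ : Exponent w} :
    γ ∈ radicalLattice w ↔ ∀ a : {a // a ∉ w}, ∑ c, lambdaInt a.1 c.1 * γ c = 0 := Iff.rfl

theorem mem_radicalLattice_iff {w : Finset (Fin m × Fin p)} {γ : Exponent w} :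
    γ ∈ radicalLattice w ↔ ∀ β, torusForm w γ β = torusForm w β γ := by
  rw [mem_radicalLattice]
  constructor
  · intro h β
    rw [eq_comm, ← sub_eq_zero, torusForm_sub]
    refine Finset.sum_eq_zero fun a _ => ?_
    rw [← mul_zero (β a), ← h a, Finset.mul_sum]
    exact Finset.sum_congr rfl fun c _ => by ring
  · intro h a
    rw [← torusForm_single_sub, h, sub_self]

theorem mem_ker_diagramMatrix {w : Finset (Fin m × Fin p)} {v : {a // a ∉ w} → ℚ} :
    v ∈ LinearMap.ker (diagramMatrix w).mulVecLin
      ↔ ∀ a : {a // a ∉ w}, ∑ c, (lambdaInt a.1 c.1 : ℚ) * v c = 0 := by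
  rw [LinearMap.mem_ker, Matrix.mulVecLin_apply, funext_iff]
  refine forall_congr' fun a => ?_
  simp only [Matrix.mulVec, dotProduct, diagramMatrix, Matrix.submatrix_apply, lambdaMatrix_eq,
    Pi.zero_apply]

/-- The inclusion of the lattice into the kernel over the rational numbers. -/
def radicalLatticeToKer (w : Finset (Fin m × Fin p)) :
    radicalLattice w →ₗ[ℤ] LinearMap.ker (diagramMatrix w).mulVecLin where
  toFun γ := ⟨fun a => (γ.1 a : ℚ), by
    rw [mem_ker_diagramMatrix]
    intro a
    exact_mod_cast γ.2 a⟩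
  map_add' γ δ := by ext a; simp
  map_smul' n γ := by ext a; simp

/-- Rational solutions of an integral linear system become integral after clearing denominators, so
the rank of the lattice is the rational nullity. -/
theorem isLocalizedModule_radicalLatticeToKer (w : Finset (Fin m × Fin p)) :
    IsLocalizedModule (nonZeroDivisors ℤ) (radicalLatticeToKer w) where
  map_units n := by
    have hn : ((n : ℤ) : ℚ) ≠ 0 := by exact_mod_cast nonZeroDivisors.ne_zero n.2
    rw [Module.End.isUnit_iff]
    constructor
    · intro x y hxy
      simp only [Module.algebraMap_end_apply] at hxy
      ext a
      have := congrFun (congrArg Subtype.val hxy) a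
      simpa [nonZeroDivisors.ne_zero n.2] using this
    · intro y
      refine ⟨(((n : ℤ) : ℚ)⁻¹) • y, ?_⟩
      rw [Module.algebraMap_end_apply]
      ext a
      simp [hn]
  surj y := by
    obtain ⟨n, hn⟩ := IsLocalization.exist_integer_multiples_of_finite (nonZeroDivisors ℤ) y.1
    choose γ hγ using hn
    refine ⟨(⟨γ, fun a => ?_⟩, n), ?_⟩
    · have h1 := mem_ker_diagramMatrix.1 y.2 a
      have h2 : ∑ c, (lambdaInt a.1 c.1 : ℚ) * (γ c : ℚ) = 0 := by
        have h3 : ∀ c, (γ c : ℚ) = (n : ℤ) * y.1 c := fun c => by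
          have := hγ c
          simpa [Submonoid.smul_def] using this
        simp only [h3, mul_left_comm _ ((n : ℤ) : ℚ), ← Finset.mul_sum, h1, mul_zero]
      exact_mod_cast h2
    · ext a
      have := hγ a
      simp only [algebraMap_int_eq, eq_intCast] at this
      simp [radicalLatticeToKer, this, Submonoid.smul_def]
  exists_of_eq {x y} h := by
    refine ⟨1, ?_⟩
    congr 1
    ext a
    have := congrFun (congrArg Subtype.val h) a
    simpa [radicalLatticeToKer] using this

theorem finrank_radicalLattice (w : Finset (Fin m × Fin p)) :
    Module.finrank ℤ (radicalLattice w) = diagramNullity w := by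
  have := isLocalizedModule_radicalLatticeToKer w
  rw [diagramNullity, IsLocalization.finrank_eq ℚ (nonZeroDivisors ℤ) le_rfl,
    IsLocalizedModule.finrank_eq (nonZeroDivisors ℤ) (radicalLatticeToKer w) le_rfl]

/-- A symmetric bilinear form on `ℤ^s` is the polarization of an integral function. -/
theorem exists_polarization {s : ℕ} (B : (Fin s → ℤ) →+ (Fin s → ℤ) →+ ℤ)
    (hB : ∀ n n', B n n' = B n' n) :
    ∃ Q : (Fin s → ℤ) → ℤ, ∀ n n', Q (n + n') = Q n + Q n' + B n n' := by
  -- `ℓ` is additive and agrees with `B n n` on unit vectors, hence everywhere modulo `2`. Half of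
  -- `B n n - ℓ n` is therefore integral, and its polarization is `B`.
  let ℓ : (Fin s → ℤ) →+ ℤ :=
    ∑ i, (B (Pi.single i 1) (Pi.single i 1)) • Pi.evalAddMonoidHom (fun _ => ℤ) i
  have hℓ : ∀ i, ℓ (Pi.single i 1) = B (Pi.single i 1) (Pi.single i 1) := fun i => by
    simp only [ℓ, AddMonoidHom.finsetSum_apply, AddMonoidHom.smul_apply,
      Pi.evalAddMonoidHom_apply]
    rw [Finset.sum_eq_single i]
    · simp
    · intro j _ hj; simp [hj]
    · simp
  let S : AddSubgroup (Fin s → ℤ) :=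
    { carrier := {n | Even (B n n - ℓ n)}
      zero_mem' := by simp
      add_mem' := fun {n n'} hn hn' => by
        obtain ⟨x, hx⟩ := hn
        obtain ⟨y, hy⟩ := hn'
        refine ⟨x + y + B n n', ?_⟩
        simp only [map_add, AddMonoidHom.add_apply, hB n' n]
        linarith
      neg_mem' := fun {n} hn => by
        obtain ⟨x, hx⟩ := hn
        refine ⟨x + ℓ n, ?_⟩
        simp only [map_neg, AddMonoidHom.neg_apply]
        linarith }
  have hS : ∀ n, n ∈ S := by
    intro n
    rw [← Finset.univ_sum_single n]
    refine sum_mem fun i _ => ?_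
    rw [show Pi.single i (n i) = n i • (Pi.single i 1 : Fin s → ℤ) by
      rw [← Pi.single_smul, smul_eq_mul, mul_one]]
    have hi : (Pi.single i 1 : Fin s → ℤ) ∈ S := ⟨0, by rw [hℓ]; simp⟩
    exact zsmul_mem hi _
  choose Q hQ using fun n => hS n
  refine ⟨Q, fun n n' => ?_⟩
  have h1 := hQ n
  have h2 := hQ n'
  have h3 := hQ (n + n')
  simp only [map_add, AddMonoidHom.add_apply, hB n' n] at h3
  linarith

/-- The center of the quantum torus attached to `w` is a Laurent polynomial ring. -/
theorem nonempty_radicalChart (w : Finset (Fin m × Fin p)) :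
    Nonempty (QTorus.RadicalChart (torusForm w) (diagramNullity w)) := by
  let v := (Module.finBasis ℤ (radicalLattice w)).reindex
    (finCongr (finrank_radicalLattice w))
  let e : (Fin (diagramNullity w) → ℤ) →+ Exponent w :=
    (radicalLattice w).subtype.toAddMonoidHom.comp v.equivFun.symm.toLinearMap.toAddMonoidHom
  have he : ∀ n, e n ∈ radicalLattice w := fun n => (v.equivFun.symm n).2
  -- On the radical the cocycle is symmetric, so it can be trivialized by an integral function.
  obtain ⟨Q, hQ⟩ := exists_polarization
    (((torusForm w).compl₂ e).comp e)
    (fun n n' => mem_radicalLattice_iff.1 (he n) _)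
  refine ⟨⟨e, ?_, fun γ => ?_, Q, hQ⟩⟩
  · exact Subtype.val_injective.comp v.equivFun.symm.injective
  · rw [← mem_radicalLattice_iff]
    constructor
    · rintro ⟨n, rfl⟩; exact he n
    · intro hγ
      exact ⟨v.equivFun ⟨γ, hγ⟩, congrArg Subtype.val (v.equivFun.symm_apply_apply ⟨γ, hγ⟩)⟩

/-- A chart of the center of the quantum torus attached to `w`. -/
def radicalChart (w : Finset (Fin m × Fin p)) :
    QTorus.RadicalChart (torusForm w) (diagramNullity w) :=
  (nonempty_radicalChart w).some

theorem QTorus.induced_bot {K Γ : Type*} [Field K] [AddCommGroup Γ] {q : Kˣ} {b : Γ →+ Γ →+ ℤ}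
    {s : ℕ} (D : QTorus.RadicalChart b s) {f : QTorus q b}
    (hf : f ∈ QTorus.induced D (⊥ : Ideal (LaurentRing K s))) : f = 0 := by
  refine QTorus.coeff_injective (Finsupp.ext fun α => ?_)
  have h1 := hf (QTorus.Tunit q b α)⁻¹.val
  have h2 : QTorus.component D α f = 0 := by
    rw [QTorus.component, (Submodule.mem_bot _).1 h1, map_zero, mul_zero]
  have h3 := QTorus.coeff_component (D := D) α f α
  rw [h2, sub_self, if_pos ⟨0, map_zero _⟩] at h3
  exact h3.symm

/-- The zero ideal of the Laurent ring is prime and induces the zero ideal, so complete primeness of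
induced ideals says that the torus is a domain. -/
theorem DiagramTorus.mul_eq_zero {K : Type u} [Field K] {q : Kˣ} {w : Finset (Fin m × Fin p)}
    {f g : DiagramTorus q w} (h : f * g = 0) : f = 0 ∨ g = 0 := by
  have h1 : f * g ∈ QTorus.induced (radicalChart w)
    (⊥ : Ideal (LaurentRing K (diagramNullity w))) := by rw [h]; exact zero_mem _
  exact (QTorus.mem_or_mem_of_mul_mem_induced Ideal.isPrime_bot h1).imp
    (QTorus.induced_bot _) (QTorus.induced_bot _)

end

end DeletingDerivations

namespace DeletingDerivations

noncomputable section

/-! ## The skew field of fractions of quantum matrices -/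

universe u

variable {m p : ℕ} {K : Type u} [Field K]

section SkewFractions

variable (K) {R : Type*} [Ring R] [Algebra K R]

/-- The canonical map to the universal ring of fractions, as an algebra homomorphism. -/
def skewFractionsOf : R →ₐ[K] SkewFractions K R where
  toFun := SkewFractions.of K
  map_one' := by
    have := RingQuot.mkAlgHom_rel K (FractionsRel.scalar (R := R) (1 : K))
    simpa [SkewFractions.of] using this
  map_zero' := by
    have := RingQuot.mkAlgHom_rel K (FractionsRel.scalar (R := R) (0 : K))
    simpa [SkewFractions.of] using this
  map_add' r s := by
    have := RingQuot.mkAlgHom_rel K (FractionsRel.add (K := K) r s)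
    simpa [SkewFractions.of] using this
  map_mul' r s := by
    have := RingQuot.mkAlgHom_rel K (FractionsRel.mul (K := K) r s)
    simpa [SkewFractions.of] using this
  commutes' c := by
    have := RingQuot.mkAlgHom_rel K (FractionsRel.scalar (R := R) c)
    rwa [AlgHom.commutes] at this

theorem isUnit_skewFractionsOf {r : R} (hr : r ≠ 0) : IsUnit (skewFractionsOf K r) := by
  refine ⟨⟨_, RingQuot.mkAlgHom K (FractionsRel K R) (FreeAlgebra.ι K (Sum.inr ⟨r, hr⟩)), ?_, ?_⟩,
    rfl⟩
  · have := RingQuot.mkAlgHom_rel K (FractionsRel.mul_inv (K := K) ⟨r, hr⟩)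
    rwa [map_mul, map_one] at this
  · have := RingQuot.mkAlgHom_rel K (FractionsRel.inv_mul (K := K) ⟨r, hr⟩)
    rwa [map_mul, map_one] at this

/-- The ring of fractions of a left noetherian domain is not trivial. -/
theorem nontrivial_skewFractions [IsNoetherianRing R] [Nontrivial R] [NoZeroDivisors R] :
    Nontrivial (SkewFractions K R) := by
  have : IsDomain R := { }
  -- A noetherian domain is an Ore domain. The universal ring maps to its Ore localization, a
  -- division ring, and so cannot be trivial.
  obtain ⟨_⟩ := nonempty_oreSet_of_strongRankCondition (R := R)
  let ν : R →+* OreLocalization (nonZeroDivisors R) R := OreLocalization.numeratorRingHom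
  have hν : ∀ r : R, r ≠ 0 → ν r ≠ 0 := fun r hr h0 => by
    have hu : IsUnit (ν r) := OreLocalization.numerator_isUnit
      (⟨r, mem_nonZeroDivisors_of_ne_zero hr⟩ : nonZeroDivisors R)
    exact hu.ne_zero h0
  let g : R ⊕ {r : R // r ≠ 0} → OreLocalization (nonZeroDivisors R) R :=
    Sum.elim ν fun r => (ν r.1)⁻¹
  have hg : ∀ ⦃x y⦄, FractionsRel K R x y → FreeAlgebra.lift K g x = FreeAlgebra.lift K g y := by
    rintro _ _ (c | ⟨r, s⟩ | ⟨r, s⟩ | r | r)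
    · rw [FreeAlgebra.lift_ι_apply, AlgHom.commutes]; rfl
    · simp [g]
    · simp [g]
    · simp [g, mul_inv_cancel₀ (hν r.1 r.2)]
    · simp [g, inv_mul_cancel₀ (hν r.1 r.2)]
  exact (RingQuot.liftAlgHom K ⟨FreeAlgebra.lift K g, hg⟩).toRingHom.domain_nontrivial

theorem skewFractionsOf_eq_zero [IsNoetherianRing R] [Nontrivial R] [NoZeroDivisors R] {r : R} :
    skewFractionsOf K r = 0 ↔ r = 0 := by
  have := nontrivial_skewFractions K (R := R)
  refine ⟨fun h => ?_, fun h => by rw [h, map_zero]⟩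
  by_contra hr
  exact (isUnit_skewFractionsOf K hr).ne_zero h

end SkewFractions

theorem activeSet_full (b : Fin m × Fin p) : b ∈ activeSet m p (m * p) := lexIndex_lt b

section QuantumMatrices

variable {q : Kˣ}

/-- The presentation of the algebra of quantum matrices. -/
abbrev quantumProj (q : Kˣ) (m p : ℕ) :
    FreeAlgebra K (Fin m × Fin p) →ₐ[K] QuantumMatrices (q : K) m p :=
  RingQuot.mkAlgHom K (QuantumMatrixRel (q : K) m p)

theorem quantumProj_surjective : Function.Surjective (quantumProj q m p) :=
  RingQuot.mkAlgHom_surjective K _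

theorem stageRel_quantumProj :
    StageRel q (activeSet m p (m * p)) (quantumProj q m p ∘ FreeAlgebra.ι K) where
  col i i' j hi := by
    have := RingQuot.mkAlgHom_rel K (QuantumMatrixRel.col (q := (q : K)) i i' j hi)
    simpa using this
  row i j j' hj := by
    have := RingQuot.mkAlgHom_rel K (QuantumMatrixRel.row (q := (q : K)) i j j' hj)
    simpa using this
  anti i i' j j' hi hj := by
    have := RingQuot.mkAlgHom_rel K (QuantumMatrixRel.anti (q := (q : K)) i i' j j' hi hj)
    simpa using this
  diag i i' j j' hi hj _ := by
    have := RingQuot.mkAlgHom_rel K (QuantumMatrixRel.diag (q := (q : K)) i i' j j' hi hj)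
    simpa using this
  comm i i' j j' hi hj hS := absurd (activeSet_full _) hS

theorem lift_quantumProj_ι :
    FreeAlgebra.lift K (quantumProj q m p ∘ FreeAlgebra.ι K) = quantumProj q m p := by
  ext b; simp

theorem StageRel.lift_eq_of_quantumMatrixRel {B : Type*} [Ring B] [Algebra K B]
    {U : Fin m × Fin p → B} (hU : StageRel q (activeSet m p (m * p)) U)
    ⦃x y : FreeAlgebra K (Fin m × Fin p)⦄ (h : QuantumMatrixRel (q : K) m p x y) :
    FreeAlgebra.lift K U x = FreeAlgebra.lift K U y := by
  rcases h with ⟨i, k, j, hi⟩ | ⟨i, j, l, hj⟩ | ⟨i, k, j, l, hi, hj⟩ | ⟨i, k, j, l, hi, hj⟩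
  · simpa using hU.col i k j hi
  · simpa using hU.row i j l hj
  · simpa using hU.anti i k j l hi hj
  · simpa using hU.diag i k j l hi hj (activeSet_full _)

/-- The embedding of quantum matrices into the full quantum torus. -/
def quantumToTorus (q : Kˣ) (m p : ℕ) :
    QuantumMatrices (q : K) m p →ₐ[K] DiagramTorus q (∅ : Finset (Fin m × Fin p)) :=
  RingQuot.liftAlgHom K ⟨FreeAlgebra.lift K (restored q ∅ (m * p)),
    (stageRel_restored q (isCauchon_empty _) le_rfl).lift_eq_of_quantumMatrixRel⟩

theorem quantumToTorus_quantumProj (f : FreeAlgebra K (Fin m × Fin p)) :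
    quantumToTorus q m p (quantumProj q m p f)
      = FreeAlgebra.lift K (restored q ∅ (m * p)) f := by
  rw [quantumToTorus, RingQuot.liftAlgHom_mkAlgHom_apply]

theorem quantumProj_eq_zero_iff {f : FreeAlgebra K (Fin m × Fin p)} :
    quantumProj q m p f = 0 ↔ FreeAlgebra.lift K (restored q ∅ (m * p)) f = 0 := by
  refine ⟨fun h => ?_, fun h => ?_⟩
  · rw [← quantumToTorus_quantumProj, h, map_zero]
  · rw [← lift_quantumProj_ι]
    exact lift_eq_zero_of_lift_restored le_rfl stageRel_quantumProj h

theorem quantumToTorus_injective : Function.Injective (quantumToTorus q m p) := by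
  rw [injective_iff_map_eq_zero]
  intro r hr
  obtain ⟨f, rfl⟩ := quantumProj_surjective r
  rwa [quantumToTorus_quantumProj, ← quantumProj_eq_zero_iff] at hr

instance : NoZeroDivisors (QuantumMatrices (q : K) m p) where
  eq_zero_or_eq_zero_of_mul_eq_zero {a b} h := by
    have := DiagramTorus.mul_eq_zero (f := quantumToTorus q m p a) (g := quantumToTorus q m p b)
      (by rw [← map_mul, h, map_zero])
    simpa [map_eq_zero_iff _ quantumToTorus_injective] using this

instance : Nontrivial (QuantumMatrices (q : K) m p) :=
  (quantumToTorus q m p).toRingHom.domain_nontrivial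

instance : IsNoetherianRing (QuantumMatrices (q : K) m p) := by
  refine (stageRel_quantumProj (q := q)).almostCommutes.isNoetherianRing ?_
  rw [Algebra.adjoin_range_eq_range_freeAlgebra_lift, lift_quantumProj_ι,
    (AlgHom.range_eq_top _).2 quantumProj_surjective]

theorem lift_quantumGens (f : FreeAlgebra K (Fin m × Fin p)) :
    FreeAlgebra.lift K (quantumGens (q : K) m p) f
      = skewFractionsOf K (quantumProj q m p f) := by
  have : FreeAlgebra.lift K (quantumGens (q : K) m p)
      = (skewFractionsOf K).comp (quantumProj q m p) := by
    ext b; simp [quantumGens]; rfl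
  rw [this]; rfl

theorem stageModel_quantumGens : StageModel q (m * p) (quantumGens (q : K) m p) where
  zero_iff f := by rw [lift_quantumGens, skewFractionsOf_eq_zero, quantumProj_eq_zero_iff]
  isUnit f hf := by
    rw [lift_quantumGens] at hf ⊢
    exact isUnit_skewFractionsOf K fun h => hf (by rw [h, map_zero])

end QuantumMatrices

/-! ## The field of fractions of the Poisson algebra -/

/-- The evaluation of noncommutative polynomials in the polynomial ring. -/
abbrev polyProj (K : Type u) [Field K] (m p : ℕ) :
    FreeAlgebra K (Fin m × Fin p) →ₐ[K] MvPolynomial (Fin m × Fin p) K :=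
  FreeAlgebra.lift K MvPolynomial.X

theorem polyProj_surjective : Function.Surjective (polyProj K m p) := by
  rw [← AlgHom.range_eq_top, ← Algebra.adjoin_range_eq_range_freeAlgebra_lift,
    MvPolynomial.adjoin_range_X]

/-- At `q = 1` the correction coefficient `q - q⁻¹` is zero, so every family in a commutative
algebra satisfies the relations of every stage. This makes the polynomial ring the instance `q = 1`
of the general theory. -/
theorem stageRel_of_comm {B : Type*} [CommRing B] [Algebra K B] (S : Set (Fin m × Fin p))
    (U : Fin m × Fin p → B) : StageRel (1 : Kˣ) S U where
  col i i' j _ := by rw [Units.val_one, one_smul, mul_comm]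
  row i j j' _ := by rw [Units.val_one, one_smul, mul_comm]
  anti i i' j j' _ _ := mul_comm _ _
  diag i i' j j' _ _ _ := by rw [inv_one, sub_self, zero_smul, add_zero, mul_comm]
  comm i i' j j' _ _ _ := mul_comm _ _

theorem QTorus.T_mul_of_one {Γ : Type*} [AddCommGroup Γ] {b : Γ →+ Γ →+ ℤ} (α β : Γ) :
    QTorus.T (1 : Kˣ) b α * QTorus.T (1 : Kˣ) b β = QTorus.T (1 : Kˣ) b (α + β) := by
  rw [QTorus.T_mul, one_zpow, Units.val_one, one_smul]

instance {Γ : Type*} [AddCommGroup Γ] (b : Γ →+ Γ →+ ℤ) : CommRing (QTorus (1 : Kˣ) b) where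
  mul_comm f g := by
    induction f using QTorus.induction_linear with
    | h0 => rw [zero_mul, mul_zero]
    | hadd f f' hf hf' => rw [add_mul, mul_add, hf, hf']
    | hT c α =>
      induction g using QTorus.induction_linear with
      | h0 => rw [zero_mul, mul_zero]
      | hadd g g' hg hg' => rw [add_mul, mul_add, hg, hg']
      | hT d β =>
        simp only [smul_mul_assoc, mul_smul_comm, QTorus.T_mul_of_one, add_comm α, smul_comm c]

theorem polyProj_eq_zero_iff {N : ℕ} (hN : N ≤ m * p) {f : FreeAlgebra K (Fin m × Fin p)} :
    polyProj K m p f = 0 ↔ FreeAlgebra.lift K (restored (1 : Kˣ) ∅ N) f = 0 := by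
  refine ⟨fun h => ?_, lift_eq_zero_of_lift_restored hN (stageRel_of_comm _ _)⟩
  have : FreeAlgebra.lift K (restored (1 : Kˣ) ∅ N)
      = (MvPolynomial.aeval (restored (1 : Kˣ) ∅ N)).comp (polyProj K m p) := by
    ext b; simp
  rw [this, AlgHom.comp_apply, h, map_zero]

theorem lift_poissonGens (f : FreeAlgebra K (Fin m × Fin p)) :
    FreeAlgebra.lift K (poissonGens K m p) f
      = algebraMap _ (FractionRing (MvPolynomial (Fin m × Fin p) K)) (polyProj K m p f) := by
  have : FreeAlgebra.lift K (poissonGens K m p)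
      = (IsScalarTower.toAlgHom K (MvPolynomial (Fin m × Fin p) K)
          (FractionRing (MvPolynomial (Fin m × Fin p) K))).comp (polyProj K m p) := by
    ext b; simp [poissonGens]
  rw [this]; rfl

theorem stageModel_poissonGens : StageModel (1 : Kˣ) (m * p) (poissonGens K m p) where
  zero_iff f := by
    rw [lift_poissonGens, map_eq_zero_iff _ (IsFractionRing.injective _ _),
      polyProj_eq_zero_iff le_rfl]
  isUnit f hf := hf.isUnit

end

end DeletingDerivations

namespace DeletingDerivations

noncomputable section

/-! ## First-order deformations -/

universe u

variable {m p : ℕ} {K : Type u} [Field K]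

/-- A bilinear map that is a derivation in each argument. -/
structure IsBiderivation {B : Type*} [CommRing B] [Algebra K B] (c : B →ₗ[K] B →ₗ[K] B) :
    Prop where
  mul_left : ∀ f g h, c (f * g) h = f * c g h + g * c f h
  mul_right : ∀ f g h, c f (g * h) = g * c f h + h * c f g

section Deformation

variable {B : Type*} [CommRing B] [Algebra K B] {c : B →ₗ[K] B →ₗ[K] B}

theorem IsBiderivation.one_left (hc : IsBiderivation c) (g : B) : c 1 g = 0 := by
  simpa using hc.mul_left 1 1 g

theorem IsBiderivation.one_right (hc : IsBiderivation c) (g : B) : c g 1 = 0 := by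
  simpa using hc.mul_right g 1 1

theorem IsBiderivation.algebraMap_left (hc : IsBiderivation c) (x : K) (g : B) :
    c (algebraMap K B x) g = 0 := by
  rw [Algebra.algebraMap_eq_smul_one, map_smul, LinearMap.smul_apply, hc.one_left, smul_zero]

theorem IsBiderivation.algebraMap_right (hc : IsBiderivation c) (x : K) (g : B) :
    c g (algebraMap K B x) = 0 := by
  rw [Algebra.algebraMap_eq_smul_one, map_smul, hc.one_right, smul_zero]

/-- The first-order deformation of a commutative algebra along a biderivation. -/
@[ext]
structure Deformation (hc : IsBiderivation c) where
  /-- The residue. -/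
  fst : B
  /-- The infinitesimal part. -/
  snd : B

namespace Deformation

variable {hc : IsBiderivation c}

instance : Zero (Deformation hc) := ⟨⟨0, 0⟩⟩
instance : One (Deformation hc) := ⟨⟨1, 0⟩⟩
instance : Add (Deformation hc) := ⟨fun x y => ⟨x.1 + y.1, x.2 + y.2⟩⟩
instance : Neg (Deformation hc) := ⟨fun x => ⟨-x.1, -x.2⟩⟩
instance : Mul (Deformation hc) := ⟨fun x y => ⟨x.1 * y.1, x.1 * y.2 + x.2 * y.1 + c x.1 y.1⟩⟩

@[simp] theorem fst_zero : (0 : Deformation hc).fst = 0 := rfl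
@[simp] theorem snd_zero : (0 : Deformation hc).snd = 0 := rfl
@[simp] theorem fst_one : (1 : Deformation hc).fst = 1 := rfl
@[simp] theorem snd_one : (1 : Deformation hc).snd = 0 := rfl
@[simp] theorem fst_add (x y : Deformation hc) : (x + y).fst = x.fst + y.fst := rfl
@[simp] theorem snd_add (x y : Deformation hc) : (x + y).snd = x.snd + y.snd := rfl
@[simp] theorem fst_neg (x : Deformation hc) : (-x).fst = -x.fst := rfl
@[simp] theorem snd_neg (x : Deformation hc) : (-x).snd = -x.snd := rfl
@[simp] theorem fst_mul (x y : Deformation hc) : (x * y).fst = x.fst * y.fst := rfl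
@[simp] theorem snd_mul (x y : Deformation hc) :
    (x * y).snd = x.fst * y.snd + x.snd * y.fst + c x.fst y.fst := rfl

instance : Ring (Deformation hc) where
  add_assoc x y z := by ext <;> simp [add_assoc]
  zero_add x := by ext <;> simp
  add_zero x := by ext <;> simp
  add_comm x y := by ext <;> simp [add_comm]
  neg_add_cancel x := by ext <;> simp
  nsmul := nsmulRec
  zsmul := zsmulRec
  zero_mul x := by ext <;> simp
  mul_zero x := by ext <;> simp
  one_mul x := by ext <;> simp [hc.one_left]
  mul_one x := by ext <;> simp [hc.one_right]
  left_distrib x y z := by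
    ext
    · simp [mul_add]
    · simp only [snd_mul, fst_add, snd_add, map_add]; ring
  right_distrib x y z := by
    ext
    · simp [add_mul]
    · simp only [snd_mul, fst_add, snd_add, map_add, LinearMap.add_apply]; ring
  mul_assoc x y z := by
    ext
    · simp [mul_assoc]
    · simp only [snd_mul, fst_mul, hc.mul_left, hc.mul_right]; ring

/-- The residue map. -/
def residue (hc : IsBiderivation c) : Deformation hc →+* B where
  toFun := fst
  map_zero' := rfl
  map_one' := rfl
  map_add' _ _ := rfl
  map_mul' _ _ := rfl

/-- The structure map of the deformation. -/
def scalar (hc : IsBiderivation c) : DualNumber K →+* Deformation hc where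
  toFun d := ⟨algebraMap K B d.fst, algebraMap K B d.snd⟩
  map_zero' := by ext <;> simp
  map_one' := by ext <;> simp
  map_add' _ _ := by ext <;> simp
  map_mul' x y := by
    ext
    · simp
    · simp only [TrivSqZeroExt.snd_mul, snd_mul, hc.algebraMap_left]
      simp [mul_comm]

instance : Algebra (DualNumber K) (Deformation hc) :=
  (scalar hc).toAlgebra' fun d x => by
    ext
    · simp [scalar, mul_comm]
    · simp only [snd_mul, scalar, RingHom.coe_mk, MonoidHom.coe_mk, OneHom.coe_mk,
        hc.algebraMap_left, hc.algebraMap_right]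
      ring

theorem fst_smul (d : DualNumber K) (x : Deformation hc) :
    (d • x).fst = algebraMap K B d.fst * x.fst := rfl

theorem snd_smul (d : DualNumber K) (x : Deformation hc) : (d • x).snd
    = algebraMap K B d.fst * x.snd + algebraMap K B d.snd * x.fst := by
  have : (d • x).snd = algebraMap K B d.fst * x.snd + algebraMap K B d.snd * x.fst
    + c (algebraMap K B d.fst) x.fst := rfl
  rw [this, hc.algebraMap_left, add_zero]

/-- Elements with residue `1` are inverted by changing the sign of the infinitesimal part; a lift of
the inverse residue reduces to this case. -/
theorem isUnit_iff {x : Deformation hc} (hx : IsUnit x.fst) : IsUnit x := by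
  have key : ∀ y : Deformation hc, y.fst = 1 → IsUnit y := fun y hy => by
    refine ⟨⟨y, ⟨1, -y.snd⟩, ?_, ?_⟩, rfl⟩ <;> ext <;> simp [hy, hc.one_left]
  obtain ⟨z, hz⟩ := hx.exists_right_inv
  obtain ⟨v, hv⟩ := key (x * ⟨z, 0⟩) (by simp [hz])
  obtain ⟨v', hv'⟩ := key (⟨z, 0⟩ * x) (by simp [mul_comm z, hz])
  refine isUnit_iff_exists_and_exists.2 ⟨⟨⟨z, 0⟩ * v⁻¹.val, ?_⟩, ⟨v'⁻¹.val * ⟨z, 0⟩, ?_⟩⟩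
  · rw [← mul_assoc, ← hv, Units.mul_inv]
  · rw [mul_assoc, ← hv', Units.inv_mul]

/-- The deformation parameter `1 + ε`. -/
def parameter (K : Type*) [Field K] : (DualNumber K)ˣ where
  val := TrivSqZeroExt.inl 1 + TrivSqZeroExt.inr 1
  inv := TrivSqZeroExt.inl 1 - TrivSqZeroExt.inr 1
  val_inv := by ext <;> simp
  inv_val := by ext <;> simp

theorem val_parameter :
    (parameter K : DualNumber K) = TrivSqZeroExt.inl 1 + TrivSqZeroExt.inr 1 := rfl

theorem val_inv_parameter :
    ((parameter K)⁻¹ : (DualNumber K)ˣ).val = TrivSqZeroExt.inl 1 - TrivSqZeroExt.inr 1 := rfl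

end Deformation

/-- The relations between the generators of the Poisson algebras in the deleting derivations
algorithm. -/
structure PoissonFamily (br : B →ₗ[K] B →ₗ[K] B) (S : Set (Fin m × Fin p))
    (U : Fin m × Fin p → B) : Prop where
  col : ∀ i i' j, i < i' → br (U (i, j)) (U (i', j)) = U (i, j) * U (i', j)
  row : ∀ i j j', j < j' → br (U (i, j)) (U (i, j')) = U (i, j) * U (i, j')
  anti : ∀ i i' j j', i < i' → j' < j → br (U (i, j)) (U (i', j')) = 0
  diag : ∀ i i' j j', i < i' → j < j' → (i', j') ∈ S →
    br (U (i, j)) (U (i', j')) = 2 * U (i, j') * U (i', j)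
  comm : ∀ i i' j j', i < i' → j < j' → (i', j') ∉ S → br (U (i, j)) (U (i', j')) = 0

/-- For `q = 1 + ε` one has `q - q⁻¹ = 2ε`, and the commutator of two elements is the value of `c -
c.flip` on their residues, as an infinitesimal part. Comparing infinitesimal parts turns the stage
relations into Poisson relations; the infinitesimal parts of the family itself cancel. -/
theorem Deformation.stageRel_iff {hc : IsBiderivation c} {S : Set (Fin m × Fin p)}
    {U : Fin m × Fin p → Deformation hc} :
    StageRel (Deformation.parameter K) S U ↔ PoissonFamily (c - c.flip) S fun b => (U b).fst := by
  have h0 : ∀ x y : Deformation hc, x * y = y * x ↔ (c - c.flip) x.fst y.fst = 0 := by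
    intro x y
    rw [Deformation.ext_iff, ← sub_eq_zero (a := (x * y).snd)]
    simp only [Deformation.fst_mul, Deformation.snd_mul, LinearMap.sub_apply, LinearMap.flip_apply,
      mul_comm x.fst, mul_comm x.snd, true_and]
    ring_nf
  have h1 : ∀ x y : Deformation hc, x * y = (Deformation.parameter K : DualNumber K) • (y * x)
      ↔ (c - c.flip) x.fst y.fst = x.fst * y.fst := by
    intro x y
    rw [Deformation.ext_iff, ← sub_eq_zero (a := (x * y).snd), ← sub_eq_zero (b := x.fst * y.fst)]
    simp only [Deformation.fst_mul, Deformation.snd_mul, LinearMap.sub_apply, LinearMap.flip_apply,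
      Deformation.fst_smul, Deformation.snd_smul, Deformation.val_parameter]
    simp [mul_comm x.fst, mul_comm x.snd]
    ring_nf
  have h2 : ∀ x y z t : Deformation hc, x * y = y * x + ((Deformation.parameter K : DualNumber K)
      - ((Deformation.parameter K)⁻¹ : (DualNumber K)ˣ).val) • (z * t)
      ↔ (c - c.flip) x.fst y.fst = 2 * z.fst * t.fst := by
    intro x y z t
    rw [Deformation.ext_iff, ← sub_eq_zero (a := (x * y).snd),
      ← sub_eq_zero (b := 2 * z.fst * t.fst)]
    simp only [Deformation.fst_mul, Deformation.snd_mul, LinearMap.sub_apply, LinearMap.flip_apply,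
      Deformation.fst_smul, Deformation.snd_smul, Deformation.val_parameter,
      Deformation.val_inv_parameter, Deformation.fst_add, Deformation.snd_add]
    simp [mul_comm x.fst, mul_comm x.snd]
    ring_nf
  exact ⟨fun h => ⟨fun i i' j hi => (h1 _ _).1 (h.col i i' j hi),
      fun i j j' hj => (h1 _ _).1 (h.row i j j' hj),
      fun i i' j j' hi hj => (h0 _ _).1 (h.anti i i' j j' hi hj),
      fun i i' j j' hi hj hS => (h2 _ _ _ _).1 (h.diag i i' j j' hi hj hS),
      fun i i' j j' hi hj hS => (h0 _ _).1 (h.comm i i' j j' hi hj hS)⟩,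
    fun h => ⟨fun i i' j hi => (h1 _ _).2 (h.col i i' j hi),
      fun i j j' hj => (h1 _ _).2 (h.row i j j' hj),
      fun i i' j j' hi hj => (h0 _ _).2 (h.anti i i' j j' hi hj),
      fun i i' j j' hi hj hS => (h2 _ _ _ _).2 (h.diag i i' j j' hi hj hS),
      fun i i' j j' hi hj hS => (h0 _ _).2 (h.comm i i' j j' hi hj hS)⟩⟩

theorem map_restoreStep {A A' : Type*} [Ring A] [Ring A'] (φ : A →+* A') {a : Fin m × Fin p}
    {V : Fin m × Fin p → A} (ha : IsUnit (V a)) (b : Fin m × Fin p) :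
    φ (restoreStep a V b) = restoreStep a (fun b => φ (V b)) b := by
  have h1 : φ (Ring.inverse (V a)) = Ring.inverse (φ (V a)) := by
    obtain ⟨u, hu⟩ := ha
    have := Ring.inverse_unit (Units.map (φ : A →* A') u)
    rw [Units.coe_map, MonoidHom.coe_coe] at this
    rw [← hu, Ring.inverse_unit, this]
    rfl
  unfold restoreStep
  split_ifs
  · rw [map_add, map_mul, map_mul, h1]
  · rfl

/-- Poisson relations are inherited by the restoration step. -/
theorem PoissonFamily.restoreStep (hc : IsBiderivation c) {N : ℕ} (h : N < m * p)
    {V : Fin m × Fin p → B} (hV : PoissonFamily (c - c.flip) (activeSet m p N) V)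
    (hu : IsUnit (V (indexAt h))) :
    PoissonFamily (c - c.flip) (activeSet m p (N + 1)) (restoreStep (indexAt h) V) := by
  -- Lift with zero infinitesimal part, restore over the dual numbers, and take residues.
  let W : Fin m × Fin p → Deformation hc := fun b => ⟨V b, 0⟩
  have hWu : IsUnit (W (indexAt h)) := Deformation.isUnit_iff hu
  have hW : StageRel (Deformation.parameter K) (activeSet m p N) W :=
    Deformation.stageRel_iff.2 hV
  have h1 := Deformation.stageRel_iff.1 (hW.restoreStep h hWu)
  have h2 : (fun b => (DeletingDerivations.restoreStep (indexAt h) W b).fst)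
      = DeletingDerivations.restoreStep (indexAt h) V :=
    funext fun b => map_restoreStep (Deformation.residue hc) hWu b
  rwa [h2] at h1

theorem PoissonFamily.insert_of_eq_zero {br : B →ₗ[K] B →ₗ[K] B} {S : Set (Fin m × Fin p)}
    {a : Fin m × Fin p} {V : Fin m × Fin p → B} (hV : PoissonFamily br S V)
    (h0 : V a = 0) (h : ∀ i < a.1, ∀ j < a.2, V (i, a.2) * V (a.1, j) = 0) :
    PoissonFamily br (insert a S) V where
  col := hV.col
  row := hV.row
  anti := hV.anti
  diag i i' j j' hi hj hS := by
    rcases hS with rfl | hS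
    · rw [h0, mul_assoc, h i hi j hj, map_zero, mul_zero]
    · exact hV.diag i i' j j' hi hj hS
  comm i i' j j' hi hj hS := hV.comm i i' j j' hi hj fun h => hS (Set.mem_insert_of_mem _ h)

end Deformation

/-! ### Poisson tori -/

section TorusBracket

variable {Γ : Type*} [AddCommGroup Γ] {b : Γ →+ Γ →+ ℤ}

/-- The biderivation of a torus attached to a bilinear form. -/
def torusCocycle (K : Type*) [Field K] (b : Γ →+ Γ →+ ℤ) :
    QTorus (1 : Kˣ) b →ₗ[K] QTorus (1 : Kˣ) b →ₗ[K] QTorus (1 : Kˣ) b :=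
  QTorus.lin fun α => QTorus.lin fun β => (b α β : K) • QTorus.T 1 b (α + β)

theorem torusCocycle_T (α β : Γ) : torusCocycle K b (QTorus.T 1 b α) (QTorus.T 1 b β)
    = (b α β : K) • QTorus.T 1 b (α + β) := by
  rw [torusCocycle, QTorus.lin_T, QTorus.lin_T]

/-- The Leibniz rules express the additivity of `b` in each argument. The map is the derivative at
`q = 1` of the multiplication `q ^ b α β`. -/
theorem isBiderivation_torusCocycle : IsBiderivation (torusCocycle K b) where
  mul_left f g h := by
    induction f using QTorus.induction_linear with
    | h0 => simp
    | hadd f f' hf hf' => simp only [add_mul, map_add, LinearMap.add_apply, hf, hf', mul_add]; ring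
    | hT x α =>
      induction g using QTorus.induction_linear with
      | h0 => simp
      | hadd g g' hg hg' =>
        simp only [add_mul, map_add, LinearMap.add_apply, hg, hg', mul_add]; ring
      | hT y β =>
        induction h using QTorus.induction_linear with
        | h0 => simp
        | hadd h h' hh hh' => simp only [map_add, hh, hh', mul_add]; ring
        | hT z γ =>
          simp only [smul_mul_assoc, mul_smul_comm, map_smul, LinearMap.smul_apply,
            QTorus.T_mul_of_one, torusCocycle_T, map_add, AddMonoidHom.add_apply, smul_smul]
          rw [show α + (β + γ) = α + β + γ by abel, show β + (α + γ) = α + β + γ by abel,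
            ← add_smul]
          congr 1; push_cast; ring
  mul_right f g h := by
    induction f using QTorus.induction_linear with
    | h0 => simp
    | hadd f f' hf hf' => simp only [map_add, LinearMap.add_apply, hf, hf', mul_add]; ring
    | hT x α =>
      induction g using QTorus.induction_linear with
      | h0 => simp
      | hadd g g' hg hg' => simp only [add_mul, map_add, hg, hg', mul_add]; ring
      | hT y β =>
        induction h using QTorus.induction_linear with
        | h0 => simp
        | hadd h h' hh hh' => simp only [map_add, hh, hh', mul_add, add_mul]; ring
        | hT z γ =>
          simp only [smul_mul_assoc, mul_smul_comm, map_smul, LinearMap.smul_apply,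
            QTorus.T_mul_of_one, torusCocycle_T, map_add, smul_smul]
          rw [show α + (β + γ) = α + β + γ by abel, show β + (α + γ) = α + β + γ by abel,
            show γ + (α + β) = α + β + γ by abel, ← add_smul]
          congr 1; push_cast; ring

/-- The Poisson bracket of a torus. -/
def torusBracket (K : Type*) [Field K] (b : Γ →+ Γ →+ ℤ) :
    QTorus (1 : Kˣ) b →ₗ[K] QTorus (1 : Kˣ) b →ₗ[K] QTorus (1 : Kˣ) b :=
  torusCocycle K b - (torusCocycle K b).flip

theorem torusBracket_T (α β : Γ) : torusBracket K b (QTorus.T 1 b α) (QTorus.T 1 b β)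
    = ((b α β - b β α : ℤ) : K) • QTorus.T 1 b (α + β) := by
  rw [torusBracket, LinearMap.sub_apply, LinearMap.sub_apply, LinearMap.flip_apply, torusCocycle_T,
    torusCocycle_T, add_comm β, ← sub_smul, Int.cast_sub]

theorem torusBracket_skew (f g : QTorus (1 : Kˣ) b) :
    torusBracket K b f g = -torusBracket K b g f := by
  simp [torusBracket]

theorem IsBiderivation.antisymm {B : Type*} [CommRing B] [Algebra K B]
    {c : B →ₗ[K] B →ₗ[K] B} (hc : IsBiderivation c) : IsBiderivation (c - c.flip) where
  mul_left f g h := by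
    simp only [LinearMap.sub_apply, LinearMap.flip_apply, hc.mul_left, hc.mul_right]; ring
  mul_right f g h := by
    simp only [LinearMap.sub_apply, LinearMap.flip_apply, hc.mul_left, hc.mul_right]; ring

theorem isBiderivation_torusBracket : IsBiderivation (torusBracket K b) :=
  isBiderivation_torusCocycle.antisymm

end TorusBracket

/-! ### Poisson relations of the restored families -/

section Restored

variable {w : Finset (Fin m × Fin p)}

theorem torusBracket_torusGen (a b : Fin m × Fin p) :
    torusBracket K (torusForm w) (torusGen 1 w a) (torusGen 1 w b)
      = (lambdaInt a b : K) • (torusGen 1 w a * torusGen 1 w b) := by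
  by_cases ha : a ∈ w
  · simp [torusGen_of_mem ha]
  by_cases hb : b ∈ w
  · simp [torusGen_of_mem hb]
  rw [torusGen_of_notMem ha, torusGen_of_notMem hb, torusBracket_T, QTorus.T_mul_of_one,
    torusForm_single_sub, Finset.sum_eq_single ⟨b, hb⟩]
  · simp
  · intro c _ hc; simp [hc]
  · simp

theorem poissonFamily_torusGen :
    PoissonFamily (torusBracket K (torusForm w)) (activeSet m p 0) (torusGen 1 w) where
  col i i' j hi := by
    rw [torusBracket_torusGen, lambdaInt, if_pos (Or.inr ⟨rfl, hi⟩), Int.cast_one, one_smul]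
  row i j j' hj := by
    rw [torusBracket_torusGen, lambdaInt, if_pos (Or.inl ⟨rfl, hj⟩), Int.cast_one, one_smul]
  anti i i' j j' hi hj := by
    rw [torusBracket_torusGen, lambdaInt, if_neg, if_neg, Int.cast_zero, zero_smul] <;>
      simp [hi.ne, hj.ne']
  diag i i' j j' hi hj hS := absurd hS (Nat.not_lt_zero _)
  comm i i' j j' hi hj _ := by
    rw [torusBracket_torusGen, lambdaInt, if_neg, if_neg, Int.cast_zero, zero_smul] <;>
      simp [hi.ne, hj.ne]

theorem poissonFamily_restored {N : ℕ} (hw : IsCauchonBelow w N) (hN : N ≤ m * p) :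
    PoissonFamily (torusBracket K (torusForm w)) (activeSet m p N) (restored 1 w N) := by
  induction N with
  | zero => exact poissonFamily_torusGen
  | succ N ih =>
    have h : N < m * p := hN
    specialize ih (hw.mono N.le_succ) h.le
    rw [restored_succ h]
    by_cases ha : indexAt h ∈ w
    · have h0 : restored (1 : Kˣ) w N (indexAt h) = 0 := by
        rw [restored_pivot, torusGen_of_mem ha]
      rw [restoreStep_of_eq_zero h0, activeSet_succ h]
      refine ih.insert_of_eq_zero h0 fun i hi j hj => ?_
      rcases hw _ ha (by rw [lexIndex_indexAt]; exact N.lt_succ_self) with h1 | h1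
      · rw [restored_row_of_pivot, torusGen_of_mem (h1 j hj), mul_zero]
      · rw [restored_col_of_pivot _ w h h1 hi, zero_mul]
    · exact PoissonFamily.restoreStep isBiderivation_torusCocycle h ih
        (by rw [restored_pivot]; exact isUnit_torusGen ha)

end Restored

end

end DeletingDerivations

namespace DeletingDerivations

noncomputable section

/-! ## Poisson brackets of the stages -/

universe u

variable {m p : ℕ} {K : Type u} [Field K]

/-- The values `{X_a, X_b}`, for `a` before `b`, in the `N`-th Poisson algebra. -/
def stageTable (K : Type*) [Field K] (N : ℕ) (a b : Fin m × Fin p) :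
    MvPolynomial (Fin m × Fin p) K :=
  if (a.1 < b.1 ∧ a.2 = b.2) ∨ (a.1 = b.1 ∧ a.2 < b.2) then
    MvPolynomial.X a * MvPolynomial.X b
  else if (a.1 < b.1 ∧ a.2 < b.2) ∧ lexIndex b < N then
    2 * MvPolynomial.X (a.1, b.2) * MvPolynomial.X (b.1, a.2)
  else 0

/-- The Poisson bracket of the `N`-th Poisson algebra. -/
def stageBracket (N : ℕ) (f g : MvPolynomial (Fin m × Fin p) K) :
    MvPolynomial (Fin m × Fin p) K :=
  ∑ a, ∑ b, stageTable K N a b *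
    (MvPolynomial.pderiv a f * MvPolynomial.pderiv b g
      - MvPolynomial.pderiv b f * MvPolynomial.pderiv a g)

theorem stageBracket_full (f g : MvPolynomial (Fin m × Fin p) K) :
    stageBracket (m * p) f g = matrixPoissonBracket f g := by
  have : ∀ a b : Fin m × Fin p, stageTable K (m * p) a b = poissonTable K a b := fun a b => by
    simp only [stageTable, poissonTable, lexIndex_lt, and_true]
  simp only [stageBracket, matrixPoissonBracket, this]

theorem stageBracket_X (N : ℕ) (a b : Fin m × Fin p) :
    stageBracket N (MvPolynomial.X a) (MvPolynomial.X b : MvPolynomial (Fin m × Fin p) K)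
      = stageTable K N a b - stageTable K N b a := by
  classical
  simp only [stageBracket, MvPolynomial.pderiv_X, mul_sub, Finset.sum_sub_distrib]
  congr 1
  · rw [Finset.sum_eq_single a, Finset.sum_eq_single b] <;> simp +contextual [Pi.single_apply]
  · rw [Finset.sum_eq_single b, Finset.sum_eq_single a] <;> simp +contextual [Pi.single_apply]

/-! ### Brackets under evaluation and on fractions -/

section Evaluation

variable {B : Type*} [CommRing B] [Algebra K B] {c : B →ₗ[K] B →ₗ[K] B}

theorem derivation_aeval {D : B →ₗ[K] B} (hD : ∀ f g, D (f * g) = f * D g + g * D f)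
    (U : Fin m × Fin p → B) (f : MvPolynomial (Fin m × Fin p) K) :
    D (MvPolynomial.aeval U f)
      = ∑ a, MvPolynomial.aeval U (MvPolynomial.pderiv a f) * D (U a) := by
  classical
  have h1 : D 1 = 0 := by simpa using hD 1 1
  induction f using MvPolynomial.induction_on with
  | C x =>
    rw [MvPolynomial.aeval_C, Algebra.algebraMap_eq_smul_one, map_smul, h1]
    simp
  | add f g hf hg => simp only [map_add, hf, hg, add_mul, Finset.sum_add_distrib]
  | mul_X f i hf =>
    simp only [map_mul, MvPolynomial.aeval_X, hD, hf, Derivation.leibniz, smul_eq_mul, map_add,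
      add_mul, Finset.sum_add_distrib, Finset.mul_sum, mul_assoc]
    congr 1
    rw [Finset.sum_eq_single i] <;> simp +contextual [MvPolynomial.pderiv_X]

theorem IsBiderivation.aeval (hc : IsBiderivation c) (U : Fin m × Fin p → B)
    (f g : MvPolynomial (Fin m × Fin p) K) :
    c (MvPolynomial.aeval U f) (MvPolynomial.aeval U g)
      = ∑ a, ∑ b, MvPolynomial.aeval U (MvPolynomial.pderiv a f)
        * MvPolynomial.aeval U (MvPolynomial.pderiv b g) * c (U a) (U b) := by
  have h1 := derivation_aeval (D := c.flip (MvPolynomial.aeval U g))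
    (fun f h => by simp only [LinearMap.flip_apply, hc.mul_left]) U f
  simp only [LinearMap.flip_apply] at h1
  rw [h1]
  refine Finset.sum_congr rfl fun a _ => ?_
  rw [derivation_aeval (hc.mul_right (U a)), Finset.mul_sum]
  exact Finset.sum_congr rfl fun b _ => (mul_assoc _ _ _).symm

theorem PoissonFamily.bracket_eq {N : ℕ} {U : Fin m × Fin p → B}
    (hU : PoissonFamily (c - c.flip) (activeSet m p N) U) (a b : Fin m × Fin p) :
    (c - c.flip) (U a) (U b) = MvPolynomial.aeval U (stageTable K N a b)
      - MvPolynomial.aeval U (stageTable K N b a) := by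
  have key : ∀ a b, lexIndex a < lexIndex b → (c - c.flip) (U a) (U b)
      = MvPolynomial.aeval U (stageTable K N a b) - MvPolynomial.aeval U (stageTable K N b a) := by
    rintro ⟨i, j⟩ ⟨i', j'⟩ hlt
    rcases lexIndex_lt_iff.1 hlt with hi | ⟨hi, hj⟩
    · simp only at hi
      rcases lt_trichotomy j j' with hj | rfl | hj
      · by_cases hS : (i', j') ∈ activeSet m p N
        · rw [hU.diag i i' j j' hi hj hS]
          rw [mem_activeSet] at hS
          simp [stageTable, hi, hi.ne, hi.ne', hi.not_gt, hj, hj.ne, hS]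
        · rw [hU.comm i i' j j' hi hj hS]
          rw [mem_activeSet] at hS
          simp [stageTable, hi, hi.ne, hi.ne', hi.not_gt, hj, hj.ne, hS]
      · rw [hU.col i i' j hi]
        simp [stageTable, hi, hi.not_gt]
      · rw [hU.anti i i' j j' hi hj]
        simp [stageTable, hi.ne, hi.ne', hi.not_gt, hj.not_gt, hj.ne']
    · simp only at hi hj
      subst hi
      rw [hU.row i j j' hj]
      simp [stageTable, hj, hj.not_gt]
  rcases lt_trichotomy (lexIndex a) (lexIndex b) with h | h | h
  · exact key a b h
  · obtain rfl := lexIndex_injective h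
    simp
  · have := key b a h
    rw [← neg_inj, neg_sub, ← this]
    simp

/-- The brackets of the stages are compatible with evaluation at families with the corresponding
Poisson relations. -/
theorem PoissonFamily.aeval_stageBracket (hc : IsBiderivation c) {N : ℕ} {U : Fin m × Fin p → B}
    (hU : PoissonFamily (c - c.flip) (activeSet m p N) U) (f g : MvPolynomial (Fin m × Fin p) K) :
    MvPolynomial.aeval U (stageBracket N f g)
      = (c - c.flip) (MvPolynomial.aeval U f) (MvPolynomial.aeval U g) := by
  rw [hc.antisymm.aeval]
  simp only [hU.bracket_eq, stageBracket, map_sum, map_mul, map_sub, mul_sub,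
    Finset.sum_sub_distrib]
  congr 1
  · refine Finset.sum_congr rfl fun a _ => Finset.sum_congr rfl fun b _ => ?_
    ring
  · rw [Finset.sum_comm]
    refine Finset.sum_congr rfl fun a _ => Finset.sum_congr rfl fun b _ => ?_
    ring

theorem IsBiderivation.flip (hc : IsBiderivation c) : IsBiderivation c.flip :=
  ⟨fun f g h => hc.mul_right h f g, fun f g h => hc.mul_left g h f⟩

theorem IsBiderivation.pow_right (hc : IsBiderivation c) (x g : B) (n : ℕ) :
    x * c g (x ^ n) = n * x ^ n * c g x := by
  induction n with
  | zero => simp [hc.one_right]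
  | succ n ih =>
    rw [pow_succ, hc.mul_right, mul_add, ← mul_assoc x x, mul_assoc x x, ih]
    push_cast; ring

theorem IsBiderivation.pow_right_eq_zero (hc : IsBiderivation c) {x g : B} (h : c g x = 0)
    (n : ℕ) : c g (x ^ n) = 0 := by
  induction n with
  | zero => simp [hc.one_right]
  | succ n ih => rw [pow_succ, hc.mul_right, ih, h, mul_zero, mul_zero, add_zero]

/-- The bracket of fractions in terms of numerators. -/
theorem IsBiderivation.fraction (hc : IsBiderivation c) {x : B} (hx : c x x = 0) (f g : B)
    (n n' : ℕ) : c f g * x ^ (n + n' + 1) = x * c (f * x ^ n) (g * x ^ n')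
      - n' * ((g * x ^ n') * c (f * x ^ n) x) - n * ((f * x ^ n) * c x (g * x ^ n')) := by
  have h1 : ∀ y, x * c (x ^ n) y = n * x ^ n * c x y := fun y => hc.flip.pow_right x y n
  have h2 := hc.pow_right x f n'
  have h3 : c x (x ^ n') = 0 := hc.pow_right_eq_zero hx n'
  have h4 : c (x ^ n) x = 0 := hc.flip.pow_right_eq_zero hx n
  have h5 := h1 (x ^ n')
  simp only [hc.mul_left, hc.mul_right, h3, h4, mul_zero, zero_add] at h5 ⊢
  linear_combination (-f * x ^ n') * h1 g - x ^ n * g * h2 - f * g * h5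

end Evaluation

end

end DeletingDerivations

namespace DeletingDerivations

noncomputable section

/-! ## Poisson ideals of the stages -/

universe u

variable {m p : ℕ} {K : Type u} [Field K]

/-- The image in the polynomial ring of an ideal of the free algebra. -/
def polyIdeal (I : TwoSidedIdeal (FreeAlgebra K (Fin m × Fin p))) :
    Ideal (MvPolynomial (Fin m × Fin p) K) where
  carrier := polyProj K m p '' {f | f ∈ I}
  zero_mem' := ⟨0, I.zero_mem, map_zero _⟩
  add_mem' := by
    rintro _ _ ⟨f, hf, rfl⟩ ⟨g, hg, rfl⟩
    exact ⟨f + g, I.add_mem hf hg, map_add _ _ _⟩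
  smul_mem' := by
    rintro c _ ⟨f, hf, rfl⟩
    obtain ⟨c, rfl⟩ := polyProj_surjective c
    exact ⟨c * f, I.mul_mem_left _ _ hf, map_mul _ _ _⟩

theorem polyProj_mem_polyIdeal {N : ℕ} (hN : N ≤ m * p)
    {I : TwoSidedIdeal (FreeAlgebra K (Fin m × Fin p))} (hI : StageIdeal 1 N I)
    {f : FreeAlgebra K (Fin m × Fin p)} : polyProj K m p f ∈ polyIdeal I ↔ f ∈ I := by
  refine ⟨fun ⟨g, hg, e⟩ => (hI.mem_congr ?_).1 hg, fun hf => ⟨f, hf, rfl⟩⟩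
  rwa [← sub_eq_zero, ← map_sub, ← polyProj_eq_zero_iff hN, map_sub, sub_eq_zero]

/-- A Poisson prime ideal of the `N`-th Poisson algebra, as an ideal of the free algebra. -/
structure PoissonStageIdeal (N : ℕ) (I : TwoSidedIdeal (FreeAlgebra K (Fin m × Fin p))) :
    Prop where
  stageIdeal : StageIdeal 1 N I
  bracket_mem : ∀ f ∈ polyIdeal I, ∀ g, stageBracket N f g ∈ polyIdeal I

theorem lift_eq_aeval {B : Type*} [CommRing B] [Algebra K B] (U : Fin m × Fin p → B)
    (f : FreeAlgebra K (Fin m × Fin p)) :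
    FreeAlgebra.lift K U f = MvPolynomial.aeval U (polyProj K m p f) := by
  have : FreeAlgebra.lift K U = (MvPolynomial.aeval U).comp (polyProj K m p) := by
    ext b; simp
  rw [this]; rfl

theorem lift_restored_of_polyProj_eq_stageBracket {w : Finset (Fin m × Fin p)} {N : ℕ}
    (hw : IsCauchonBelow w N) (hN : N ≤ m * p) {f g h : FreeAlgebra K (Fin m × Fin p)}
    (e : polyProj K m p h = stageBracket N (polyProj K m p f) (polyProj K m p g)) :
    FreeAlgebra.lift K (restored 1 w N) h = torusBracket K (torusForm w)
      (FreeAlgebra.lift K (restored 1 w N) f) (FreeAlgebra.lift K (restored 1 w N) g) := by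
  rw [lift_eq_aeval _ h, lift_eq_aeval _ f, lift_eq_aeval _ g, e]
  exact (poissonFamily_restored hw hN).aeval_stageBracket isBiderivation_torusCocycle _ _

/-- The projection of `T^γ * {f, T^α}` is a scalar multiple of that of `T^(γ + α) * f`. Indeed only
exponents `β` of `f` with `γ + α + β` in the radical matter, and for these `b β α - b α β = b α γ -
b γ α`, independently of `β`. -/
theorem torusBracket_mem_induced {Γ : Type*} [AddCommGroup Γ] {b : Γ →+ Γ →+ ℤ} {s : ℕ}
    {D : QTorus.RadicalChart b s} {I : Ideal (LaurentRing K s)} {f : QTorus (1 : Kˣ) b}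
    (hf : f ∈ QTorus.induced D I) (g : QTorus (1 : Kˣ) b) :
    torusBracket K b f g ∈ QTorus.induced D I := by
  induction g using QTorus.induction_linear with
  | h0 => rw [map_zero]; exact zero_mem _
  | hadd g g' hg hg' => rw [map_add]; exact add_mem hg hg'
  | hT c α =>
    rw [map_smul, Algebra.smul_def]
    refine Ideal.mul_mem_left _ _ ?_
    intro h
    induction h using QTorus.induction_linear with
    | h0 => rw [zero_mul, map_zero]; exact zero_mem _
    | hadd h h' hh hh' => rw [add_mul, map_add]; exact add_mem hh hh'
    | hT d γ =>
      rw [smul_mul_assoc, map_smul, Algebra.smul_def]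
      refine Ideal.mul_mem_left _ _ ?_
      have key : QTorus.toLaurent D 1 (QTorus.T 1 b γ * torusBracket K b f (QTorus.T 1 b α))
          = ((b α γ - b γ α : ℤ) : K) • QTorus.toLaurent D 1 (QTorus.T 1 b (γ + α) * f) := by
        clear hf
        induction f using QTorus.induction_linear with
        | h0 => simp
        | hadd f f' hf hf' => simp only [map_add, LinearMap.add_apply, mul_add, hf, hf', smul_add]
        | hT x β =>
          simp only [map_smul, LinearMap.smul_apply, torusBracket_T, mul_smul_comm,
            QTorus.T_mul_of_one]
          rw [show γ + (β + α) = γ + α + β by abel, smul_comm]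
          by_cases hr : γ + α + β ∈ Set.range D.emb
          · have h1 := (D.mem_range _).1 hr α
            simp only [map_add, AddMonoidHom.add_apply] at h1
            rw [show b β α - b α β = b α γ - b γ α by linarith]
          · rw [QTorus.toLaurent_T_of_notMem D hr]; simp
      rw [key, Algebra.smul_def]
      exact Ideal.mul_mem_left _ _ (hf _)

theorem poissonStageIdeal_stageKernel {w : Finset (Fin m × Fin p)} {s : ℕ}
    {D : QTorus.RadicalChart (torusForm w) s} {𝔭 : PrimeSpectrum (LaurentRing K s)} {N : ℕ}
    (hN : N ≤ m * p) (hw : IsCauchonBelow w N) :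
    PoissonStageIdeal N (stageKernel D 1 N 𝔭.asIdeal) where
  stageIdeal := stageIdeal_stageKernel hN hw
  bracket_mem := by
    rintro _ ⟨f, hf, rfl⟩ g
    obtain ⟨g, rfl⟩ := polyProj_surjective g
    obtain ⟨h, hh⟩ := polyProj_surjective (stageBracket N (polyProj K m p f) (polyProj K m p g))
    refine ⟨h, ?_, hh⟩
    rw [Set.mem_ofPred_eq, mem_stageKernel] at hf ⊢
    rw [lift_restored_of_polyProj_eq_stageBracket hw hN hh]
    exact torusBracket_mem_induced hf _

/-! ### Poisson ideals under the steps of the algorithm -/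

section Steps

variable {N : ℕ} {I I' : TwoSidedIdeal (FreeAlgebra K (Fin m × Fin p))}

/-- The bracket of the pivot with the entry at `(i, j)` is `-2` times this product, and `2` is
invertible. -/
theorem PoissonStageIdeal.corner [CharZero K] (h : N < m * p) (hI : PoissonStageIdeal (N + 1) I)
    (ha : FreeAlgebra.ι K (indexAt h) ∈ I) {i : Fin m} (hi : i < (indexAt h).1) {j : Fin p}
    (hj : j < (indexAt h).2) :
    (MvPolynomial.X (i, (indexAt h).2) * MvPolynomial.X ((indexAt h).1, j)
      : MvPolynomial (Fin m × Fin p) K) ∈ polyIdeal I := by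
  have h1 := hI.bracket_mem _ ((polyProj_mem_polyIdeal h hI.stageIdeal).2 ha)
    (MvPolynomial.X (i, j))
  rw [FreeAlgebra.lift_ι_apply, stageBracket_X] at h1
  have h2 : stageTable K (N + 1) (indexAt h) (i, j) = 0 := by
    simp [stageTable, hi.ne', hj.not_gt, hi.not_gt]
  have h3 : stageTable K (N + 1) (i, j) (indexAt h) = MvPolynomial.C 2
      * (MvPolynomial.X (i, (indexAt h).2) * MvPolynomial.X ((indexAt h).1, j)) := by
    simp only [stageTable, hi, hi.ne, hj, hj.ne, mul_assoc, lexIndex_indexAt, map_ofNat]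
    simp
  rw [h2, h3, zero_sub, neg_mem_iff] at h1
  have h4 := Ideal.mul_mem_left _ (MvPolynomial.C (2⁻¹ : K)) h1
  rwa [← mul_assoc, ← map_mul, inv_mul_cancel₀ two_ne_zero, map_one, one_mul] at h4

/-- At `q = 1` the full torus is commutative, so a stage ideal that is prime is completely prime. -/
theorem StageIdeal.mem_or_mem {q : Kˣ} (hq : q = 1) (hI : StageIdeal q N I)
    {f g : FreeAlgebra K (Fin m × Fin p)} (h : f * g ∈ I) : f ∈ I ∨ g ∈ I := by
  subst hq
  refine hI.prime.2 f g fun r => (hI.mem_congr ?_).1 (I.mul_mem_left r _ h)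
  simp only [map_mul]; ring

theorem PoissonStageIdeal.pivotRegular [CharZero K] (h : N < m * p)
    (hI : PoissonStageIdeal (N + 1) I) : PivotRegular h I where
  corner ha i hi j hj := by
    rw [← polyProj_mem_polyIdeal h hI.stageIdeal]
    simpa using hI.corner h ha hi hj
  left ha _ hg := (hI.stageIdeal.mem_or_mem rfl hg).resolve_left ha
  right ha _ hg := (hI.stageIdeal.mem_or_mem rfl hg).resolve_right ha

/-- The brackets of consecutive stages differ only in terms whose larger index is the pivot, and
these are multiples of products of column and row entries, which lie in the ideal. -/
theorem PoissonStageIdeal.next_of_mem [CharZero K] (h : N < m * p)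
    (hI : PoissonStageIdeal (N + 1) I) (ha : FreeAlgebra.ι K (indexAt h) ∈ I)
    (hN : StageIdeal 1 N I) : PoissonStageIdeal N I where
  stageIdeal := hN
  bracket_mem f hf g := by
    rw [← sub_sub_cancel (stageBracket (N + 1) f g) (stageBracket N f g)]
    refine sub_mem (hI.bracket_mem f hf g) ?_
    simp only [stageBracket, ← Finset.sum_sub_distrib, ← sub_mul]
    refine sum_mem fun a _ => sum_mem fun b _ => Ideal.mul_mem_right _ _ ?_
    unfold stageTable
    by_cases h1 : (a.1 < b.1 ∧ a.2 = b.2) ∨ (a.1 = b.1 ∧ a.2 < b.2)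
    · simp [h1]
    by_cases h2 : a.1 < b.1 ∧ a.2 < b.2
    · rcases lt_trichotomy (lexIndex b) N with h3 | h3 | h3
      · simp [h2, h3, h3.le]
      · obtain rfl : indexAt h = b := lexIndex_injective (by rw [lexIndex_indexAt, h3])
        rw [if_neg h1, if_neg h1, if_pos ⟨h2, by omega⟩, if_neg (by omega), sub_zero, mul_assoc]
        exact Ideal.mul_mem_left _ _ (hI.corner h ha h2.1 h2.2)
      · rw [if_neg h1, if_neg h1, if_neg (by omega), if_neg (by omega), sub_zero]
        exact zero_mem _
    · simp [h1, h2]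

/-- Write `f` and `g` as fractions with numerators `F` and `G`. The fraction formula expresses `{f,
g}`, multiplied by a power of the pivot, through brackets of the earlier stage, and every term
contains `F` or a bracket with `F`. -/
theorem PoissonStageIdeal.next_of_notMem (h : N < m * p)
    (hI : PoissonStageIdeal (N + 1) I) (hn : IsNext 1 h I I')
    (ha : FreeAlgebra.ι K (indexAt h) ∉ I) (hN : StageIdeal 1 N I') : PoissonStageIdeal N I' where
  stageIdeal := hN
  bracket_mem := by
    rintro _ ⟨f, hf, rfl⟩ g
    obtain ⟨g, rfl⟩ := polyProj_surjective g
    obtain ⟨k, hk⟩ := polyProj_surjective (stageBracket N (polyProj K m p f) (polyProj K m p g))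
    refine ⟨k, ?_, hk⟩
    obtain ⟨M, F, hF⟩ := exists_lift_deleteStep_mul_pow 1 h f
    obtain ⟨M', G, hG⟩ := exists_lift_deleteStep_mul_pow 1 h g
    have eF := hF _ _ (pivotSetting_full 1 h)
    have eG := hG _ _ (pivotSetting_full 1 h)
    rw [deleteStep_restored] at eF eG
    have hFI : polyProj K m p F ∈ polyIdeal I := ⟨F, (hn.of_notMem ha f M F eF).1 hf, rfl⟩
    let X := FreeAlgebra.ι K (indexAt h : Fin m × Fin p)
    let br : FreeAlgebra K (Fin m × Fin p) → FreeAlgebra K (Fin m × Fin p) → MvPolynomial _ K :=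
      fun a b => stageBracket (N + 1) (polyProj K m p a) (polyProj K m p b)
    have hbr : ∀ b, br F b ∈ polyIdeal I := fun b => hI.bracket_mem _ hFI _
    obtain ⟨A, hA, eA⟩ := hbr G
    obtain ⟨A', hA', eA'⟩ := hbr X
    obtain ⟨A'', eA''⟩ := polyProj_surjective (br X G)
    have hle : N ≤ m * p := h.le
    have e := (isBiderivation_torusBracket (K := K)
      (b := torusForm (∅ : Finset (Fin m × Fin p)))).fraction
      (x := restored 1 ∅ (N + 1) (indexAt h)) (by simp [torusBracket])
      (FreeAlgebra.lift K (restored 1 ∅ N) f) (FreeAlgebra.lift K (restored 1 ∅ N) g) M M'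
    rw [← lift_restored_of_polyProj_eq_stageBracket (isCauchon_empty _) hle hk, eF, eG,
      ← FreeAlgebra.lift_ι_apply (R := K) (restored (1 : Kˣ) ∅ (N + 1)) (indexAt h),
      ← lift_restored_of_polyProj_eq_stageBracket (isCauchon_empty _) h eA,
      ← lift_restored_of_polyProj_eq_stageBracket (isCauchon_empty _) h eA',
      ← lift_restored_of_polyProj_eq_stageBracket (isCauchon_empty _) h eA''] at e
    refine (hn.of_notMem ha k (M + M' + 1) (X * A - M' * (G * A') - M * (F * A'')) ?_).2 ?_
    · simpa [X] using e
    · refine I.sub_mem (I.sub_mem (I.mul_mem_left _ _ hA) ?_) ?_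
      · exact I.mul_mem_left _ _ (I.mul_mem_left _ _ hA')
      · exact I.mul_mem_left _ _ (I.mul_mem_right _ _ ((hn.of_notMem ha f M F eF).1 hf))

theorem stageClass_poissonStageIdeal [CharZero K] :
    StageClass (K := K) (m := m) (p := p) 1 PoissonStageIdeal where
  stageIdeal _ h := h.stageIdeal
  regular h hI := hI.pivotRegular h
  next {N I I'} h hI hn hI' := by
    by_cases ha : FreeAlgebra.ι K (indexAt h) ∈ I
    · obtain rfl := hn.of_mem ha
      exact hI.next_of_mem h ha hI'
    · exact hI.next_of_notMem h hn ha hI'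

end Steps

theorem isCauchonBelow_of_le_one (w : Finset (Fin m × Fin p)) {N : ℕ} (hN : N ≤ 1) :
    IsCauchonBelow w N := by
  intro b _ hb
  have h0 : (b.2 : ℕ) = 0 := by rw [lexIndex_eq] at hb; omega
  exact Or.inl fun j hj => absurd (Fin.lt_def.1 hj) (by omega)

/-- Poisson prime ideals of the final algebra are induced from the Poisson center of a torus. -/
theorem exists_torusIdeal_eq_induced_of_poisson [CharZero K] {N : ℕ}
    {I : TwoSidedIdeal (FreeAlgebra K (Fin m × Fin p))} {w : Finset (Fin m × Fin p)}
    (hI : PoissonStageIdeal N I) (hN : N ≤ 1) (hN' : N ≤ m * p)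
    (hw : ∀ b, FreeAlgebra.ι K b ∈ I ↔ b ∈ w) {s : ℕ}
    (D : QTorus.RadicalChart (torusForm w) s) : ∃ 𝔭 : PrimeSpectrum (LaurentRing K s),
      torusIdeal hI.stageIdeal hN hw = QTorus.induced D 𝔭.asIdeal := by
  refine exists_torusIdeal_eq_induced hI.stageIdeal hN hw D
    (fun (a : {a // a ∉ w}) γ => ((∑ c, lambdaInt a.1 c.1 * γ c : ℤ) : K))
    (fun a z hz => ?_) (fun a γ hγ => ?_) (fun γ hγ => ?_)
  -- Bracketing with the generator `T_a` is the diagonal operator followed by multiplication with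
  -- the unit `T_a`.
  · have h1 : QTorus.T 1 (torusForm w) (Pi.single a 1) * QTorus.lin (fun α : Exponent w =>
        ((∑ c, lambdaInt a.1 c.1 * α c : ℤ) : K) • QTorus.T 1 (torusForm w) α) z
        = torusBracket K (torusForm w) (QTorus.T 1 (torusForm w) (Pi.single a 1)) z := by
      clear hz
      induction z using QTorus.induction_linear with
      | h0 => simp
      | hadd f g hf hg => rw [map_add, mul_add, hf, hg, map_add]
      | hT c α =>
        rw [map_smul, QTorus.lin_T, ← torusForm_single_sub, map_smul, torusBracket_T,
          mul_smul_comm, mul_smul_comm, QTorus.T_mul_of_one]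
    obtain ⟨s, hs, f, hf, e⟩ := hz
    obtain ⟨k, hk, ek⟩ := hI.bracket_mem _ ⟨f, hf, rfl⟩ (MvPolynomial.X a.1)
    have h2 := lift_restored_of_polyProj_eq_stageBracket (f := f) (g := FreeAlgebra.ι K a.1)
      (isCauchonBelow_of_le_one w hN) hN' (by rw [ek, FreeAlgebra.lift_ι_apply])
    have h3 := (lift_mem_torusIdeal hI.stageIdeal hN hw _).2 hk
    have hz : z ∈ torusIdeal hI.stageIdeal hN hw := ⟨s, hs, f, hf, e⟩
    rw [restored_of_le_one _ _ hN, FreeAlgebra.lift_ι_apply, torusGen_of_notMem a.2,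
      torusBracket_skew, ← e, isBiderivation_torusBracket.mul_right] at h2
    rw [h2, neg_mem_iff] at h3
    -- By the Leibniz rule the bracket of `T_a` with `z` times the denominator has two summands; the
    -- one containing `z` as a factor is in the ideal, so the other one is as well.
    have h4 := (Ideal.add_mem_iff_right _ (Ideal.mul_mem_right _ _ hz)).1 h3
    rw [← h1] at h4
    obtain ⟨x, hx⟩ := isUnit_lift_freeMonomials (q := 1) hs
    obtain ⟨y, hy⟩ := QTorus.isUnit_T (q := (1 : Kˣ)) (b := torusForm w) (Pi.single a 1)
    rw [← hx, ← hy] at h4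
    have h5 := Ideal.mul_mem_left _ y⁻¹.val (Ideal.mul_mem_left _ x⁻¹.val h4)
    rwa [Units.inv_mul_cancel_left, Units.inv_mul_cancel_left] at h5
  · rw [mem_range_emb_iff] at hγ
    simp [hγ a]
  · rw [mem_range_emb_iff] at hγ
    push Not at hγ
    obtain ⟨a, ha⟩ := hγ
    refine ⟨a, ?_⟩
    simpa using (Int.cast_ne_zero (α := K)).2 ha

end

end DeletingDerivations

namespace DeletingDerivations

noncomputable section

/-! ## Strata -/

universe u

variable {m p : ℕ} {K : Type u} [Field K]

/-- The torus consists of fractions not only of its own generators but of each restored family,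
since denominators can be carried through one step at a time. -/
theorem exists_mul_lift_restored (q : Kˣ) {w : Finset (Fin m × Fin p)} {N : ℕ} (hN : N ≤ m * p)
    (hw : IsCauchonBelow w N) (z : DiagramTorus q w) :
    ∃ s f : FreeAlgebra K (Fin m × Fin p), IsUnit (FreeAlgebra.lift K (restored q w N) s) ∧
      z * FreeAlgebra.lift K (restored q w N) s = FreeAlgebra.lift K (restored q w N) f := by
  induction N with
  | zero =>
    obtain ⟨s, hs, f, e⟩ := exists_mul_lift_torusGen q z
    exact ⟨s, f, isUnit_lift_freeMonomials hs, e⟩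
  | succ N ih =>
    have h : N < m * p := hN
    obtain ⟨s, f, hs, e⟩ := ih h.le (hw.mono N.le_succ)
    by_cases ha : indexAt h ∈ w
    · have : restored q w (N + 1) = restored q w N := by
        rw [restored_succ h, restoreStep_of_eq_zero]
        rw [restored_pivot, torusGen_of_mem ha]
      rw [this]
      exact ⟨s, f, hs, e⟩
    · have hS := pivotSetting_restored q hw h ha
      obtain ⟨M, s', hs'⟩ := exists_lift_deleteStep_mul_pow q h s
      obtain ⟨M', f', hf'⟩ := exists_lift_deleteStep_mul_pow q h f
      have e1 := hs' _ _ hS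
      have e2 := hf' _ _ hS
      rw [deleteStep_restored] at e1 e2
      refine ⟨s' * FreeAlgebra.ι K (indexAt h) ^ M', f' * FreeAlgebra.ι K (indexAt h) ^ M, ?_, ?_⟩
      · rw [map_mul, map_pow, FreeAlgebra.lift_ι_apply, ← e1]
        exact (hs.mul (hS.unit.pow _)).mul (hS.unit.pow _)
      · rw [map_mul, map_mul, map_pow, map_pow, FreeAlgebra.lift_ι_apply, ← e1, ← e2, ← e,
          mul_assoc _ (_ ^ M), mul_assoc _ (_ ^ M'), ← pow_add, ← pow_add, add_comm M',
          mul_assoc]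

/-- A class of ideals whose final members are induced from the centers of quantum tori. -/
structure TorusClass (q : Kˣ) (G : ℕ → TwoSidedIdeal (FreeAlgebra K (Fin m × Fin p)) → Prop) :
    Prop extends StageClass q G where
  stageKernel_mem : ∀ {N} (w : Finset (Fin m × Fin p)) (𝔭 : PrimeSpectrum (LaurentRing K _)),
    N ≤ m * p → IsCauchonBelow w N → G N (stageKernel (radicalChart w) q N 𝔭.asIdeal)
  exists_stageKernel : ∀ {N I}, N ≤ 1 → N ≤ m * p → G N I →
    ∃ w, ∃ 𝔭 : PrimeSpectrum (LaurentRing K _), I = stageKernel (radicalChart w) q N 𝔭.asIdeal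

theorem StageIdeal.eq_stageKernel {q : Kˣ} {N : ℕ}
    {I : TwoSidedIdeal (FreeAlgebra K (Fin m × Fin p))} {w : Finset (Fin m × Fin p)}
    (hI : StageIdeal q N I) (hN : N ≤ 1) (hw : ∀ b, FreeAlgebra.ι K b ∈ I ↔ b ∈ w) {s : ℕ}
    {D : QTorus.RadicalChart (torusForm w) s} {𝔭 : Ideal (LaurentRing K s)}
    (h : torusIdeal hI hN hw = QTorus.induced D 𝔭) : I = stageKernel D q N 𝔭 := by
  ext f
  rw [mem_stageKernel, ← h, restored_of_le_one q w hN, lift_mem_torusIdeal]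

theorem exists_finset_ι_mem_iff (I : TwoSidedIdeal (FreeAlgebra K (Fin m × Fin p))) :
    ∃ w : Finset (Fin m × Fin p), ∀ b, FreeAlgebra.ι K b ∈ I ↔ b ∈ w := by
  classical
  exact ⟨Finset.univ.filter fun b => FreeAlgebra.ι K b ∈ I, by simp⟩

theorem torusClass_stageIdeal {q : Kˣ} (hq : ∀ n : ℕ, 0 < n → (q : K) ^ n ≠ 1) :
    TorusClass (m := m) (p := p) q (StageIdeal q) where
  toStageClass := stageClass_stageIdeal hq
  stageKernel_mem _ _ hN hw := stageIdeal_stageKernel hN hw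
  exists_stageKernel {_ I} hN _ hI := by
    obtain ⟨w, hw⟩ := exists_finset_ι_mem_iff I
    obtain ⟨𝔭, h𝔭⟩ := exists_torusIdeal_eq_induced_of_not_root hq hI hN hw (radicalChart w)
    exact ⟨w, 𝔭, hI.eq_stageKernel hN hw h𝔭⟩

theorem torusClass_poissonStageIdeal [CharZero K] :
    TorusClass (K := K) (m := m) (p := p) 1 PoissonStageIdeal where
  toStageClass := stageClass_poissonStageIdeal
  stageKernel_mem _ _ hN hw := poissonStageIdeal_stageKernel hN hw
  exists_stageKernel {_ I} hN hN' hI := by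
    obtain ⟨w, hw⟩ := exists_finset_ι_mem_iff I
    obtain ⟨𝔭, h𝔭⟩ := exists_torusIdeal_eq_induced_of_poisson hI hN hN' hw (radicalChart w)
    exact ⟨w, 𝔭, hI.stageIdeal.eq_stageKernel hN hw h𝔭⟩

/-! ### Parametrization of the strata by Laurent spectra -/

section Strata

variable {q : Kˣ} {G : ℕ → TwoSidedIdeal (FreeAlgebra K (Fin m × Fin p)) → Prop}

theorem TorusClass.isChain_stageKernel (hG : TorusClass q G) {w : Finset (Fin m × Fin p)}
    (hw : IsCauchonBelow w (m * p)) (𝔭 : PrimeSpectrum (LaurentRing K (diagramNullity w))) :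
    IsChain q G fun N => stageKernel (radicalChart w) q N 𝔭.asIdeal where
  mem _ hN := hG.stageKernel_mem w 𝔭 hN (hw.mono hN)
  next _ h := isNext_stageKernel h (hw.mono h)

theorem TorusClass.exists_eq_stageKernel (hG : TorusClass q G)
    {I : TwoSidedIdeal (FreeAlgebra K (Fin m × Fin p))} (hI : G (m * p) I) :
    ∃ w, ∃ 𝔭 : PrimeSpectrum (LaurentRing K (diagramNullity w)), IsCauchonBelow w (m * p) ∧
      I = stageKernel (radicalChart w) q (m * p) 𝔭.asIdeal := by
  obtain ⟨J, hJ, rfl⟩ := hG.toStageClass.exists_isChain hI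
  have h1 : m * p - (m * p - 1) ≤ 1 := by omega
  have h2 : m * p - (m * p - 1) ≤ m * p := Nat.sub_le _ _
  obtain ⟨w, 𝔭, e⟩ := hG.exists_stageKernel h1 h2 (hJ.mem _ h2)
  obtain ⟨e', hw⟩ := chain_eq_stageKernel hG.toStageClass hJ e (isCauchonBelow_of_le_one w h1) h2
    le_rfl
  exact ⟨w, 𝔭, hw, e'⟩

variable {L : Type u} [Ring L] [Algebra K L] {X : Fin m × Fin p → L}

/-- The ideal `I` belongs to the stratum of `w`. -/
def InStratum (X : Fin m × Fin p → L) (w : Finset (Fin m × Fin p))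
    (I : TwoSidedIdeal (FreeAlgebra K (Fin m × Fin p))) : Prop :=
  ∀ b, finalGens X b ∈ canonicalEmbedding K X (FreeAlgebra.lift K X '' {f | f ∈ I}) ↔ b ∈ w

theorem InStratum.unique {w w' : Finset (Fin m × Fin p)}
    {I : TwoSidedIdeal (FreeAlgebra K (Fin m × Fin p))} (h : InStratum X w I)
    (h' : InStratum X w' I) : w = w' := Finset.ext fun b => (h b).symm.trans (h' b)

theorem TorusClass.inStratum_stageKernel (hG : TorusClass q G) (hX : StageModel q (m * p) X)
    {w : Finset (Fin m × Fin p)} (hw : IsCauchonBelow w (m * p))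
    (𝔭 : PrimeSpectrum (LaurentRing K (diagramNullity w))) :
    InStratum X w (stageKernel (radicalChart w) q (m * p) 𝔭.asIdeal) := fun b => by
  refine (hX.finalGens_mem_iff hG.toStageClass (hG.isChain_stageKernel hw 𝔭) b).trans ?_
  rw [mem_stageKernel, restored_of_le_one q w (by omega), FreeAlgebra.lift_ι_apply,
    torusGen_mem_induced_iff 𝔭.isPrime.ne_top]

theorem TorusClass.eq_stageKernel_of_inStratum (hG : TorusClass q G)
    (hX : StageModel q (m * p) X) {w : Finset (Fin m × Fin p)}
    {I : TwoSidedIdeal (FreeAlgebra K (Fin m × Fin p))} (hI : G (m * p) I)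
    (h : InStratum X w I) : ∃ 𝔭 : PrimeSpectrum (LaurentRing K (diagramNullity w)),
      IsCauchonBelow w (m * p) ∧ I = stageKernel (radicalChart w) q (m * p) 𝔭.asIdeal := by
  obtain ⟨w', 𝔭, hw, rfl⟩ := hG.exists_eq_stageKernel hI
  obtain rfl := h.unique (hG.inStratum_stageKernel hX hw 𝔭)
  exact ⟨𝔭, hw, rfl⟩

/-- A central element is a fraction with numerator coming from the free algebra and invertible
denominator, so its membership in the prime of the center can be read off from the numerator. -/
theorem stageKernel_injective {w : Finset (Fin m × Fin p)} (hw : IsCauchonBelow w (m * p))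
    {𝔭 𝔭' : PrimeSpectrum (LaurentRing K (diagramNullity w))}
    (h : stageKernel (radicalChart w) q (m * p) 𝔭.asIdeal
      = stageKernel (radicalChart w) q (m * p) 𝔭'.asIdeal) : 𝔭 = 𝔭' := by
  ext z
  obtain ⟨s, f, hs, e⟩ := exists_mul_lift_restored q le_rfl hw
    (QTorus.fromLaurent (radicalChart w) q z)
  have key : ∀ 𝔮 : PrimeSpectrum (LaurentRing K (diagramNullity w)),
      z ∈ 𝔮.asIdeal ↔ f ∈ stageKernel (radicalChart w) q (m * p) 𝔮.asIdeal := fun 𝔮 => by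
    rw [mem_stageKernel, ← e, mul_unit_mem_induced hs, QTorus.fromLaurent_mem_induced]
  rw [key, key, h]

/-- A topological space of ideals of the free algebra with its Zariski topology. -/
structure IdealSpace (G : ℕ → TwoSidedIdeal (FreeAlgebra K (Fin m × Fin p)) → Prop)
    {S : Type*} [TopologicalSpace S] (ι : S → TwoSidedIdeal (FreeAlgebra K (Fin m × Fin p))) :
    Prop where
  injective : Function.Injective ι
  mem : ∀ P, G (m * p) (ι P)
  surj : ∀ I, G (m * p) I → ∃ P, ι P = I
  isClosed_iff : ∀ Z : Set S, IsClosed Z ↔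
    ∃ T : Set (FreeAlgebra K (Fin m × Fin p)), Z = {P | ∀ f ∈ T, f ∈ ι P}

variable {S : Type*} [TopologicalSpace S]
  {ι : S → TwoSidedIdeal (FreeAlgebra K (Fin m × Fin p))}

/-- The point of the spectrum attached to a point of a torus. -/
def spectrumPoint (hS : IdealSpace G ι) (hG : TorusClass q G) {w : Finset (Fin m × Fin p)}
    (hw : IsCauchonBelow w (m * p)) (𝔭 : PrimeSpectrum (LaurentRing K (diagramNullity w))) : S :=
  (hS.surj _ (hG.stageKernel_mem w 𝔭 le_rfl hw)).choose

theorem ι_spectrumPoint (hS : IdealSpace G ι) (hG : TorusClass q G) {w : Finset (Fin m × Fin p)}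
    (hw : IsCauchonBelow w (m * p)) (𝔭 : PrimeSpectrum (LaurentRing K (diagramNullity w))) :
    ι (spectrumPoint hS hG hw 𝔭) = stageKernel (radicalChart w) q (m * p) 𝔭.asIdeal :=
  (hS.surj _ (hG.stageKernel_mem w 𝔭 le_rfl hw)).choose_spec

theorem continuous_spectrumPoint (hS : IdealSpace G ι) (hG : TorusClass q G)
    {w : Finset (Fin m × Fin p)} (hw : IsCauchonBelow w (m * p)) :
    Continuous (spectrumPoint hS hG hw) := by
  rw [continuous_iff_isClosed]
  intro Z hZ
  obtain ⟨T, rfl⟩ := (hS.isClosed_iff Z).1 hZ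
  rw [PrimeSpectrum.isClosed_iff_zeroLocus]
  refine ⟨{z | ∃ f ∈ T, ∃ g, z = QTorus.toLaurent (radicalChart w) q
    (g * FreeAlgebra.lift K (restored q w (m * p)) f)}, ?_⟩
  ext 𝔭
  simp only [Set.mem_preimage, Set.mem_ofPred_eq, PrimeSpectrum.mem_zeroLocus, ι_spectrumPoint,
    mem_stageKernel, QTorus.mem_induced]
  constructor
  · rintro h _ ⟨f, hf, g, rfl⟩; exact h f hf g
  · intro h f hf g; exact h ⟨f, hf, g, rfl⟩

/-- The bijection between the spectrum of a Laurent polynomial ring and a stratum. -/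
def stratumEquiv (hS : IdealSpace G ι) (hG : TorusClass q G) (hX : StageModel q (m * p) X)
    {w : Finset (Fin m × Fin p)} (hw : IsCauchonBelow w (m * p)) :
    PrimeSpectrum (LaurentRing K (diagramNullity w)) ≃ {P : S // InStratum X w (ι P)} :=
  Equiv.ofBijective
    (fun 𝔭 => ⟨spectrumPoint hS hG hw 𝔭, by
      rw [ι_spectrumPoint hS hG hw]; exact hG.inStratum_stageKernel hX hw 𝔭⟩)
    ⟨fun 𝔭 𝔭' h => by
      have h1 := congrArg (fun P => ι P.1) h
      simp only [ι_spectrumPoint hS hG hw] at h1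
      exact stageKernel_injective hw h1,
    fun P => by
      obtain ⟨𝔭, _, e⟩ := hG.eq_stageKernel_of_inStratum hX (hS.mem P.1) P.2
      exact ⟨𝔭, Subtype.ext (hS.injective (by rw [ι_spectrumPoint hS hG hw, e]))⟩⟩

theorem stratumEquiv_coe (hS : IdealSpace G ι) (hG : TorusClass q G) (hX : StageModel q (m * p) X)
    {w : Finset (Fin m × Fin p)} (hw : IsCauchonBelow w (m * p))
    (𝔭 : PrimeSpectrum (LaurentRing K (diagramNullity w))) :
    (stratumEquiv hS hG hX hw 𝔭 : S) = spectrumPoint hS hG hw 𝔭 := rfl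

/-- The homeomorphism between the spectrum of a Laurent polynomial ring and a stratum. -/
def stratumHomeomorph (hS : IdealSpace G ι) (hG : TorusClass q G) (hX : StageModel q (m * p) X)
    {w : Finset (Fin m × Fin p)} (hw : IsCauchonBelow w (m * p)) :
    PrimeSpectrum (LaurentRing K (diagramNullity w)) ≃ₜ {P : S // InStratum X w (ι P)} where
  toEquiv := stratumEquiv hS hG hX hw
  continuous_toFun := (continuous_spectrumPoint hS hG hw).subtype_mk _
  continuous_invFun := by
    rw [continuous_iff_isClosed]
    intro Z hZ
    obtain ⟨T, rfl⟩ := (PrimeSpectrum.isClosed_iff_zeroLocus Z).1 hZ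
    -- The image of the zero locus of `T` is cut out by the numerators of the central elements
    -- attached to the members of `T`.
    choose s f hs e using fun z => exists_mul_lift_restored q le_rfl hw
      (QTorus.fromLaurent (radicalChart w) q z)
    have hcl := (hS.isClosed_iff {P | ∀ g ∈ f '' T, g ∈ ι P}).2 ⟨_, rfl⟩
    convert hcl.preimage continuous_subtype_val using 1
    ext P
    obtain ⟨𝔭, rfl⟩ := (stratumEquiv hS hG hX hw).surjective P
    have key : ∀ z, f z ∈ stageKernel (radicalChart w) q (m * p) 𝔭.asIdeal ↔ z ∈ 𝔭.asIdeal :=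
      fun z => by
        rw [mem_stageKernel, ← e, mul_unit_mem_induced (hs z), QTorus.fromLaurent_mem_induced]
    rw [Set.mem_preimage, Equiv.invFun_as_coe, Equiv.symm_apply_apply]
    simp only [Set.mem_preimage, Set.mem_ofPred_eq, Set.forall_mem_image, stratumEquiv_coe,
      ι_spectrumPoint hS hG hw, key]
    rfl

/-- The spectrum is the disjoint union of its strata. -/
def spectrumEquiv (hS : IdealSpace G ι) (hG : TorusClass q G) (hX : StageModel q (m * p) X) :
    (Σ w : {w : Finset (Fin m × Fin p) // IsCauchonBelow w (m * p)},
      PrimeSpectrum (LaurentRing K (diagramNullity w.1))) ≃ S :=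
  Equiv.ofBijective (fun x => spectrumPoint hS hG x.1.2 x.2)
    ⟨fun ⟨⟨w, hw⟩, 𝔭⟩ ⟨⟨w', hw'⟩, 𝔭'⟩ h => by
      have h1 := congrArg ι h
      simp only [ι_spectrumPoint hS hG hw, ι_spectrumPoint hS hG hw'] at h1
      have h2 := hG.inStratum_stageKernel hX hw 𝔭
      rw [h1] at h2
      obtain rfl := h2.unique (hG.inStratum_stageKernel hX hw' 𝔭')
      rw [stageKernel_injective hw h1],
    fun P => by
      obtain ⟨w, 𝔭, hw, e⟩ := hG.exists_eq_stageKernel (hS.mem P)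
      exact ⟨⟨⟨w, hw⟩, 𝔭⟩, hS.injective (by rw [ι_spectrumPoint hS hG hw, e])⟩⟩

/-- The criterion mentions neither `q` nor the class of ideals, which is why both sides have the
same diagrams. Nonemptiness holds since a Laurent ring has a prime ideal. -/
theorem exists_inStratum_iff (hS : IdealSpace G ι) (hG : TorusClass q G)
    (hX : StageModel q (m * p) X) (w : Finset (Fin m × Fin p)) :
    (∃ P, InStratum X w (ι P)) ↔ IsCauchonBelow w (m * p) := by
  constructor
  · rintro ⟨P, hP⟩
    obtain ⟨𝔭, hw, -⟩ := hG.eq_stageKernel_of_inStratum hX (hS.mem P) hP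
    exact hw
  · intro hw
    obtain ⟨𝔭⟩ := (inferInstance : Nonempty (PrimeSpectrum (LaurentRing K (diagramNullity w))))
    exact ⟨_, (stratumEquiv hS hG hX hw 𝔭).2⟩

end Strata

/-! ### Two-sided ideals under surjective homomorphisms -/

section Images

variable {A : Type*} [Ring A] {F : Type*} [Ring F]

/-- The image of an ideal under a surjective homomorphism. -/
def imageIdeal (φ : F →+* A) (hφ : Function.Surjective φ) (I : TwoSidedIdeal F) :
    TwoSidedIdeal A :=
  TwoSidedIdeal.mk' {a | ∃ f ∈ I, φ f = a} ⟨0, I.zero_mem, map_zero φ⟩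
    (fun ⟨f, hf, e⟩ ⟨g, hg, e'⟩ => ⟨f + g, I.add_mem hf hg, by rw [map_add, e, e']⟩)
    (fun ⟨f, hf, e⟩ => ⟨-f, I.neg_mem hf, by rw [map_neg, e]⟩)
    (fun {x _} ⟨f, hf, e⟩ => by
      obtain ⟨x, rfl⟩ := hφ x
      exact ⟨x * f, I.mul_mem_left _ _ hf, by rw [map_mul, e]⟩)
    (fun {_ x} ⟨f, hf, e⟩ => by
      obtain ⟨x, rfl⟩ := hφ x
      exact ⟨f * x, I.mul_mem_right _ _ hf, by rw [map_mul, e]⟩)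

theorem map_mem_imageIdeal {φ : F →+* A} (hφ : Function.Surjective φ) {I : TwoSidedIdeal F}
    (hI : ∀ f, φ f = 0 → f ∈ I) {f : F} : φ f ∈ imageIdeal φ hφ I ↔ f ∈ I := by
  refine (TwoSidedIdeal.mem_mk' ..).trans ?_
  refine ⟨fun ⟨g, hg, e⟩ => ?_, fun hf => ⟨f, hf, rfl⟩⟩
  have h1 : f - g ∈ I := hI _ (by rw [map_sub, e, sub_self])
  have h2 := I.add_mem h1 hg
  rwa [sub_add_cancel] at h2

theorem TwoSidedIdealIsPrime.comap {φ : F →+* A} (hφ : Function.Surjective φ)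
    {P : TwoSidedIdeal A} : TwoSidedIdealIsPrime (P.comap φ) ↔ TwoSidedIdealIsPrime P := by
  unfold TwoSidedIdealIsPrime
  simp only [TwoSidedIdeal.mem_comap, map_one, hφ.forall, map_mul]

theorem imageIdeal_comap {φ : F →+* A} (hφ : Function.Surjective φ) {I : TwoSidedIdeal F}
    (hI : ∀ f, φ f = 0 → f ∈ I) : (imageIdeal φ hφ I).comap φ = I := by
  ext f
  rw [TwoSidedIdeal.mem_comap, map_mem_imageIdeal hφ hI]

end Images

/-! ### The two spectra as spaces of ideals of the free algebra -/

theorem NCSpec.isClosed_iff {R : Type*} [Ring R] (Z : Set (NCSpec R)) :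
    IsClosed Z ↔ ∃ T, Z = NCSpec.zeroLocus T := by
  rw [← isOpen_compl_iff]
  change Zᶜᶜ ∈ Set.range NCSpec.zeroLocus ↔ _
  rw [compl_compl]
  exact ⟨fun ⟨T, h⟩ => ⟨T, h.symm⟩, fun ⟨T, h⟩ => ⟨T, h.symm⟩⟩

/-- The ideal of the free algebra attached to a prime ideal of quantum matrices. -/
def quantumPullback (q : Kˣ) (P : NCSpec (QuantumMatrices (q : K) m p)) :
    TwoSidedIdeal (FreeAlgebra K (Fin m × Fin p)) :=
  P.1.comap (quantumProj q m p : FreeAlgebra K (Fin m × Fin p) →+* _)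

theorem mem_quantumPullback {q : Kˣ} {P : NCSpec (QuantumMatrices (q : K) m p)}
    {f : FreeAlgebra K (Fin m × Fin p)} : f ∈ quantumPullback q P ↔ quantumProj q m p f ∈ P.1 :=
  TwoSidedIdeal.mem_comap _

theorem idealSpace_quantum (q : Kˣ) :
    IdealSpace (StageIdeal q) (quantumPullback (m := m) (p := p) q) where
  injective P P' h := by
    refine Subtype.ext (TwoSidedIdeal.ext fun r => ?_)
    obtain ⟨f, rfl⟩ := quantumProj_surjective r
    rw [← mem_quantumPullback, ← mem_quantumPullback, h]
  mem P :=
    { ker := fun f hf => by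
        rw [mem_quantumPullback, quantumProj_eq_zero_iff.2 hf]; exact P.1.zero_mem
      prime := (TwoSidedIdealIsPrime.comap quantumProj_surjective).2 P.2 }
  surj I hI := by
    have h1 := imageIdeal_comap (φ := (quantumProj q m p : _ →+* QuantumMatrices (q : K) m p))
      quantumProj_surjective fun f hf => hI.ker f (quantumProj_eq_zero_iff.1 hf)
    exact ⟨⟨_, (TwoSidedIdealIsPrime.comap quantumProj_surjective).1 (h1.symm ▸ hI.prime)⟩, h1⟩
  isClosed_iff Z := by
    rw [NCSpec.isClosed_iff]
    simp only [mem_quantumPullback]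
    constructor
    · rintro ⟨T, rfl⟩
      refine ⟨quantumProj q m p ⁻¹' T, ?_⟩
      ext P
      refine ⟨fun h f hf => h _ hf, fun h r hr => ?_⟩
      obtain ⟨f, rfl⟩ := quantumProj_surjective r
      exact h f hr
    · rintro ⟨T, rfl⟩
      refine ⟨quantumProj q m p '' T, ?_⟩
      ext P
      exact (Set.forall_mem_image (f := quantumProj q m p) (p := fun r => r ∈ P.1)).symm

theorem inStratum_quantumPullback_iff (q : Kˣ) {w : Finset (Fin m × Fin p)}
    {P : NCSpec (QuantumMatrices (q : K) m p)} :
    InStratum (quantumGens (q : K) m p) w (quantumPullback q P)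
      ↔ P ∈ quantumStratum (q : K) m p w := by
  have : FreeAlgebra.lift K (quantumGens (q : K) m p) '' {f | f ∈ quantumPullback q P}
      = SkewFractions.of K '' {r | r ∈ P.1} := by
    ext x
    constructor
    · rintro ⟨f, hf, rfl⟩
      exact ⟨_, mem_quantumPullback.1 hf, (lift_quantumGens f).symm⟩
    · rintro ⟨r, hr, rfl⟩
      obtain ⟨f, rfl⟩ := quantumProj_surjective r
      exact ⟨f, mem_quantumPullback.2 hr, lift_quantumGens f⟩
  rw [InStratum, this]; rfl

/-- The ideal of the free algebra attached to a Poisson prime ideal. -/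
def poissonPullback (P : PoissonSpec K m p) : TwoSidedIdeal (FreeAlgebra K (Fin m × Fin p)) :=
  TwoSidedIdeal.mk' {f | polyProj K m p f ∈ P.1.asIdeal}
    (by simp) (fun {f g} hf hg => by
      simp only [Set.mem_ofPred_eq, map_add] at hf hg ⊢; exact add_mem hf hg)
    (fun {f} hf => by simp only [Set.mem_ofPred_eq, map_neg] at hf ⊢; exact neg_mem hf)
    (fun {f g} hg => by
      simp only [Set.mem_ofPred_eq, map_mul] at hg ⊢; exact Ideal.mul_mem_left _ _ hg)
    (fun {f g} hf => by
      simp only [Set.mem_ofPred_eq, map_mul] at hf ⊢; exact Ideal.mul_mem_right _ _ hf)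

theorem mem_poissonPullback {P : PoissonSpec K m p} {f : FreeAlgebra K (Fin m × Fin p)} :
    f ∈ poissonPullback P ↔ polyProj K m p f ∈ P.1.asIdeal := by
  rw [poissonPullback, TwoSidedIdeal.mem_mk']; rfl

theorem polyIdeal_poissonPullback (P : PoissonSpec K m p) :
    polyIdeal (poissonPullback P) = P.1.asIdeal := by
  ext x
  constructor
  · rintro ⟨f, hf, rfl⟩; exact mem_poissonPullback.1 hf
  · intro hx
    obtain ⟨f, rfl⟩ := polyProj_surjective x
    exact ⟨f, mem_poissonPullback.2 hx, rfl⟩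

theorem matrixPoissonBracket_skew (f g : MvPolynomial (Fin m × Fin p) K) :
    matrixPoissonBracket f g = -matrixPoissonBracket g f := by
  simp only [matrixPoissonBracket, ← Finset.sum_neg_distrib]
  exact Finset.sum_congr rfl fun a _ => Finset.sum_congr rfl fun b _ => by ring

theorem idealSpace_poisson :
    IdealSpace PoissonStageIdeal (poissonPullback (K := K) (m := m) (p := p)) where
  injective P P' h := by
    refine Subtype.ext (PrimeSpectrum.ext ?_)
    rw [← polyIdeal_poissonPullback, ← polyIdeal_poissonPullback, h]
  mem P :=
    { stageIdeal :=
        { ker := fun f hf => by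
            rw [mem_poissonPullback, (polyProj_eq_zero_iff le_rfl).2 hf]; exact zero_mem _
          prime := by
            refine ⟨fun h => ?_, fun a b h => ?_⟩
            · rw [mem_poissonPullback, map_one] at h
              exact P.1.isPrime.one_notMem h
            · have h1 := h 1
              rw [mul_one, mem_poissonPullback, map_mul] at h1
              rw [mem_poissonPullback, mem_poissonPullback]
              exact P.1.isPrime.mem_or_mem h1 }
      bracket_mem := fun f hf g => by
        rw [polyIdeal_poissonPullback] at hf ⊢
        rw [stageBracket_full, matrixPoissonBracket_skew, neg_mem_iff]
        exact P.2 g f hf }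
  surj I hI := by
    have hmem := fun f => polyProj_mem_polyIdeal le_rfl hI.stageIdeal (f := f)
    refine ⟨⟨⟨polyIdeal I, ⟨?_, ?_⟩⟩, fun f g hg => ?_⟩, ?_⟩
    · rw [Ne, Ideal.eq_top_iff_one, ← map_one (polyProj K m p), hmem]
      exact hI.stageIdeal.prime.1
    · intro x y hxy
      obtain ⟨f, rfl⟩ := polyProj_surjective x
      obtain ⟨g, rfl⟩ := polyProj_surjective y
      rw [← map_mul, hmem] at hxy
      rw [hmem, hmem]
      exact hI.stageIdeal.mem_or_mem rfl hxy
    · rw [matrixPoissonBracket_skew, neg_mem_iff, ← stageBracket_full]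
      exact hI.bracket_mem g hg f
    · ext f
      rw [mem_poissonPullback, hmem]
  isClosed_iff Z := by
    rw [isClosed_induced_iff]
    simp only [mem_poissonPullback, PrimeSpectrum.isClosed_iff_zeroLocus]
    constructor
    · rintro ⟨_, ⟨T, rfl⟩, rfl⟩
      refine ⟨polyProj K m p ⁻¹' T, ?_⟩
      ext P
      refine ⟨fun h f hf => h hf, fun h r hr => ?_⟩
      obtain ⟨f, rfl⟩ := polyProj_surjective r
      exact h f hr
    · rintro ⟨T, rfl⟩
      refine ⟨_, ⟨polyProj K m p '' T, rfl⟩, ?_⟩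
      ext P
      exact Set.forall_mem_image (f := polyProj K m p) (p := fun r => r ∈ P.1.asIdeal)

theorem inStratum_poissonPullback_iff {w : Finset (Fin m × Fin p)} {P : PoissonSpec K m p} :
    InStratum (poissonGens K m p) w (poissonPullback P) ↔ P ∈ poissonStratum K m p w := by
  have : FreeAlgebra.lift K (poissonGens K m p) '' {f | f ∈ poissonPullback P}
      = algebraMap (MvPolynomial (Fin m × Fin p) K)
          (FractionRing (MvPolynomial (Fin m × Fin p) K)) '' {f | f ∈ P.1.asIdeal} := by
    ext x
    constructor
    · rintro ⟨f, hf, rfl⟩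
      exact ⟨_, mem_poissonPullback.1 hf, (lift_poissonGens f).symm⟩
    · rintro ⟨r, hr, rfl⟩
      obtain ⟨f, rfl⟩ := polyProj_surjective r
      exact ⟨f, mem_poissonPullback.2 hr, lift_poissonGens f⟩
  rw [InStratum, this]; rfl

end

end DeletingDerivations

/-! ### Comparison of the two sides -/

theorem mainTheorem5 {K : Type*} [Field K] [CharZero K] (q : K) (hq0 : q ≠ 0)
    (hq : ∀ n : ℕ, 0 < n → q ^ n ≠ 1) (m p : ℕ) :
    quantumDiagrams q m p = poissonDiagrams K m p ∧
    (∀ w ∈ quantumDiagrams q m p,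
      Nonempty (poissonStratum K m p w ≃ₜ PrimeSpectrum (LaurentRing K (diagramNullity w))) ∧
      Nonempty (PrimeSpectrum (LaurentRing K (diagramNullity w)) ≃ₜ quantumStratum q m p w)) ∧
    ∃ Φ : NCSpec (QuantumMatrices q m p) ≃ PoissonSpec K m p,
      ∀ w ∈ quantumDiagrams q m p,
        ∃ h : quantumStratum q m p w ≃ₜ poissonStratum K m p w,
          ∀ P : quantumStratum q m p w, (h P : PoissonSpec K m p) = Φ P := by
  open DeletingDerivations in
  obtain ⟨q, rfl⟩ : ∃ q' : Kˣ, (q' : K) = q := ⟨Units.mk0 q hq0, rfl⟩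
  have hS := idealSpace_quantum (m := m) (p := p) q
  have hG := torusClass_stageIdeal (m := m) (p := p) hq
  have hX := stageModel_quantumGens (m := m) (p := p) (q := q)
  have hS' := idealSpace_poisson (K := K) (m := m) (p := p)
  have hG' := torusClass_poissonStageIdeal (K := K) (m := m) (p := p)
  have hX' := stageModel_poissonGens (K := K) (m := m) (p := p)
  have hw : ∀ w, w ∈ quantumDiagrams (q : K) m p ↔ IsCauchonBelow w (m * p) := fun w =>
    (exists_congr fun _ => (inStratum_quantumPullback_iff q).symm).trans
      (exists_inStratum_iff hS hG hX w)
  have hw' : ∀ w, w ∈ poissonDiagrams K m p ↔ IsCauchonBelow w (m * p) := fun w =>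
    (exists_congr fun _ => inStratum_poissonPullback_iff.symm).trans
      (exists_inStratum_iff hS' hG' hX' w)
  let e : ∀ w, IsCauchonBelow w (m * p) →
      (PrimeSpectrum (LaurentRing K (diagramNullity w)) ≃ₜ quantumStratum (q : K) m p w) :=
    fun w h => (stratumHomeomorph hS hG hX h).trans
      (Homeomorph.setCongr (Set.ext fun _ => inStratum_quantumPullback_iff q))
  let e' : ∀ w, IsCauchonBelow w (m * p) →
      (PrimeSpectrum (LaurentRing K (diagramNullity w)) ≃ₜ poissonStratum K m p w) :=
    fun w h => (stratumHomeomorph hS' hG' hX' h).trans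
      (Homeomorph.setCongr (Set.ext fun _ => inStratum_poissonPullback_iff))
  refine ⟨Set.ext fun w => (hw w).trans (hw' w).symm,
    fun w h => ⟨⟨(e' w ((hw w).1 h)).symm⟩, ⟨e w ((hw w).1 h)⟩⟩,
    (spectrumEquiv hS hG hX).symm.trans (spectrumEquiv hS' hG' hX'), fun w h =>
    ⟨(e w ((hw w).1 h)).symm.trans (e' w ((hw w).1 h)), fun P => ?_⟩⟩
  obtain ⟨𝔭, rfl⟩ := (e w ((hw w).1 h)).surjective P
  rw [Homeomorph.trans_apply, Homeomorph.symm_apply_apply]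
  -- The chart of a stratum and the global parametrization send a prime of the Laurent ring to the
  -- same point, on both sides; so the homeomorphism of strata is a restriction of the global
  -- bijection.
  have h1 : ((e w ((hw w).1 h) 𝔭 : quantumStratum (q : K) m p w) : NCSpec _)
      = spectrumEquiv hS hG hX ⟨⟨w, (hw w).1 h⟩, 𝔭⟩ := rfl
  rw [h1, Equiv.trans_apply, Equiv.symm_apply_apply]
  rfl
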